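/- Fix an infinite set $\mathbb{D}$ of data values. A data word over a finite alphabet $A$ is a finite word over $A\times\mathbb{D}$. \textbf{Automata.} Let $\Gamma$ be a finite stack alphabet. A $0$-stack is a pair consisting of a symbol of $\Gamma$ and either a data value or the mark $\mathsf{no\text{-}data}$; a $k$-stack is a finite sequence of $(k-1)$-stacks, with its top at the end and its size being its length. An $n$-stack is well formed if every $k$-stack in it, $1\le k\le n$, is nonempty. A deterministic higher-order pushdown automaton with data of level $n$ has finite input and stack alphabets $A,\Gamma$, an initial stack symbol $\gamma_I$, a finite state set $Q$ with an initial state $q_I$ and a set $F$ of accepting states, and a partial transition function from $Q\times\Gamma\times(A\cup\{\varepsilon\})$ to $Q\times OP$ that is never defined both for $(q,\alpha,\varepsilon)$ and for $(q,\alpha,a)$ with $a\in A$. Here $OP$ consists of the operations $\mathsf{pop}^k$ and $\mathsf{push}^k_\beta$ with $1\le k\le n$, $\beta\in\Gamma$. A configuration is a state together with a well-formed $n$-stack; the initial one is $q_I$ with the stack whose only $0$-stack is $(\gamma_I,\mathsf{no\text{-}data})$. The transition is determined by the state, the symbol of the topmost $0$-stack and the letter $a\in A$ read (or $\varepsilon$).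 The operation $\mathsf{pop}^k$ removes the topmost $(k-1)$-stack from the topmost $k$-stack (the result has to be well formed); if the step reads a letter, its data value has to be equal to the one in the topmost $0$-stack. The operation $\mathsf{push}^k_\beta$ duplicates the topmost $(k-1)$-stack in the topmost $k$-stack and then replaces the topmost $0$-stack by $\beta$ with the data value just read ($\mathsf{no\text{-}data}$ in an $\varepsilon$-step). A data word is accepted if it is read by some run from the initial configuration to a configuration with an accepting state; an automaton recognizes the set of data words that it accepts. A deterministic collapsible pushdown automaton with data of level $n$ is defined likewise, except that each $0$-stack stores additionally $n$ numbers $k_1,\dots,k_n$: every push stores in the topmost $0$-stack the numbers $k_i$ such that the topmost $i$-stack has size $k_i$ after the operation (in the initial configuration all are $1$). There are additional operations $\mathsf{collapse}^i$, $1\le i\le n$, which remove $(i-1)$-stacks from the top of the topmost $i$-stack so that only $k_i-1$ of them are left, where $k_i$ is the number stored in the topmost $0$-stack; the conditions on well-formedness and on a data value read in the same step are as for $\mathsf{pop}$. \textbf{The language.} Let $U$ be the set of data words $w$ over the alphabet $\{[,\,],\,\$\}$ such that (i) $w$ contains exactly one dollar; (ii) $w$ without the dollar is a well-formed bracket expression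 (in each prefix there are at most as many closing as opening brackets, and in the whole word these numbers are equal); (iii) the suffix of $w$ after the dollar is symmetric to the prefix $p$ of $w$ that ends on the last opening bracket which is not closed before the dollar ($p$ is empty if there is no such bracket): it has the same length as $p$, and for each $i\le |p|$ the $i$-th letter from the beginning and the $i$-th letter from the end of $w$ have the same data value, and one of them is $[$ and the other is $]$. \textbf{Theorem.} The data language $U$ is recognized by a deterministic collapsible pushdown automaton with data of level $2$, but for every $n$ it is not recognized by any deterministic higher-order pushdown automaton with data (without collapse) of level $n$. In particular, there exists a data language with these two properties. -/

import Mathlib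

universe u v

/-! ### Higher-order stacks -/

/-- `Stk S k` is the set of `k`-stacks whose `0`-stacks are the elements of `S`:
a `0`-stack is an element of `S`, a `(k+1)`-stack is a (possibly empty) sequence of `k`-stacks.
The top of a stack is the *head* of the list. -/
def Stk (S : Type u) : ℕ → Type u
  | 0 => S
  | k + 1 => List (Stk S k)

namespace Stk

variable {S : Type u}

/-- Every stack of level at least `1` occurring in the given `n`-stack (itself included)
is nonempty. -/
def WellFormed : (n : ℕ) → Stk S n → Prop
  | 0, _ => True
  | n + 1, s => List.length s ≠ 0 ∧ ∀ t : Stk S n, List.Mem t s → WellFormed n t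

/-- The stack containing only one `0`-stack, namely `x`. -/
def single (x : S) : (n : ℕ) → Stk S n
  | 0 => x
  | n + 1 => ([single x n] : List (Stk S n))

/-- The topmost `0`-stack (it exists whenever the stack is well formed). -/
def top : (n : ℕ) → Stk S n → Option S
  | 0, x => some x
  | _ + 1, [] => none
  | n + 1, t :: _ => top n t

/-- Replace the topmost `0`-stack by `x`. -/
def setTop (x : S) : (n : ℕ) → Stk S n → Stk S n
  | 0, _ => x
  | _ + 1, [] => ([] : List _)
  | n + 1, t :: s => (setTop x n t :: s : List (Stk S n))

/-- The size of the topmost `k`-stack of an `n`-stack (for `1 ≤ k ≤ n`). -/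
def topSize (k : ℕ) : (n : ℕ) → Stk S n → ℕ
  | 0, _ => 0
  | _ + 1, [] => 0
  | n + 1, t :: s => if k = n + 1 then List.length (t :: s) else topSize k n t

/-- Replace the topmost `k`-stack `s : t` of an `n`-stack by `s` (for `1 ≤ k ≤ n`). -/
def pop (k : ℕ) : (n : ℕ) → Stk S n → Stk S n
  | 0, x => x
  | _ + 1, [] => ([] : List _)
  | n + 1, t :: s => if k = n + 1 then s else (pop k n t :: s : List (Stk S n))

/-- Replace the topmost `k`-stack `s : t` of an `n`-stack by `(s : t) : t` (for `1 ≤ k ≤ n`). -/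
def dup (k : ℕ) : (n : ℕ) → Stk S n → Stk S n
  | 0, x => x
  | _ + 1, [] => ([] : List _)
  | n + 1, t :: s =>
    if k = n + 1 then (t :: t :: s : List (Stk S n)) else (dup k n t :: s : List (Stk S n))

/-- From the topmost `k`-stack of an `n`-stack remove its topmost `(k-1)`-stacks, so that only
`m` of them (the bottommost ones) are left (for `1 ≤ k ≤ n`). -/
def keep (k m : ℕ) : (n : ℕ) → Stk S n → Stk S n
  | 0, x => x
  | _ + 1, [] => ([] : List _)
  | n + 1, t :: s =>
    if k = n + 1 then List.drop (List.length (t :: s) - m) (t :: s)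
    else (keep k m n t :: s : List (Stk S n))

theorem single_wellFormed (x : S) : (n : ℕ) → WellFormed n (single x n)
  | 0 => trivial
  | n + 1 => by
    refine ⟨Nat.one_ne_zero, fun t ht => ?_⟩
    have h : t = single x n := List.mem_singleton.1 ht
    rw [h]
    exact single_wellFormed x n

end Stk

/-! ### Data words and runs -/

/-- Data words over the alphabet `A` with data values in `D`. -/
abbrev DataWord (A : Type u) (D : Type v) := List (A × D)

/-- `Run step c w c'`: there is a run from `c` to `c'` that reads the data word `w`.
A step labelled `none` is an `ε`-step, a step labelled `some (a, d)` reads `(a, d)`. -/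
inductive Run {C : Type u} {X : Type v} (step : C → Option X → C → Prop) : C → List X → C → Prop
  | nil (c : C) : Run step c [] c
  | eps {c c' c'' : C} {w : List X} : step c none c' → Run step c' w c'' → Run step c w c''
  | read {c c' c'' : C} {x : X} {w : List X} :
      step c (some x) c' → Run step c' w c'' → Run step c (x :: w) c''

/-! ### Higher-order pushdown automata with data -/

/-- Operations of an automaton of level `n` without collapse. An index `k : Fin n` stands for
the level `k + 1`, so that the levels range over `1, …, n`. -/
inductive HOp (Γ : Type) (n : ℕ) where
  | pop (k : Fin n)
  | push (k : Fin n) (β : Γ)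

/-- Deterministic higher-order pushdown automata with data of level `n` over the input
alphabet `A`. In the transition function, `none : Option A` stands for `ε`. -/
structure HOPAD (A : Type) (n : ℕ) where
  /-- stack alphabet -/
  Γ : Type
  finΓ : Finite Γ
  /-- initial stack symbol -/
  γI : Γ
  /-- states -/
  Q : Type
  finQ : Finite Q
  /-- initial state -/
  qI : Q
  /-- accepting states -/
  F : Set Q
  /-- transitions -/
  δ : Q → Γ → Option A → Option (Q × HOp Γ n)
  det : ∀ (q : Q) (α : Γ) (a : A), ¬ ((δ q α none).isSome ∧ (δ q α (some a)).isSome)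

namespace HOPAD

variable {A : Type} {n : ℕ}

/-- A `0`-stack: a stack symbol and possibly a data value (`none` means no data). -/
abbrev Cell (M : HOPAD A n) (D : Type v) : Type v := M.Γ × Option D

/-- Configurations: a state and a well-formed `n`-stack. -/
structure Config (M : HOPAD A n) (D : Type v) where
  state : M.Q
  stack : Stk (M.Cell D) n
  wf : Stk.WellFormed n stack

/-- The initial configuration. -/
def init (M : HOPAD A n) (D : Type v) : M.Config D where
  state := M.qI
  stack := Stk.single (M.γI, none) n
  wf := Stk.single_wellFormed _ n

/-- The effect of an operation on the stack, where `x` is the data value just read (`none` for an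
`ε`-transition) and `d'` is the data value in the topmost `0`-stack of `s`. -/
def Effect (M : HOPAD A n) {D : Type v} (x d' : Option D) (s s' : Stk (M.Cell D) n) :
    HOp M.Γ n → Prop
  | HOp.pop k => (x = none ∨ x = d') ∧ s' = Stk.pop (k + 1) n s
  | HOp.push k β => s' = Stk.setTop (β, x) n (Stk.dup (k + 1) n s)

/-- One step of the automaton, labelled by the letter that it reads. -/
def Step (M : HOPAD A n) {D : Type v} (c : M.Config D) (x : Option (A × D)) (c' : M.Config D) :
    Prop :=
  ∃ (α : M.Γ) (d' : Option D) (op : HOp M.Γ n),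
    Stk.top n c.stack = some (α, d') ∧
    M.δ c.state α (x.map Prod.fst) = some (c'.state, op) ∧
    M.Effect (x.map Prod.snd) d' c.stack c'.stack op

/-- The set of data words accepted by the automaton. -/
def language (M : HOPAD A n) (D : Type v) : Set (DataWord A D) :=
  {w | ∃ c : M.Config D, Run M.Step (M.init D) w c ∧ c.state ∈ M.F}

end HOPAD

/-! ### Collapsible pushdown automata with data -/

/-- Operations of a collapsible automaton of level `n`; an index `k : Fin n` stands for the
level `k + 1`. -/
inductive COp (Γ : Type) (n : ℕ) where
  | pop (k : Fin n)
  | push (k : Fin n) (β : Γ)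
  | collapse (k : Fin n)

/-- Deterministic collapsible pushdown automata with data of level `n` over the input
alphabet `A`. In the transition function, `none : Option A` stands for `ε`. -/
structure CPAD (A : Type) (n : ℕ) where
  /-- stack alphabet -/
  Γ : Type
  finΓ : Finite Γ
  /-- initial stack symbol -/
  γI : Γ
  /-- states -/
  Q : Type
  finQ : Finite Q
  /-- initial state -/
  qI : Q
  /-- accepting states -/
  F : Set Q
  /-- transitions -/
  δ : Q → Γ → Option A → Option (Q × COp Γ n)
  det : ∀ (q : Q) (α : Γ) (a : A), ¬ ((δ q α none).isSome ∧ (δ q α (some a)).isSome)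

namespace CPAD

variable {A : Type} {n : ℕ}

/-- A `0`-stack: a stack symbol, possibly a data value (`none` means no data), and `n` numbers
`k₁, …, kₙ`, the number `kᵢ` being stored at the index `i - 1 : Fin n`. -/
abbrev Cell (M : CPAD A n) (D : Type v) : Type v := M.Γ × Option D × (Fin n → ℕ)

/-- Configurations: a state and a well-formed `n`-stack. -/
structure Config (M : CPAD A n) (D : Type v) where
  state : M.Q
  stack : Stk (M.Cell D) n
  wf : Stk.WellFormed n stack

/-- The initial configuration; the numbers stored in the only `0`-stack are the sizes of the
topmost stacks, which are all equal to `1`. -/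
def init (M : CPAD A n) (D : Type v) : M.Config D where
  state := M.qI
  stack := Stk.single (M.γI, none, fun _ => 1) n
  wf := Stk.single_wellFormed _ n

/-- The effect of an operation on the stack, where `x` is the data value just read (`none` for an
`ε`-transition), and `d'` and `ks` are the data value and the numbers in the topmost `0`-stack
of `s`. -/
def Effect (M : CPAD A n) {D : Type v} (x d' : Option D) (ks : Fin n → ℕ)
    (s s' : Stk (M.Cell D) n) : COp M.Γ n → Prop
  | COp.pop k => (x = none ∨ x = d') ∧ s' = Stk.pop (k + 1) n s
  | COp.push k β =>
    s' = Stk.setTop (β, x, fun i : Fin n => Stk.topSize (i + 1) n (Stk.dup (k + 1) n s)) n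
      (Stk.dup (k + 1) n s)
  | COp.collapse k => (x = none ∨ x = d') ∧ s' = Stk.keep (k + 1) (ks k - 1) n s

/-- One step of the automaton, labelled by the letter that it reads. -/
def Step (M : CPAD A n) {D : Type v} (c : M.Config D) (x : Option (A × D)) (c' : M.Config D) :
    Prop :=
  ∃ (α : M.Γ) (d' : Option D) (ks : Fin n → ℕ) (op : COp M.Γ n),
    Stk.top n c.stack = some (α, d', ks) ∧
    M.δ c.state α (x.map Prod.fst) = some (c'.state, op) ∧
    M.Effect (x.map Prod.snd) d' ks c.stack c'.stack op

/-- The set of data words accepted by the automaton. -/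
def language (M : CPAD A n) (D : Type v) : Set (DataWord A D) :=
  {w | ∃ c : M.Config D, Run M.Step (M.init D) w c ∧ c.state ∈ M.F}

end CPAD

/-! ### The separating language -/

/-- The alphabet consisting of an opening bracket, a closing bracket and a dollar. -/
inductive Letter where
  | opn
  | cls
  | dollar
deriving DecidableEq

/-- Well-formed bracket expressions: no dollars; in each prefix there are at most as many closing
as opening brackets; in the whole word these numbers are equal. -/
def WellBracketed (w : List Letter) : Prop :=
  Letter.dollar ∉ w ∧
  (∀ p : List Letter, p <+: w → p.count Letter.cls ≤ p.count Letter.opn) ∧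
  w.count Letter.cls = w.count Letter.opn

/-- `v` is symmetric to `p`: the `i`-th letter of `p` and the `i`-th letter of `v` from the end have
the same data value, and one of them is an opening bracket and the other a closing one. -/
def IsMirror {D : Type v} (p v : DataWord Letter D) : Prop :=
  List.Forall₂ (fun x y : Letter × D => x.2 = y.2 ∧
    ((x.1 = Letter.opn ∧ y.1 = Letter.cls) ∨ (x.1 = Letter.cls ∧ y.1 = Letter.opn))) p v.reverse

/-- The data language `U`: a word in it has exactly one dollar, it is well bracketed after removing
the dollar, and the part `v` after the dollar is symmetric to the prefix `p` that ends on the last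
opening bracket not closed before the dollar (`p` is empty if there is no such bracket).
Equivalently, what lies between `p` and the dollar is a well-formed bracket expression `m`, and
`p` is empty or ends with an opening bracket. -/
def langU (D : Type v) : Set (DataWord Letter D) :=
  {w | ∃ (p m v : DataWord Letter D) (d : D),
    w = p ++ m ++ (Letter.dollar, d) :: v ∧
    WellBracketed ((p ++ m ++ v).map Prod.fst) ∧
    IsMirror p v ∧
    WellBracketed (m.map Prod.fst) ∧
    (p = [] ∨ ∃ (p' : DataWord Letter D) (e : D), p = p' ++ [(Letter.opn, e)])}

/-!
# Collapse cannot be simulated by higher-order pushdown automata with data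

**A collapsible automaton of level 2.** It keeps the unclosed opening brackets of the word read so
far in its topmost `1`-stack, and below it, for every letter read so far, one `1`-stack having
this letter near its top. An opening bracket remembers the size of the `2`-stack, so
that a collapse at the last unclosed bracket uncovers exactly the stored letters of the prefix `p`;
then they are compared with the remaining letters, one by one (`Bracket.language_automaton`).

**No automaton without collapse.** Let `M` be an automaton of level `n` recognizing the language. If
the part `w` before the dollar has pairwise different data values, then all letters after
the dollar have to be read by pops: if one of them was read by a push, its data value
could be replaced by a fresh one (`HOPAD.exists_popRun`). In particular all data
values of the prefix `p` are still in the stack when the dollar comes. A contradiction is reached by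
showing, by induction on `k ≤ n`, that each word `w` can be prolonged by some `u` such that after
`w ++ u` a data value of `u` does not occur in the topmost `k`-stack (`HOPAD.Escapes`).

For the step from `k` to `k + 1`, suppose that from some `w₀` on the topmost `(k+1)`-stack
always contains all data values read after `w₀`. The induction hypothesis gives successive
prolongations `w₀ u₀ u₁ … u_N`, where `uᵢ` contains a data value `dᵢ` which disappears from the
topmost `k`-stack. Let closing brackets follow. The basic invariant `Stk.Evolve.suffix` says what
may happen to the topmost `(m+1)`-stack `x :: r` as long as it contains a mark located in its topmost
`0`-stack only: it becomes `l ++ r`, where `l` consists of modified copies of `x`. Hence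
all the topmost `(k+1)`-stacks have a common part at the bottom, outside of which no `dᵢ` occurs.

After `b` closing brackets only a bounded amount of information about the common part is
accessible. This is made precise by typings of stacks by finitely many types, compositional with
respect to adding a stack on top of a stack of the next level. Such a typing can be refined so that
the type of a stack determines the outcome of a given program working on the stack without
reading input (`Program.acc_of_refine_ty_eq`). Colour the data values, by `χ i`, so that only
the letters in `u₀ … u_N` are visible, and a mark at `dᵢ`. By induction on the level, for every
typing the colourings `χ i` split into a number of classes independent of `N`, such that colourings
from one class are not distinguished by the types at any moment of reading the closing
brackets (`HOPAD.exists_classes`). In the step of this induction, the colouring `χ i'` is put only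
on the topmost `m`-stack; a program which waits for the next closing bracket and then reports
the type of the part below the topmost `m`-stack cannot notice this, which by the invariant
transfers the equality of types to this part.

Finally let `i < i'` be in one class, which happens for large `N`, and close all brackets of
`uᵢ₊₁ … u_N`. The program `HOPAD.markProg`, which reads the dollar and then brackets by
pops as long as the colours allow, meets the mark under `χ i`, because `dᵢ` occurs in the prefix
`p = w₀ u₀ … uᵢ`, and does not meet it under `χ i'`: a contradiction.
-/

/-! ### Cellwise relations between higher-order stacks -/

namespace Stk

variable {S : Type u} {S' : Type v}

/-- Two stacks have the same shape, and their `0`-stacks are related by `R`. -/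
def Rel (R : S → S' → Prop) : (n : ℕ) → Stk S n → Stk S' n → Prop
  | 0, x, y => R x y
  | n + 1, s, t => List.Forall₂ (Rel R n) s t

/-- Apply a function to all `0`-stacks. -/
def map (f : S → S') : (n : ℕ) → Stk S n → Stk S' n
  | 0, x => f x
  | n + 1, s => List.map (map f n) s

/-- Some `0`-stack satisfies `P`. -/
def Any (P : S → Prop) : (n : ℕ) → Stk S n → Prop
  | 0, x => P x
  | n + 1, s => ∃ t : Stk S n, List.Mem t s ∧ Any P n t

section equations

variable {n : ℕ} (k : ℕ) (x : S) (t : Stk S n) (s : List (Stk S n))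

theorem pop_cons : pop k (n + 1) (t :: s : List (Stk S n)) =
    if k = n + 1 then s else (pop k n t :: s : List (Stk S n)) := rfl
theorem dup_cons : dup k (n + 1) (t :: s : List (Stk S n)) =
    if k = n + 1 then (t :: t :: s : List (Stk S n)) else (dup k n t :: s : List (Stk S n)) := rfl
theorem setTop_cons : setTop x (n + 1) (t :: s : List (Stk S n)) =
    (setTop x n t :: s : List (Stk S n)) := rfl

end equations

theorem rel_mono {R R' : S → S' → Prop} (h : ∀ a b, R a b → R' a b) :
    ∀ {n : ℕ} {s : Stk S n} {t : Stk S' n}, Rel R n s t → Rel R' n s t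
  | 0, _, _, H => h _ _ H
  | n + 1, s, t, H => List.Forall₂.imp (fun _ _ => rel_mono h (n := n)) (H : List.Forall₂ _ s t)

theorem rel_map_iff {f : S → S'} :
    ∀ {n : ℕ} {s : Stk S n} {t : Stk S' n}, Rel (fun a b => b = f a) n s t ↔ t = map f n s
  | 0, _, _ => Iff.rfl
  | n + 1, s, t => by
    change List.Forall₂ (Rel (fun a b => b = f a) n) s t ↔ t = List.map (map f n) s
    have : Rel (fun a b => b = f a) n = fun s t => t = map f n s := by
      funext s t; exact propext rel_map_iff
    rw [this]
    constructor
    · intro h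
      induction h with
      | nil => rfl
      | cons h _ ih => rw [List.map_cons, ← h, ← ih]
    · rintro rfl
      induction (s : List _) with
      | nil => exact .nil
      | cons a l ih => exact .cons rfl ih

theorem rel_map_self (f : S → S') (n : ℕ) (s : Stk S n) :
    Rel (fun a b => b = f a) n s (map f n s) := rel_map_iff.2 rfl

theorem rel_diag_iff {P : S → Prop} :
    ∀ {n : ℕ} {s t : Stk S n},
      Rel (fun a b => b = a ∧ P a) n s t ↔ t = s ∧ ¬ Any (fun a => ¬ P a) n s
  | 0, s, t => by
    change (t = s ∧ P s) ↔ (t = s ∧ ¬ ¬ P s)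
    rw [not_not]
  | n + 1, s, t => by
    change List.Forall₂ (Rel (fun a b => b = a ∧ P a) n) s t ↔
      t = s ∧ ¬ ∃ x : Stk S n, List.Mem x s ∧ Any (fun a => ¬ P a) n x
    have : Rel (fun a b => b = a ∧ P a) n = fun s t => t = s ∧ ¬ Any (fun a => ¬ P a) n s := by
      funext s t; exact propext rel_diag_iff
    rw [this]
    constructor
    · intro h
      induction h with
      | nil => exact ⟨rfl, fun ⟨x, hx, _⟩ => List.not_mem_nil hx⟩
      | @cons a b l l' h _ ih =>
        refine ⟨by rw [h.1, ih.1], ?_⟩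
        rintro ⟨x, hx, h'⟩
        rcases List.mem_cons.1 hx with rfl | hx
        · exact h.2 h'
        · exact ih.2 ⟨x, hx, h'⟩
    · rintro ⟨rfl, h⟩
      exact List.forall₂_same.2 fun x hx => ⟨rfl, fun h' => h ⟨x, hx, h'⟩⟩

theorem map_id : ∀ {n : ℕ} (s : Stk S n), map id n s = s
  | 0, _ => rfl
  | n + 1, s => (List.map_congr_left fun t _ => map_id (n := n) t).trans (List.map_id s)

variable {R : S → S' → Prop}

theorem rel_pop (k : ℕ) : ∀ {n : ℕ} {s : Stk S n} {t : Stk S' n},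
    Rel R n s t → Rel R n (pop k n s) (pop k n t)
  | 0, _, _, h => h
  | n + 1, s, t, h => by
    change List.Forall₂ _ s t at h
    cases h with
    | nil => exact .nil
    | cons h h' =>
      rw [pop_cons, pop_cons]
      split
      · exact h'
      · exact .cons (rel_pop k h) h'

theorem rel_dup (k : ℕ) : ∀ {n : ℕ} {s : Stk S n} {t : Stk S' n},
    Rel R n s t → Rel R n (dup k n s) (dup k n t)
  | 0, _, _, h => h
  | n + 1, s, t, h => by
    change List.Forall₂ _ s t at h
    cases h with
    | nil => exact .nil
    | cons h h' =>
      rw [dup_cons, dup_cons]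
      split
      · exact .cons h (.cons h h')
      · exact .cons (rel_dup k h) h'

theorem rel_setTop {b : S} {b' : S'} (hb : R b b') : ∀ {n : ℕ} {s : Stk S n} {t : Stk S' n},
    Rel R n s t → Rel R n (setTop b n s) (setTop b' n t)
  | 0, _, _, _ => hb
  | n + 1, s, t, h => by
    change List.Forall₂ _ s t at h
    cases h with
    | nil => exact .nil
    | cons h h' => exact .cons (rel_setTop hb h) h'

theorem rel_top : ∀ {n : ℕ} {s : Stk S n} {t : Stk S' n} {a : S},
    Rel R n s t → top n s = some a → ∃ b, top n t = some b ∧ R a b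
  | 0, _, _, _, h, ha => ⟨_, rfl, Option.some.inj ha ▸ h⟩
  | n + 1, s, t, a, h, ha => by
    change List.Forall₂ _ s t at h
    cases h with
    | nil => cases ha
    | cons h h' => exact rel_top (n := n) h ha

theorem rel_wellFormed : ∀ {n : ℕ} {s : Stk S n} {t : Stk S' n},
    Rel R n s t → WellFormed n s → WellFormed n t
  | 0, _, _, _, _ => trivial
  | n + 1, s, t, h, hs => by
    change List.Forall₂ _ s t at h
    obtain ⟨hlen, hs⟩ := hs
    refine ⟨h.length_eq ▸ hlen, fun y hy => ?_⟩
    clear hlen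
    induction h with
    | nil => exact absurd hy List.not_mem_nil
    | @cons a b l l' h _ ih =>
      rcases List.mem_cons.1 hy with rfl | hy
      · exact rel_wellFormed h (hs a List.mem_cons_self)
      · exact ih (fun x hx => hs x (List.mem_cons_of_mem _ hx)) hy

theorem map_congr {f g : S → S'} : ∀ {n : ℕ} {s : Stk S n},
    ¬ Any (fun a => f a ≠ g a) n s → map f n s = map g n s
  | 0, _, h => not_not.1 h
  | _ + 1, _, h => List.map_congr_left fun t ht => map_congr fun h' => h ⟨t, ht, h'⟩

/-! ### Occurrences of `0`-stacks under the stack operations -/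

section any

variable {P : S → Prop}

theorem any_cons {n : ℕ} {t : Stk S n} {s : List (Stk S n)} :
    Any P (n + 1) (t :: s : List (Stk S n)) ↔ Any P n t ∨ Any P (n + 1) s := by
  constructor
  · rintro ⟨x, hx, h⟩
    rcases List.mem_cons.1 hx with rfl | hx
    · exact .inl h
    · exact .inr ⟨x, hx, h⟩
  · rintro (h | ⟨x, hx, h⟩)
    · exact ⟨t, List.mem_cons_self, h⟩
    · exact ⟨x, List.mem_cons_of_mem _ hx, h⟩

theorem any_mono {P Q : S → Prop} (h : ∀ a, P a → Q a) : ∀ {n : ℕ} {s : Stk S n},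
    Any P n s → Any Q n s
  | 0, _, H => h _ H
  | _ + 1, _, ⟨t, ht, H⟩ => ⟨t, ht, any_mono h H⟩

theorem exists_of_any : ∀ {n : ℕ} {s : Stk S n}, Any P n s → ∃ a, P a ∧ Any (· = a) n s
  | 0, s, h => ⟨s, h, rfl⟩
  | _ + 1, _, ⟨t, ht, h⟩ =>
    have ⟨a, ha, h'⟩ := exists_of_any h
    ⟨a, ha, t, ht, h'⟩

theorem any_pop (k : ℕ) : ∀ {n : ℕ} {s : Stk S n}, Any P n (pop k n s) → Any P n s
  | 0, _, h => h
  | _ + 1, [], h => h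
  | n + 1, t :: s, h => by
    rw [pop_cons] at h
    split at h
    · exact any_cons.2 (.inr h)
    · rcases any_cons.1 h with h | h
      · exact any_cons.2 (.inl (any_pop k h))
      · exact any_cons.2 (.inr h)

theorem any_dup (k : ℕ) : ∀ {n : ℕ} {s : Stk S n}, Any P n (dup k n s) → Any P n s
  | 0, _, h => h
  | _ + 1, [], h => h
  | n + 1, t :: s, h => by
    rw [dup_cons] at h
    split at h
    · rcases any_cons.1 h with h | h
      · exact any_cons.2 (.inl h)
      · exact h
    · rcases any_cons.1 h with h | h
      · exact any_cons.2 (.inl (any_dup k h))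
      · exact any_cons.2 (.inr h)

theorem any_setTop {b : S} : ∀ {n : ℕ} {s : Stk S n}, Any P n (setTop b n s) → P b ∨ Any P n s
  | 0, _, h => .inl h
  | _ + 1, [], h => .inr h
  | n + 1, t :: s, h => by
    rw [setTop_cons] at h
    rcases any_cons.1 h with h | h
    · exact (any_setTop h).imp id fun h => any_cons.2 (.inl h)
    · exact .inr (any_cons.2 (.inr h))

theorem any_single {x : S} : ∀ {n : ℕ}, Any P n (single x n) → P x
  | 0, h => h
  | n + 1, ⟨t, ht, h⟩ => by
    have ht : t = single x n := List.mem_singleton.1 ht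
    rw [ht] at h
    exact any_single h

theorem any_of_top : ∀ {n : ℕ} {s : Stk S n} {a : S}, top n s = some a → P a → Any P n s
  | 0, _, _, h, ha => Option.some.inj h ▸ ha
  | _ + 1, [], _, h, _ => by cases h
  | n + 1, t :: s, a, h, ha => any_cons.2 (.inl (any_of_top (n := n) h ha))

end any

theorem top_setTop (b : S) : ∀ {n : ℕ} {s : Stk S n} {a : S}, top n s = some a →
    top n (setTop b n s) = some b
  | 0, _, _, _ => rfl
  | _ + 1, [], _, h => by cases h
  | n + 1, t :: s, a, h => top_setTop (n := n) b h

theorem top_dup (k : ℕ) : ∀ {n : ℕ} {s : Stk S n}, top n (dup k n s) = top n s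
  | 0, _ => rfl
  | _ + 1, [] => rfl
  | n + 1, t :: s => by
    rw [dup_cons]
    split
    · rfl
    · exact top_dup (n := n) k

/-! ### The topmost stack of a given level -/

/-- `IsTop x n s`: the `m`-stack `x` is the topmost `m`-stack of the `n`-stack `s`. -/
inductive IsTop {m : ℕ} (x : Stk S m) : (n : ℕ) → Stk S n → Prop
  | refl : IsTop x m x
  | cons {n : ℕ} (t : Stk S n) (s : List (Stk S n)) : IsTop x n t →
      IsTop x (n + 1) (t :: s : List (Stk S n))

theorem IsTop.le {m n : ℕ} {x : Stk S m} {s : Stk S n} (h : IsTop x n s) : m ≤ n := by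
  induction h with
  | refl => exact le_rfl
  | cons _ _ _ ih => exact ih.trans (Nat.le_succ _)

theorem IsTop.eq_of_level {m n : ℕ} {x : Stk S m} {s : Stk S n} (h : IsTop x n s) (e : n = m) :
    HEq s x := by
  cases h with
  | refl => rfl
  | cons t s h => have := h.le; omega

theorem IsTop.self_iff {m : ℕ} {x y : Stk S m} : IsTop x m y ↔ y = x :=
  ⟨fun h => eq_of_heq (h.eq_of_level rfl), fun h => h ▸ .refl⟩

theorem IsTop.inv {m n : ℕ} {x : Stk S m} {s : Stk S n} (h : IsTop x n s) (hmn : m < n) :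
    ∀ {k : ℕ}, n = k + 1 → ∃ (t : Stk S k) (r : List (Stk S k)),
      HEq s (t :: r : List (Stk S k)) ∧ IsTop x k t := by
  cases h with
  | refl => omega
  | cons t r h =>
    intro k e
    obtain rfl : _ = k := Nat.succ.inj e
    exact ⟨t, r, HEq.rfl, h⟩

theorem IsTop.cons_iff {m n : ℕ} (hmn : m ≤ n) {x : Stk S m} {t : Stk S n} {s : List (Stk S n)} :
    IsTop x (n + 1) (t :: s : List (Stk S n)) ↔ IsTop x n t := by
  refine ⟨fun h => ?_, .cons t s⟩
  obtain ⟨t', r, e, h'⟩ := h.inv (by omega) rfl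
  have e := eq_of_heq e
  rw [(List.cons.inj e).1]
  exact h'

theorem IsTop.exists_cons {m n : ℕ} (hmn : m ≤ n) {x : Stk S m} {s : List (Stk S n)}
    (h : IsTop x (n + 1) s) : ∃ t r, s = t :: r ∧ IsTop x n t := by
  obtain ⟨t', r, e, h'⟩ := h.inv (by omega) rfl
  exact ⟨t', r, eq_of_heq e, h'⟩

theorem IsTop.unique {m n : ℕ} {x y : Stk S m} {s : Stk S n} (hx : IsTop x n s)
    (hy : IsTop y n s) : x = y := by
  induction hx with
  | refl => exact self_iff.1 hy
  | cons t r h ih => exact ih ((cons_iff h.le).1 hy)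

theorem IsTop.trans {l m n : ℕ} {x : Stk S l} {y : Stk S m} {s : Stk S n} (hx : IsTop x m y)
    (hy : IsTop y n s) : IsTop x n s := by
  induction hy with
  | refl => exact hx
  | cons t r _ ih => exact .cons t r ih

theorem IsTop.any {m n : ℕ} {x : Stk S m} {s : Stk S n} (h : IsTop x n s) {P : S → Prop}
    (hP : Any P m x) : Any P n s := by
  induction h with
  | refl => exact hP
  | cons t r _ ih => exact any_cons.2 (.inl ih)

theorem IsTop.exists_of_wellFormed {m : ℕ} : ∀ {n : ℕ} {s : Stk S n}, WellFormed n s → m ≤ n →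
    ∃ x : Stk S m, IsTop x n s
  | n, s, h, hmn => by
    rcases hmn.eq_or_lt with rfl | hlt
    · exact ⟨s, .refl⟩
    · match n, s, h with
      | n + 1, [], h => exact absurd rfl h.1
      | n + 1, t :: s, h =>
        obtain ⟨x, hx⟩ := exists_of_wellFormed (h.2 t List.mem_cons_self) (Nat.le_of_lt_succ hlt)
        exact ⟨x, .cons t s hx⟩

theorem IsTop.wellFormed {m n : ℕ} {x : Stk S m} {s : Stk S n} (h : IsTop x n s)
    (hs : WellFormed n s) : WellFormed m x := by
  induction h with
  | refl => exact hs
  | cons t r _ ih => exact ih (hs.2 t List.mem_cons_self)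

theorem IsTop.top_eq {m n : ℕ} {x : Stk S m} {s : Stk S n} (h : IsTop x n s) :
    top n s = top m x := by
  induction h with
  | refl => rfl
  | cons t r _ ih => exact ih

theorem IsTop.rel {m n : ℕ} {x : Stk S m} {s : Stk S n} (h : IsTop x n s) {t : Stk S' n}
    (hst : Rel R n s t) : ∃ y : Stk S' m, IsTop y n t ∧ Rel R m x y := by
  induction h with
  | refl => exact ⟨t, .refl, hst⟩
  | @cons n a r _ ih =>
    change List.Forall₂ _ (a :: r) t at hst
    cases hst with
    | cons h1 h2 =>
      obtain ⟨y, hy, hxy⟩ := ih h1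
      exact ⟨y, .cons _ _ hy, hxy⟩

/-- Only the topmost `0`-stack may satisfy `P`. -/
def OnlyTop (P : S → Prop) : (n : ℕ) → Stk S n → Prop
  | 0, _ => True
  | _ + 1, [] => True
  | n + 1, t :: s => OnlyTop P n t ∧ ¬ Any P (n + 1) s

theorem onlyTop_setTop {P : S → Prop} (b : S) : ∀ {n : ℕ} {s : Stk S n}, ¬ Any P n s →
    OnlyTop P n (setTop b n s)
  | 0, _, _ => trivial
  | _ + 1, [], _ => trivial
  | _ + 1, _ :: _, h =>
    ⟨onlyTop_setTop b fun h' => h (any_cons.2 (.inl h')), fun h' => h (any_cons.2 (.inr h'))⟩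

theorem IsTop.onlyTop {P : S → Prop} {m n : ℕ} {x : Stk S m} {s : Stk S n} (h : IsTop x n s)
    (hs : OnlyTop P n s) : OnlyTop P m x := by
  induction h with
  | refl => exact hs
  | cons t r _ ih => exact ih hs.1

/-! ### Stacks evolving by the same operations -/

/-- `Evolve B n s t s' t'`: the pair `(s', t')` arises from `(s, t)` by performing the same
pops and pushes on both components, where the pairs of pushed `0`-stacks are related by `B`. -/
inductive Evolve (B : S → S' → Prop) (n : ℕ) (s : Stk S n) (t : Stk S' n) :
    Stk S n → Stk S' n → Prop
  | refl : Evolve B n s t s t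
  | pop {s' : Stk S n} {t' : Stk S' n} (k : ℕ) : Evolve B n s t s' t' →
      Evolve B n s t (pop k n s') (pop k n t')
  | push {s' : Stk S n} {t' : Stk S' n} (k : ℕ) {b : S} {b' : S'} : Evolve B n s t s' t' →
      B b b' → Evolve B n s t (setTop b n (dup k n s')) (setTop b' n (dup k n t'))

theorem Evolve.trans {B : S → S' → Prop} {n : ℕ} {s s₁ s₂ : Stk S n} {t t₁ t₂ : Stk S' n}
    (h : Evolve B n s t s₁ t₁) (h' : Evolve B n s₁ t₁ s₂ t₂) : Evolve B n s t s₂ t₂ := by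
  induction h' with
  | refl => exact h
  | pop k _ ih => exact .pop k ih
  | push k _ hb ih => exact .push k ih hb

theorem Evolve.mono {B B' : S → S' → Prop} (hB : ∀ a b, B a b → B' a b) {n : ℕ} {s s₁ : Stk S n}
    {t t₁ : Stk S' n} (h : Evolve B n s t s₁ t₁) : Evolve B' n s t s₁ t₁ := by
  induction h with
  | refl => exact .refl
  | pop k _ ih => exact .pop k ih
  | push k _ hb ih => exact .push k ih (hB _ _ hb)

theorem Evolve.rel {B : S → S' → Prop} {n : ℕ} {s s₁ : Stk S n} {t t₁ : Stk S' n}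
    (h : Evolve B n s t s₁ t₁) (hB : ∀ a b, B a b → R a b) (hst : Rel R n s t) :
    Rel R n s₁ t₁ := by
  induction h with
  | refl => exact hst
  | pop k _ ih => exact rel_pop k ih
  | push k _ hb ih => exact rel_setTop (hB _ _ hb) (rel_dup k ih)

theorem Evolve.any {B : S → S' → Prop} {P : S → Prop} {n : ℕ} {s s₁ : Stk S n} {t t₁ : Stk S' n}
    (h : Evolve B n s t s₁ t₁) (hs : Any P n s₁) : Any P n s ∨ ∃ a b, B a b ∧ P a := by
  induction h with
  | refl => exact .inl hs
  | pop k _ ih => exact ih (any_pop k hs)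
  | push k _ hb ih =>
    rcases any_setTop hs with hs | hs
    · exact .inr ⟨_, _, hb, hs⟩
    · exact ih (any_dup k hs)

/-- Lift a relation between `m`-stacks to `(m + j)`-stacks, elementwise. -/
def Lift {m : ℕ} (P : Stk S m → Stk S' m → Prop) : (j : ℕ) → Stk S (m + j) → Stk S' (m + j) → Prop
  | 0 => P
  | j + 1 => fun s t => List.Forall₂ (Lift P j) s t

section lift

variable {m : ℕ} {P : Stk S m → Stk S' m → Prop}

theorem lift_pop (k : ℕ) (hP : ∀ x y, P x y → P (pop k m x) (pop k m y)) :
    ∀ {j : ℕ} {s : Stk S (m + j)} {t : Stk S' (m + j)}, Lift P j s t →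
      Lift P j (pop k (m + j) s) (pop k (m + j) t)
  | 0, _, _, h => hP _ _ h
  | j + 1, s, t, h => by
    change List.Forall₂ _ s t at h
    cases h with
    | nil => exact .nil
    | cons h h' =>
      change List.Forall₂ _ (pop k (m + j + 1) _) (pop k (m + j + 1) _)
      rw [pop_cons, pop_cons]
      split
      · exact h'
      · exact .cons (lift_pop k hP h) h'

theorem lift_dup (k : ℕ) (hP : ∀ x y, P x y → P (dup k m x) (dup k m y)) :
    ∀ {j : ℕ} {s : Stk S (m + j)} {t : Stk S' (m + j)}, Lift P j s t →
      Lift P j (dup k (m + j) s) (dup k (m + j) t)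
  | 0, _, _, h => hP _ _ h
  | j + 1, s, t, h => by
    change List.Forall₂ _ s t at h
    cases h with
    | nil => exact .nil
    | cons h h' =>
      change List.Forall₂ _ (dup k (m + j + 1) _) (dup k (m + j + 1) _)
      rw [dup_cons, dup_cons]
      split
      · exact .cons h (.cons h h')
      · exact .cons (lift_dup k hP h) h'

theorem lift_setTop {b : S} {b' : S'} (hP : ∀ x y, P x y → P (setTop b m x) (setTop b' m y)) :
    ∀ {j : ℕ} {s : Stk S (m + j)} {t : Stk S' (m + j)}, Lift P j s t →
      Lift P j (setTop b (m + j) s) (setTop b' (m + j) t)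
  | 0, _, _, h => hP _ _ h
  | j + 1, s, t, h => by
    change List.Forall₂ _ s t at h
    cases h with
    | nil => exact .nil
    | cons h h' => exact .cons (lift_setTop hP h) h'

theorem lift_evolve {B : S → S' → Prop}
    (hpop : ∀ k x y, P x y → P (pop k m x) (pop k m y))
    (hdup : ∀ k x y, P x y → P (dup k m x) (dup k m y))
    (hset : ∀ b b' x y, B b b' → P x y → P (setTop b m x) (setTop b' m y))
    {j : ℕ} {s s₁ : Stk S (m + j)} {t t₁ : Stk S' (m + j)}
    (h : Evolve B (m + j) s t s₁ t₁) (hst : Lift P j s t) : Lift P j s₁ t₁ := by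
  induction h with
  | refl => exact hst
  | pop k _ ih => exact lift_pop k (hpop k) ih
  | push k _ hb ih => exact lift_setTop (fun _ _ => hset _ _ _ _ hb) (lift_dup k (hdup k) ih)

theorem lift_isTop : ∀ {j : ℕ} {s : Stk S (m + j)} {t : Stk S' (m + j)} {x : Stk S m},
    Lift P j s t → IsTop x (m + j) s → ∃ y : Stk S' m, IsTop y (m + j) t ∧ P x y
  | 0, s, t, x, h, hx => ⟨t, .refl, by
      have : s = x := IsTop.self_iff.1 hx
      exact this ▸ h⟩
  | j + 1, s, t, x, h, hx => by
    change List.Forall₂ _ s t at h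
    obtain ⟨a, r, rfl, ha⟩ := IsTop.exists_cons (Nat.le_add_right m j) hx
    cases h with
    | cons h h' =>
      obtain ⟨y, hy, hxy⟩ := lift_isTop h ha
      exact ⟨y, .cons _ _ hy, hxy⟩

theorem lift_of_rel {f : S → Prop} (hP : ∀ x y, Rel R m x y → ¬ Any f m x → P x y) :
    ∀ {j : ℕ} {s : Stk S (m + j)} {t : Stk S' (m + j)}, Rel R (m + j) s t →
      ¬ Any f (m + j) s → Lift P j s t
  | 0, s, t, h, hs => hP s t h hs
  | j + 1, s, t, h, hs => by
    change List.Forall₂ _ s t at h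
    change List.Forall₂ (Lift P j) s t
    induction h with
    | nil => exact .nil
    | cons h h' ih =>
      exact .cons (lift_of_rel hP h fun h' => hs (any_cons.2 (.inl h')))
        (ih fun h' => hs (any_cons.2 (.inr h')))

theorem lift_of_isTop {f : S → Prop} (hP : ∀ x y, Rel R m x y → ¬ Any f m x → P x y) :
    ∀ {j : ℕ} {s : Stk S (m + j)} {t : Stk S' (m + j)} {x : Stk S m} {y : Stk S' m},
      Rel R (m + j) s t → OnlyTop f (m + j) s → IsTop x (m + j) s → IsTop y (m + j) t →
      P x y → Lift P j s t
  | 0, s, t, x, y, _, _, hx, hy, hxy => by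
    obtain rfl : s = x := IsTop.self_iff.1 hx
    obtain rfl : t = y := IsTop.self_iff.1 hy
    exact hxy
  | j + 1, s, t, x, y, h, hs, hx, hy, hxy => by
    change List.Forall₂ _ s t at h
    obtain ⟨a, r, rfl, ha⟩ := IsTop.exists_cons (Nat.le_add_right m j) hx
    cases h with
    | cons h h' =>
      have hy := (IsTop.cons_iff (Nat.le_add_right m j)).1 hy
      have h2 : Lift P (j + 1) r _ := lift_of_rel hP (j := j + 1) (s := r) h' hs.2
      exact .cons (lift_of_isTop hP h hs.1 ha hy hxy) h2

end lift

/-- The key invariant. Suppose that the mark `f` occurs in `s` only in the topmost `0`-stack, and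
let `x :: r` be the topmost `(m+1)`-stack of `s`. After any sequence of operations not pushing the
mark, a topmost `(m+1)`-stack which contains the mark is `l ++ r`, where `l` consists of
modified copies of `x`. The same operations performed on a second stack `t` with topmost
`(m+1)`-stack `x' :: r'` give `l' ++ r'` with `l'` corresponding to `l`. -/
theorem Evolve.suffix {ρ σ : S → S' → Prop} {f : S → Prop}
    {m n : ℕ} (hmn : m < n) {s s₁ : Stk S n} {t t₁ : Stk S' n}
    {x : Stk S m} {x' : Stk S' m} {r : List (Stk S m)} {r' : List (Stk S' m)}
    (hst : Rel σ n s t) (hf : OnlyTop f n s)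
    (hs : IsTop (m := m + 1) (x :: r : List (Stk S m)) n s)
    (ht : IsTop (m := m + 1) (x' :: r' : List (Stk S' m)) n t) (hx : Rel ρ m x x')
    (h : Evolve (fun a b => ρ a b ∧ ¬ f a) n s t s₁ t₁)
    {y : List (Stk S m)} (hy : IsTop (m := m + 1) y n s₁) (hfy : Any f (m + 1) y) :
    ∃ l l', l ≠ [] ∧ y = l ++ r ∧ IsTop (m := m + 1) (l' ++ r' : List (Stk S' m)) n t₁ ∧
      List.Forall₂ (Rel ρ m) l l' := by
  obtain ⟨j, rfl⟩ : ∃ j, n = m + 1 + j := Nat.exists_eq_add_of_le hmn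
  have hr : ¬ Any f (m + 1) r := (hs.onlyTop hf).2
  let P : Stk S (m + 1) → Stk S' (m + 1) → Prop := fun Y Y' => Any f (m + 1) Y →
    ∃ l l', Y = l ++ r ∧ Y' = l' ++ r' ∧ List.Forall₂ (Rel ρ m) l l'
  have hP0 : ∀ Y Y', Rel σ (m + 1) Y Y' → ¬ Any f (m + 1) Y → P Y Y' :=
    fun _ _ _ h h' => absurd h' h
  have hlift : Lift P j s t := lift_of_isTop hP0 hst hf hs ht
    fun _ => ⟨[x], [x'], rfl, rfl, .cons hx .nil⟩
  have hlift' : Lift P j s₁ t₁ := by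
    refine lift_evolve ?_ ?_ ?_ h hlift
    · intro k Y Y' hY hfY
      obtain ⟨l, l', rfl, rfl, hl⟩ := hY (any_pop k hfY)
      cases hl with
      | nil => exact absurd (any_pop k hfY) hr
      | cons h1 h2 =>
        change ∃ l₂ l₂', Stk.pop k (m + 1) (_ :: (_ ++ r) : List (Stk S m)) = l₂ ++ r ∧
          Stk.pop k (m + 1) (_ :: (_ ++ r') : List (Stk S' m)) = l₂' ++ r' ∧ _
        rw [pop_cons, pop_cons]
        split
        · exact ⟨_, _, rfl, rfl, h2⟩
        · exact ⟨_ :: _, _ :: _, rfl, rfl, .cons (rel_pop k h1) h2⟩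
    · intro k Y Y' hY hfY
      obtain ⟨l, l', rfl, rfl, hl⟩ := hY (any_dup k hfY)
      cases hl with
      | nil => exact absurd (any_dup k hfY) hr
      | cons h1 h2 =>
        change ∃ l₂ l₂', dup k (m + 1) (_ :: (_ ++ r) : List (Stk S m)) = l₂ ++ r ∧
          dup k (m + 1) (_ :: (_ ++ r') : List (Stk S' m)) = l₂' ++ r' ∧ _
        rw [dup_cons, dup_cons]
        split
        · exact ⟨_ :: _ :: _, _ :: _ :: _, rfl, rfl, .cons h1 (.cons h1 h2)⟩
        · exact ⟨_ :: _, _ :: _, rfl, rfl, .cons (rel_dup k h1) h2⟩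
    · intro b b' Y Y' hb hY hfY
      have hfY' := (any_setTop hfY).resolve_left hb.2
      obtain ⟨l, l', rfl, rfl, hl⟩ := hY hfY'
      cases hl with
      | nil => exact absurd hfY' hr
      | cons h1 h2 =>
        exact ⟨_ :: _, _ :: _, rfl, rfl, .cons (rel_setTop hb.1 h1) h2⟩
  obtain ⟨y', hy', hyy'⟩ := lift_isTop hlift' hy
  obtain ⟨l, l', e, rfl, hl⟩ := hyy' hfy
  refine ⟨l, l', ?_, e, hy', hl⟩
  rintro rfl
  rw [e] at hfy
  exact hr hfy

end Stk

/-! ### Finite compositional typings of stacks and their refinement by a program -/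

/-- A typing of the `k`-stacks over `A`, for `k ≤ n`, by finitely many types, such that the type of
`t : s` depends only on the types of `t` and `s`. -/
structure FinTyping (A : Type) (n : ℕ) where
  /-- the types of `k`-stacks -/
  C : ℕ → Type
  fin : ∀ k, Finite (C k)
  /-- the type of a `k`-stack -/
  ty : (k : ℕ) → Stk A k → C k
  congr : ∀ k < n, ∀ (t t' : Stk A k) (s s' : List (Stk A k)), ty k t = ty k t' →
    ty (k + 1) s = ty (k + 1) s' →
    ty (k + 1) (t :: s : List (Stk A k)) = ty (k + 1) (t' :: s' : List (Stk A k))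

/-- Stack operations of a program; the levels are natural numbers. -/
inductive POp (A : Type) where
  | pop (k : ℕ)
  | push (k : ℕ) (b : A)

/-- The stack after an operation. -/
def POp.exec {A : Type} (n : ℕ) (s : Stk A n) : POp A → Stk A n
  | pop k => Stk.pop k n s
  | push k b => Stk.setTop b n (Stk.dup k n s)

/-- A deterministic program without input, working on stacks over `A`; configurations
may report elements of `O`. -/
structure Program (A P O : Type) where
  /-- the transition, depending on the state and the topmost symbol -/
  step : P → A → Option (P × POp A)
  /-- the elements reported by a configuration -/
  rep : P → O → (n : ℕ) → Stk A n → Prop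

namespace Program

variable {A P O : Type} (pr : Program A P O)

/-- `Acc n p s o`: the run from the state `p` and the stack `s` reaches a configuration
which reports `o`. -/
inductive Acc (n : ℕ) : P → Stk A n → O → Prop
  | rep {p : P} {s : Stk A n} {o : O} : pr.rep p o n s → Acc n p s o
  | step {p p' : P} {s : Stk A n} {o : O} {a : A} {op : POp A} : Stk.top n s = some a →
      pr.step p a = some (p', op) → Acc n p' (op.exec n s) o → Acc n p s o

variable {n : ℕ} (τ : FinTyping A n)

/-- Semantic domains: an element of `Dyn τ P O j k` describes a `k`-stack with `j` levels above it.
It maps the types and the descriptions of the rests of the higher levels to the set of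
pairs `(p, o)` such that `o` is reported when starting from the state `p`. -/
def Dyn (P O : Type) : ℕ → ℕ → Type
  | 0, _ => Set (P × O)
  | j + 1, k => τ.C (k + 1) × Dyn P O j (k + 1) → Dyn P O j (k + 1)

theorem finite_dyn [Finite P] [Finite O] : ∀ j k, Finite (Dyn τ P O j k)
  | 0, _ => inferInstanceAs (Finite (Set (P × O)))
  | j + 1, k => by
    have := finite_dyn j (k + 1)
    have := τ.fin (k + 1)
    exact inferInstanceAs (Finite (τ.C (k + 1) × Dyn τ P O j (k + 1) → Dyn τ P O j (k + 1)))

/-- The `k`-stack `x` realizes the description `f`: what `f` promises about runs starting with `x`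
on top of arbitrary rests that realize the arguments of `f` does hold. -/
def Real : (j k : ℕ) → Stk A k → Dyn τ P O j k → Prop
  | 0, k, x, f => ∀ po : P × O, Set.Mem (α := P × O) f po → pr.Acc k po.1 x po.2
  | j + 1, k, x, f => ∀ (r : List (Stk A k)) (ρ : Dyn τ P O j (k + 1)), Real j (k + 1) r ρ →
      Real j (k + 1) (x :: r : List (Stk A k)) (f (τ.ty (k + 1) r, ρ))

/-- The best description realized by all elements of a set of `k`-stacks. For a description
with arguments it is obtained by extending the stacks by all rests that realize the arguments. -/
def best : (j k : ℕ) → Set (Stk A k) → Dyn τ P O j k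
  | 0, k, X => {po : P × O | ∀ x ∈ X, pr.Acc k po.1 x po.2}
  | j + 1, k, X => fun ρ => best j (k + 1)
      {s : List (Stk A k) | ∃ x r, s = x :: r ∧ x ∈ X ∧ τ.ty (k + 1) r = ρ.1 ∧
        Real pr τ j (k + 1) r ρ.2}

theorem real_best : ∀ {j k : ℕ} {X : Set (Stk A k)} {x : Stk A k}, x ∈ X →
    Real pr τ j k x (best pr τ j k X)
  | 0, _, _, _, hx => fun _ hpo => (show ∀ x ∈ _, _ from hpo) _ hx
  | _ + 1, _, _, _, hx => fun _ _ hr => real_best ⟨_, _, rfl, hx, rfl, hr⟩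

/-- The compositional description of a stack, where a single symbol gets its best description. -/
noncomputable def den : (k j : ℕ) → Stk A k → Dyn τ P O j k
  | 0, j, a => best pr τ j 0 {a}
  | k + 1, j, s => List.rec (motive := fun _ => Dyn τ P O j (k + 1))
      (best pr τ j (k + 1) {([] : List (Stk A k))})
      (fun t s ih => den k (j + 1) t (τ.ty (k + 1) s, ih)) s

theorem den_cons {k j : ℕ} (t : Stk A k) (s : List (Stk A k)) :
    den pr τ (k + 1) j (t :: s : List (Stk A k)) =
      den pr τ k (j + 1) t (τ.ty (k + 1) s, den pr τ (k + 1) j s) := rfl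

theorem real_den : ∀ {k j : ℕ} (s : Stk A k), Real pr τ j k s (den pr τ k j s)
  | 0, _, _ => real_best pr τ rfl
  | k + 1, j, s => by
    change List (Stk A k) at s
    induction s with
    | nil => exact real_best pr τ (Set.mem_singleton _)
    | cons t s ih => exact (real_den t : Real pr τ (j + 1) k t _) s _ ih

/-- `Sim j k s s'`: the `k`-stacks `s` and `s'` have the same topmost symbol, and each rest of `s'`
has the same type as the corresponding rest of `s`, and realizes its description. -/
def Sim : (k j : ℕ) → Stk A k → Stk A k → Prop
  | 0, _, a, a' => a' = a
  | _ + 1, _, [], s' => s' = ([] : List _)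
  | _ + 1, _, _ :: _, [] => False
  | k + 1, j, t :: s, t' :: s' => Sim k (j + 1) t t' ∧ τ.ty (k + 1) s' = τ.ty (k + 1) s ∧
      Real pr τ j (k + 1) s' (den pr τ (k + 1) j s)

theorem sim_refl : ∀ {k j : ℕ} (s : Stk A k), Sim pr τ k j s s
  | 0, _, _ => rfl
  | _ + 1, _, [] => rfl
  | k + 1, _, t :: s => ⟨sim_refl (k := k) t, rfl, real_den pr τ (k := k + 1) s⟩

/-- The compositional description of `s` is the best one realized by all stacks similar to `s`. -/
theorem den_eq_best : ∀ {k j : ℕ} (s : Stk A k),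
    den pr τ k j s = best pr τ j k {s' | Sim pr τ k j s s'}
  | 0, _, _ => rfl
  | _ + 1, _, [] => rfl
  | k + 1, j, t :: s => by
    rw [den_cons, den_eq_best t]
    change best pr τ j (k + 1) _ = _
    congr 1
    ext s'
    constructor
    · rintro ⟨x, r, rfl, h1, h2, h3⟩
      exact ⟨h1, h2, h3⟩
    · intro h
      match s', h with
      | x :: r, ⟨h1, h2, h3⟩ => exact ⟨x, r, rfl, h1, h2, h3⟩

theorem Sim.real {k j : ℕ} {s s' : Stk A k} (h : Sim pr τ k j s s') :
    Real pr τ j k s' (den pr τ k j s) := by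
  rw [den_eq_best]
  exact real_best pr τ h

theorem Sim.ty : ∀ {k j : ℕ} {s s' : Stk A k}, k ≤ n → Sim pr τ k j s s' →
    τ.ty k s' = τ.ty k s
  | 0, _, _, _, _, h => by
    have h := (show _ = _ from h)
    rw [h]
  | _ + 1, _, [], _, _, h => by
    have h := (show _ = _ from h)
    rw [h]
  | k + 1, j, t :: s, t' :: s', hk, h => τ.congr k hk _ _ _ _ (Sim.ty (by omega) h.1) h.2.1

theorem Sim.top : ∀ {k j : ℕ} {s s' : Stk A k}, Sim pr τ k j s s' →
    Stk.top k s' = Stk.top k s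
  | 0, _, _, _, h => congrArg some h
  | _ + 1, _, [], _, h => by
    have h := (show _ = _ from h)
    rw [h]
  | k + 1, j, t :: s, t' :: s', h => Sim.top (k := k) h.1

theorem Sim.isTop {m : ℕ} : ∀ {k j : ℕ} {s s' : Stk A k} {x : Stk A m} {r : List (Stk A m)},
    Sim pr τ k j s s' → Stk.IsTop (m := m + 1) (x :: r : List (Stk A m)) k s →
    ∃ (x' : Stk A m) (r' : List (Stk A m)),
      Stk.IsTop (m := m + 1) (x' :: r' : List (Stk A m)) k s' ∧ τ.ty (m + 1) r' = τ.ty (m + 1) r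
  | 0, _, _, _, _, _, _, hx => absurd hx.le (by omega)
  | k + 1, j, s, s', x, r, h, hx => by
    rcases hx.le.eq_or_lt with e | hlt
    · obtain rfl : m = k := Nat.succ.inj e
      obtain rfl : s = (x :: r : List _) := Stk.IsTop.self_iff.1 hx
      match s', h with
      | x' :: r', h => exact ⟨x', r', .refl, h.2.1⟩
    · obtain ⟨t, s, rfl, ht⟩ := Stk.IsTop.exists_cons (by omega) hx
      match s', h with
      | t' :: s', h =>
        obtain ⟨x', r', h1, h2⟩ := Sim.isTop h.1 ht
        exact ⟨x', r', .cons _ _ h1, h2⟩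

/-- `t'` has the same type as `t` and realizes the description of `t`. -/
def Refines (k j : ℕ) (t t' : Stk A k) : Prop :=
  τ.ty k t' = τ.ty k t ∧ Real pr τ j k t' (den pr τ k j t)

theorem Refines.cons {k j : ℕ} (hk : k < n) {t t' : Stk A k} {s s' : List (Stk A k)}
    (h : Refines pr τ k (j + 1) t t') (h' : Refines pr τ (k + 1) j s s') :
    Refines pr τ (k + 1) j (t :: s : List (Stk A k)) (t' :: s' : List (Stk A k)) :=
  ⟨τ.congr k hk _ _ _ _ h.1 h'.1, by
    rw [den_cons, ← h'.1]
    exact h.2 s' _ h'.2⟩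

theorem Sim.refines {k j : ℕ} (hk : k ≤ n) {s s' : Stk A k} (h : Sim pr τ k j s s') :
    Refines pr τ k j s s' := ⟨h.ty pr τ hk, h.real⟩

theorem Sim.pop (i : ℕ) : ∀ {k j : ℕ} {s s' : Stk A k}, k ≤ n → Sim pr τ k j s s' →
    Refines pr τ k j (Stk.pop i k s) (Stk.pop i k s')
  | 0, _, _, _, hk, h => h.refines pr τ hk
  | _ + 1, _, [], _, hk, h => by
    obtain rfl := (show _ = _ from h)
    exact (sim_refl pr τ _).refines pr τ hk
  | k + 1, j, t :: s, t' :: s', hk, h => by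
    rw [Stk.pop_cons, Stk.pop_cons]
    split
    · exact h.2
    · exact Refines.cons pr τ hk (Sim.pop i (by omega) h.1) h.2

theorem Sim.dup (i : ℕ) : ∀ {k j : ℕ} {s s' : Stk A k}, k ≤ n → Sim pr τ k j s s' →
    Sim pr τ k j (Stk.dup i k s) (Stk.dup i k s')
  | 0, _, _, _, _, h => h
  | _ + 1, _, [], _, _, h => by
    obtain rfl := (show _ = _ from h)
    exact rfl
  | k + 1, j, t :: s, t' :: s', hk, h => by
    rw [Stk.dup_cons, Stk.dup_cons]
    split
    · exact ⟨h.1, Refines.cons pr τ hk (h.1.refines pr τ (by omega)) h.2⟩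
    · exact ⟨Sim.dup i (by omega) h.1, h.2⟩

theorem Sim.setTop (b : A) : ∀ {k j : ℕ} {s s' : Stk A k}, Sim pr τ k j s s' →
    Sim pr τ k j (Stk.setTop b k s) (Stk.setTop b k s')
  | 0, _, _, _, _ => rfl
  | _ + 1, _, [], _, h => by
    obtain rfl := (show _ = _ from h)
    exact rfl
  | k + 1, j, t :: s, t' :: s', h => ⟨Sim.setTop b h.1, h.2⟩

/-- What is reported from `s` is reported from every `s'` similar to `s`. An operation makes `s'`
leave this class, but the new stack still realizes the description of the new `s`, and by
`den_eq_best` this description promises all that is common to the class of the new `s`. -/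
theorem Acc.of_sim (hrep : ∀ p o (s s' : Stk A n), Sim pr τ n 0 s s' → pr.rep p o n s →
    pr.rep p o n s') {p : P} {s : Stk A n} {o : O} (h : pr.Acc n p s o) :
    ∀ s', Sim pr τ n 0 s s' → pr.Acc n p s' o := by
  induction h with
  | rep h => exact fun s' hs => .rep (hrep _ _ _ _ hs h)
  | @step p p' s o a op ha hstep _ ih =>
    intro s' hs
    refine .step ((hs.top pr τ).trans ha) hstep ?_
    have key : Refines pr τ n 0 (op.exec n s) (op.exec n s') := by
      cases op with
      | pop k => exact hs.pop pr τ k le_rfl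
      | push k b => exact ((hs.dup pr τ k le_rfl).setTop pr τ b).refines pr τ le_rfl
    have key2 : ∀ po : P × O, _ → pr.Acc n po.1 _ po.2 := key.2
    refine key2 (p', o) ?_
    rw [den_eq_best]
    exact ih

/-- The description of a stack determines what is reported from it. -/
theorem acc_of_den_eq (hrep : ∀ p o (s s' : Stk A n), Sim pr τ n 0 s s' → pr.rep p o n s →
    pr.rep p o n s') {p : P} {s s' : Stk A n} {o : O}
    (e : den pr τ n 0 s = den pr τ n 0 s') (h : pr.Acc n p s o) : pr.Acc n p s' o := by
  have h1 : Set.Mem (α := P × O) (den pr τ n 0 s) (p, o) := by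
    rw [den_eq_best]
    exact h.of_sim pr τ hrep
  rw [e] at h1
  have h2 : Real pr τ 0 n s' (den pr τ n 0 s') := real_den pr τ s'
  exact (show ∀ po : P × O, _ → pr.Acc n po.1 _ po.2 from h2) _ h1

/-- The refinement of the typing `τ` by the descriptions with respect to a program. -/
noncomputable def refine [Finite P] [Finite O] : FinTyping A n where
  C k := τ.C k × Dyn τ P O (n - k) k
  fin k := by
    have := τ.fin k
    have := finite_dyn τ (P := P) (O := O) (n - k) k
    infer_instance
  ty k s := (τ.ty k s, den pr τ k (n - k) s)
  congr k hk t t' s s' h h' := by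
    rw [Prod.mk.injEq] at h h' ⊢
    refine ⟨τ.congr k hk _ _ _ _ h.1 h'.1, ?_⟩
    have ht : ∀ j, n - k = j → den pr τ k j t = den pr τ k j t' := by
      rintro _ rfl
      exact h.2
    rw [den_cons, den_cons, ht (n - (k + 1) + 1) (by omega), h'.1, h'.2]

theorem refine_ty_fst [Finite P] [Finite O] {k : ℕ} {s s' : Stk A k}
    (h : (refine pr τ).ty k s = (refine pr τ).ty k s') : τ.ty k s = τ.ty k s' :=
  congrArg Prod.fst h

/-- The refined type of a stack determines what is reported from it. -/
theorem acc_of_refine_ty_eq [Finite P] [Finite O]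
    (hrep : ∀ p o (s s' : Stk A n), Sim pr τ n 0 s s' → pr.rep p o n s → pr.rep p o n s')
    {p : P} {s s' : Stk A n} {o : O} (e : (refine pr τ).ty n s = (refine pr τ).ty n s')
    (h : pr.Acc n p s o) : pr.Acc n p s' o := by
  refine acc_of_den_eq pr τ hrep ?_ h
  have ht : ∀ j, n - n = j → den pr τ n j s = den pr τ n j s' := by
    rintro _ rfl
    exact congrArg Prod.snd e
  exact ht 0 (by omega)

end Program

/-! ### Programs simulating an automaton on coloured stacks -/

theorem FinTyping.append {A : Type} {n : ℕ} (τ : FinTyping A n) {k : ℕ} (hk : k < n)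
    (l : List (Stk A k)) {r r' : List (Stk A k)} (h : τ.ty (k + 1) r = τ.ty (k + 1) r') :
    τ.ty (k + 1) (l ++ r : List (Stk A k)) = τ.ty (k + 1) (l ++ r' : List (Stk A k)) := by
  induction l with
  | nil => exact h
  | cons t l ih => exact τ.congr k hk t t _ _ rfl ih

/-- Replacing the topmost `m`-stack by one of the same type does not change the type. -/
theorem FinTyping.exists_replace {S : Type v} {A : Type} {N : ℕ} (τ : FinTyping A N)
    {σ : S → A → Prop} {m n : ℕ} {a : Stk S m} {s : Stk S n} (h : Stk.IsTop a n s) (hn : n ≤ N)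
    {x x' : Stk A m} {t : Stk A n} (hst : Stk.Rel σ n s t) (hx : Stk.IsTop x n t)
    (hx' : Stk.Rel σ m a x') (e : τ.ty m x = τ.ty m x') :
    ∃ t', Stk.IsTop x' n t' ∧ τ.ty n t = τ.ty n t' ∧ Stk.Rel σ n s t' := by
  induction h with
  | refl =>
    obtain rfl := Stk.IsTop.self_iff.1 hx
    exact ⟨x', .refl, e, hx'⟩
  | @cons n b r hb ih =>
    change List.Forall₂ _ (b :: r) t at hst
    cases hst with
    | cons h1 h2 =>
      have hx := (Stk.IsTop.cons_iff hb.le).1 hx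
      obtain ⟨t', h3, h4, h5⟩ := ih (by omega) h1 hx
      exact ⟨_ :: _, .cons _ _ h3, τ.congr _ hn _ _ _ _ h4 rfl, .cons h5 h2⟩

namespace Program

variable {A P O : Type} {pr : Program A P O} {n : ℕ} {p p' : P} {s : Stk A n} {o : O}

theorem acc_step_iff {a : A} {op : POp A} (h : ¬ pr.rep p o n s) (ha : Stk.top n s = some a)
    (hstep : pr.step p a = some (p', op)) : pr.Acc n p s o ↔ pr.Acc n p' (op.exec n s) o := by
  refine ⟨fun H => ?_, .step ha hstep⟩
  cases H with
  | rep h' => exact absurd h' h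
  | step ha' hstep' h' =>
    obtain rfl := Option.some.inj (ha.symm.trans ha')
    have := Option.some.inj (hstep.symm.trans hstep')
    rw [Prod.mk.injEq] at this
    rw [this.1, this.2]
    exact h'

theorem acc_halt_iff (h : ∀ a, Stk.top n s = some a → pr.step p a = none) :
    pr.Acc n p s o ↔ pr.rep p o n s := by
  refine ⟨fun H => ?_, .rep⟩
  cases H with
  | rep h' => exact h'
  | step ha hstep h' =>
    rw [h _ ha] at hstep
    cases hstep

end Program

namespace HOPAD

variable {I : Type} {n : ℕ} (M : HOPAD I n) {D : Type v} {X : Type}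

/-- `M.PushRun a d c c'`: some `ε`-steps followed by a push which reads `(a, d)`. -/
def PushRun (a : I) (d : D) (c c' : M.Config D) : Prop :=
  ∃ c₁ : M.Config D, Run M.Step c [] c₁ ∧ ∃ α d' k β, Stk.top n c₁.stack = some (α, d') ∧
    M.δ c₁.state α (some a) = some (c'.state, HOp.push k β) ∧
    c'.stack = Stk.setTop (β, some d) n (Stk.dup (k + 1) n c₁.stack)

/-- The operation of a program on coloured stacks that corresponds to an operation of `M`;
the pushed symbols get no colour. -/
def colOp (M : HOPAD I n) (X : Type) : HOp M.Γ n → POp (M.Γ × Option X)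
  | .pop k => .pop (k + 1)
  | .push k β => .push (k + 1) (β, none)

/-- A program that first performs the `ε`-steps of `M` and a push reading the letter `a`
(mode `false`), and then (in mode `true`) proceeds according to `after`. -/
def prog {O : Type} (a : I)
    (after : M.Q → M.Γ → Option X → Option ((M.Q × Bool) × POp (M.Γ × Option X)))
    (rep : M.Q → O → (k : ℕ) → Stk (M.Γ × Option X) k → Prop) :
    Program (M.Γ × Option X) (M.Q × Bool) O where
  step p x := match p.2 with
    | true => after p.1 x.1 x.2
    | false => match M.δ p.1 x.1 none with
      | some (q, op) => some ((q, false), M.colOp X op)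
      | none => match M.δ p.1 x.1 (some a) with
        | some (q, .push k β) => some ((q, true), .push (k + 1) (β, none))
        | _ => none
  rep p o k s := p.2 = true ∧ rep p.1 o k s

variable {O : Type} {a : I}
    {after : M.Q → M.Γ → Option X → Option ((M.Q × Bool) × POp (M.Γ × Option X))}
    {rep : M.Q → O → (k : ℕ) → Stk (M.Γ × Option X) k → Prop}

/-- One `ε`-step of `M` on a stack, mirrored on a coloured stack. -/
theorem exists_colOp {c c' : M.Config D} (h : M.Step c none c') {t : Stk (M.Γ × Option X) n}
    (ht : Stk.Rel (fun x y => x.1 = y.1) n c.stack t) :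
    ∃ (γ : M.Γ) (x : Option X) (op : HOp M.Γ n), Stk.top n t = some (γ, x) ∧
      M.δ c.state γ none = some (c'.state, op) ∧
      Stk.Evolve (fun a b => a.2 = none ∧ b = (a.1, none)) n c.stack t c'.stack
        ((M.colOp X op).exec n t) := by
  obtain ⟨α, d', op, htop, hδ, he⟩ := h
  obtain ⟨⟨γ, x⟩, htop', hr⟩ := Stk.rel_top ht htop
  have hr : α = γ := hr
  subst hr
  refine ⟨α, x, op, htop', hδ, ?_⟩
  cases op with
  | pop k =>
    rw [he.2]
    exact .pop _ .refl
  | push k β =>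
    have he : c'.stack = Stk.setTop (β, none) n (Stk.dup (k + 1) n c.stack) := he
    rw [he]
    exact .push _ .refl ⟨rfl, rfl⟩

theorem prog_eps {c c' : M.Config D} (h : Run M.Step c [] c') {t : Stk (M.Γ × Option X) n}
    (ht : Stk.Rel (fun x y => x.1 = y.1) n c.stack t) :
    ∃ t', Stk.Evolve (fun a b => a.2 = none ∧ b = (a.1, none)) n c.stack t c'.stack t' ∧
      ∀ o, (M.prog a after rep).Acc n (c.state, false) t o ↔
        (M.prog a after rep).Acc n (c'.state, false) t' o := by
  generalize hw : ([] : DataWord I D) = w at h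
  induction h generalizing t with
  | nil c => exact ⟨t, .refl, fun _ => Iff.rfl⟩
  | read _ _ _ => cases hw
  | @eps c c₁ c₂ w h₁ h₂ ih =>
    obtain ⟨γ, x, op, htop, hδ, hev⟩ := M.exists_colOp h₁ ht
    obtain ⟨t', hev', hacc⟩ := ih (hev.rel (fun a b h => by rw [h.2]) ht) hw
    refine ⟨t', hev.trans hev', fun o => ?_⟩
    rw [← hacc]
    refine Program.acc_step_iff (fun h => Bool.false_ne_true h.1) htop ?_
    simp only [prog, hδ]

/-- A run of ε-steps and a push reading the letter, mirrored by the program. -/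
theorem prog_pushRun {c c' : M.Config D} {d : D} (h : M.PushRun a d c c')
    {t : Stk (M.Γ × Option X) n} (ht : Stk.Rel (fun x y => x.1 = y.1) n c.stack t) :
    ∃ t', Stk.Evolve (fun a b => (a.2 = none ∨ a.2 = some d) ∧ b = (a.1, none)) n
        c.stack t c'.stack t' ∧
      ∀ o, (M.prog a after rep).Acc n (c.state, false) t o ↔
        (M.prog a after rep).Acc n (c'.state, true) t' o := by
  obtain ⟨c₁, hrun, α, d', k, β, htop, hδ, hst⟩ := h
  obtain ⟨t₁, hev, hacc⟩ := M.prog_eps (a := a) (after := after) (rep := rep) hrun ht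
  obtain ⟨⟨γ, x⟩, htop', hr⟩ := Stk.rel_top (hev.rel (fun a b h => by rw [h.2]) ht) htop
  have hr : α = γ := hr
  subst hr
  refine ⟨Stk.setTop (β, none) n (Stk.dup (k + 1) n t₁), ?_, fun o => ?_⟩
  · rw [hst]
    exact .push _ (hev.mono fun a b h => ⟨.inl h.1, h.2⟩) ⟨.inr rfl, rfl⟩
  · rw [hacc]
    refine Program.acc_step_iff (fun h => Bool.false_ne_true h.1) htop' (op := .push (k + 1) _) ?_
    have hnone : M.δ c₁.state α none = none := by
      have := M.det c₁.state α a
      rw [hδ] at this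
      simpa using this
    simp only [prog, hnone, hδ]

/-! ### Colourings that cannot be distinguished -/

/-- Recolour a `0`-stack: a data value is replaced by its colour, if it has one. -/
def colour {D : Type v} (χ : D → Option X) (x : M.Cell D) : M.Γ × Option X := (x.1, x.2.bind χ)

/-- A sequence of configurations `c 0, …, c L`, where each next one is reached from the previous
one by reading `(a, f (b + 1))` by a push, together with colourings `χ i` of data values. The
newest data value `f b` is only in the topmost `0`-stack of `c b`, and still in the topmost
`(k+1)`-stack of `c (b + 1)`. The values `f (b + 1)` have no colours, and all colourings
coincide on the topmost `(k+1)`-stacks, except on a common part `tail` at the bottom. -/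
structure PushChain {ι : Type} (a : I) (k L : ℕ) (c : ℕ → M.Config D) (f : ℕ → D)
    (χ : ι → D → Option X) : Prop where
  push : ∀ b < L, M.PushRun a (f (b + 1)) (c b) (c (b + 1))
  ne : ∀ b < L, f (b + 1) ≠ f b
  only : ∀ b ≤ L, Stk.OnlyTop (fun x => x.2 = some (f b)) n (c b).stack
  mem : ∀ b < L, ∀ y : Stk (M.Cell D) (k + 1), Stk.IsTop y n (c (b + 1)).stack →
    Stk.Any (fun x => x.2 = some (f b)) (k + 1) y
  fresh : ∀ b < L, ∀ i, χ i (f (b + 1)) = none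
  base : ∃ tail : List (Stk (M.Cell D) k), ∀ b ≤ L, ∃ stuff : List (Stk (M.Cell D) k),
    Stk.IsTop (m := k + 1) (stuff ++ tail : List _) n (c b).stack ∧
    ∀ i i', stuff.map (Stk.map (M.colour (χ i)) k) = stuff.map (Stk.map (M.colour (χ i')) k)

/-- A program reports the type of the rest of the topmost `(m+1)`-stack. -/
def restRep (T : FinTyping (M.Γ × Option X) n) (m : ℕ) (_ : M.Q) (o : T.C (m + 1)) (k : ℕ)
    (s : Stk (M.Γ × Option X) k) : Prop :=
  ∃ (x : Stk (M.Γ × Option X) m) (r : List (Stk (M.Γ × Option X) m)),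
    Stk.IsTop (m := m + 1) (x :: r : List (Stk (M.Γ × Option X) m)) k s ∧ T.ty (m + 1) r = o

theorem map_isTop {S : Type u} {S' : Type v} (g : S → S') {m n : ℕ} {x : Stk S m} {s : Stk S n}
    (h : Stk.IsTop x n s) : Stk.IsTop (Stk.map g m x) n (Stk.map g n s) := by
  obtain ⟨y, hy, hxy⟩ := h.rel (Stk.rel_map_self g n s)
  rwa [← Stk.rel_map_iff.1 hxy]

theorem rel_fst_map {χ : D → Option X} {m : ℕ} (s : Stk (M.Cell D) m) :
    Stk.Rel (fun x y => x.1 = y.1) m s (Stk.map (M.colour χ) m s) :=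
  Stk.rel_mono (fun _ _ h => by rw [h]; rfl) (Stk.rel_map_self (M.colour χ) m s)

theorem forall₂_rel_map {S : Type u} {S' : Type v} (g : S → S') {m : ℕ} {l : List (Stk S m)}
    {l' : List (Stk S' m)} (h : List.Forall₂ (Stk.Rel (fun x y => y = g x) m) l l') :
    l' = l.map (Stk.map g m) :=
  Stk.rel_map_iff (n := m + 1).1 h

/-- For every finite typing the colourings fall into finitely many classes (their number does not
depend on the chain), such that colourings from the same class give the same types to all topmost
`m`-stacks in the chain. -/
theorem exists_classes (a : I) {k : ℕ} : ∀ m, k + 1 ≤ m → m ≤ n →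
    ∀ T : FinTyping (M.Γ × Option X) n, ∃ Z : Type, Finite Z ∧
      ∀ (ι : Type) (L : ℕ) (c : ℕ → M.Config D) (f : ℕ → D) (χ : ι → D → Option X),
        M.PushChain a k L c f χ → ∃ z : ι → Z, ∀ i i', z i = z i' → ∀ b ≤ L,
          ∀ x : Stk (M.Cell D) m, Stk.IsTop x n (c b).stack →
            T.ty m (Stk.map (M.colour (χ i)) m x) = T.ty m (Stk.map (M.colour (χ i')) m x) := by
  intro m hkm
  induction m, hkm using Nat.le_induction with
  | base =>
    intro hn T
    refine ⟨T.C (k + 1), T.fin _, fun ι L c f χ h => ?_⟩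
    obtain ⟨tail, htail⟩ := h.base
    refine ⟨fun i => T.ty (k + 1) (Stk.map (M.colour (χ i)) (k + 1) tail), ?_⟩
    intro i i' hz b hb x hx
    obtain ⟨stuff, hs, hi⟩ := htail b hb
    obtain rfl := hx.unique hs
    change T.ty (k + 1) (List.map _ (stuff ++ tail)) = T.ty (k + 1) (List.map _ (stuff ++ tail))
    rw [List.map_append, List.map_append, hi i i']
    exact T.append hn _ hz
  | succ m hkm ih =>
    intro hn T
    have := M.finQ
    have := T.fin (m + 1)
    let pr := M.prog a (fun _ _ _ => none) (M.restRep T m)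
    obtain ⟨Z, hZ, H⟩ := ih (by omega) (pr.refine T)
    refine ⟨Z × T.C (m + 1), inferInstance, fun ι L c f χ h => ?_⟩
    obtain ⟨z, hz⟩ := H ι L c f χ h
    have hsplit : ∀ b, ∃ (x : Stk (M.Cell D) m) (r : List (Stk (M.Cell D) m)),
        Stk.IsTop (m := m + 1) (x :: r : List _) n (c b).stack := by
      intro b
      obtain ⟨y, hy⟩ := Stk.IsTop.exists_of_wellFormed (c b).wf hn
      match y, hy with
      | [], hy => exact absurd rfl (hy.wellFormed (c b).wf).1
      | x :: r, hy => exact ⟨x, r, hy⟩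
    obtain ⟨x₀, r₀, h₀⟩ := hsplit 0
    refine ⟨fun i => (z i, T.ty (m + 1) (Stk.map (M.colour (χ i)) (m + 1) r₀)), ?_⟩
    intro i i' hzz
    rw [Prod.mk.injEq] at hzz
    have hz := hz i i' hzz.1
    have htop : ∀ {b} {x : Stk (M.Cell D) m} {r : List (Stk (M.Cell D) m)},
        Stk.IsTop (m := m + 1) (x :: r : List _) n (c b).stack → Stk.IsTop x n (c b).stack :=
      fun hx => Stk.IsTop.trans (.cons _ _ .refl) hx
    -- the rests of the topmost `(m+1)`-stacks have the same types
    have hrest : ∀ b ≤ L, ∀ (x : Stk (M.Cell D) m) (r : List (Stk (M.Cell D) m)),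
        Stk.IsTop (m := m + 1) (x :: r : List _) n (c b).stack →
        T.ty (m + 1) (r.map (Stk.map (M.colour (χ i)) m)) =
          T.ty (m + 1) (r.map (Stk.map (M.colour (χ i')) m)) := by
      intro b
      induction b with
      | zero =>
        intro _ x r hx
        obtain ⟨rfl, rfl⟩ := List.cons.inj (hx.unique h₀)
        exact hzz.2
      | succ b ihb =>
        intro hb x₁ r₁ hx₁
        obtain ⟨x, r, hx⟩ := hsplit b
        have hr := ihb (by omega) x r hx
        have hσ : Stk.Rel (fun x y => x.1 = y.1) n (c b).stack
            (Stk.map (M.colour (χ i)) n (c b).stack) := M.rel_fst_map _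
        -- the stack in which only the topmost `m`-stack is recoloured
        obtain ⟨t, ht, hty, hst⟩ := (pr.refine T).exists_replace hx le_rfl hσ
          (map_isTop (M.colour (χ i)) hx)
          (x' := (Stk.map (M.colour (χ i')) m x :: r.map (Stk.map (M.colour (χ i)) m) : List _))
          (.cons (M.rel_fst_map x) (M.rel_fst_map (m := m + 1) r))
          ((pr.refine T).congr m hn _ _ _ _ (hz b (by omega) x (htop hx)) rfl)
        have hpush := h.push b (by omega)
        obtain ⟨t₁, hev₁, hacc₁⟩ := M.prog_pushRun hpush hσ (after := fun _ _ _ => none)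
          (rep := M.restRep T m)
        obtain ⟨t₂, hev₂, hacc₂⟩ := M.prog_pushRun hpush hst (after := fun _ _ _ => none)
          (rep := M.restRep T m)
        have hB : ∀ (j : ι) (p : M.Cell D) (q : M.Γ × Option X),
            ((p.2 = none ∨ p.2 = some (f (b + 1))) ∧ q = (p.1, none)) →
            (q = M.colour (χ j) p) ∧ ¬ p.2 = some (f b) := by
          rintro j ⟨γ, d⟩ q ⟨h1 | h1, rfl⟩
          · have h1 : d = none := h1
            subst h1
            exact ⟨rfl, fun h => by cases h⟩
          · have h1 : d = some (f (b + 1)) := h1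
            subst h1
            refine ⟨?_, fun h' => h.ne b (by omega) (Option.some.inj h')⟩
            simp only [colour, Option.bind_some, h.fresh b hb j]
        have ht₁ : t₁ = Stk.map (M.colour (χ i)) n (c (b + 1)).stack :=
          Stk.rel_map_iff.1 (hev₁.rel (fun p q hpq => (hB i p q hpq).1) (Stk.rel_map_self _ _ _))
        have hmem : Stk.Any (fun x => x.2 = some (f b)) (m + 1) (x₁ :: r₁ : List _) := by
          obtain ⟨y, hy⟩ := Stk.IsTop.exists_of_wellFormed (c (b + 1)).wf (m := k + 1) (by omega)
          obtain ⟨y', hy'⟩ := Stk.IsTop.exists_of_wellFormed (hx₁.wellFormed (c (b + 1)).wf)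
            (m := k + 1) (by omega)
          obtain rfl := hy.unique (hy'.trans hx₁)
          exact hy'.any (h.mem b (by omega) y hy)
        obtain ⟨l, l', hl, hy, htop₂, hll⟩ := Stk.Evolve.suffix
          (ρ := fun p q => q = M.colour (χ i') p) (σ := fun x y => x.1 = y.1)
          (f := fun x => x.2 = some (f b)) (by omega) hst
          (h.only b (by omega)) hx ht (Stk.rel_map_self _ _ _) (hev₂.mono (hB i')) hx₁ hmem
        obtain rfl := forall₂_rel_map _ hll
        match l, hl, hy, htop₂ with
        | x₂ :: l, _, hy, htop₂ =>
          obtain ⟨rfl, rfl⟩ := List.cons.inj hy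
          have hA : pr.Acc n ((c b).state, false) (Stk.map (M.colour (χ i)) n (c b).stack)
              (T.ty (m + 1) ((l ++ r).map (Stk.map (M.colour (χ i)) m))) := by
            refine (hacc₁ _).2 (.rep ⟨rfl, ?_⟩)
            rw [ht₁]
            exact ⟨_, _, map_isTop (M.colour (χ i)) hx₁, rfl⟩
          have hA' := Program.acc_of_refine_ty_eq pr T (by
            rintro p o s s' hs ⟨hp, x, r, hx, hr⟩
            obtain ⟨x', r', hx', hr'⟩ := hs.isTop pr T hx
            exact ⟨hp, x', r', hx', hr'.trans hr⟩) hty hA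
          obtain ⟨-, x₃, r₃, hx₃, hr₃⟩ :=
            (Program.acc_halt_iff fun _ _ => rfl).1 ((hacc₂ _).1 hA')
          obtain ⟨-, rfl⟩ := List.cons.inj (hx₃.unique htop₂)
          change T.ty (m + 1) (List.map _ (l ++ r)) = T.ty (m + 1) (List.map _ (l ++ r))
          refine hr₃.symm.trans ?_
          rw [List.map_append]
          exact T.append hn _ hr
    intro b hb y hy
    obtain ⟨x, r, hx⟩ := hsplit b
    obtain rfl := hy.unique hx
    exact T.congr m hn _ _ _ _ (Program.refine_ty_fst pr T (hz b hb x (htop hx)))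
      (hrest b hb x r hx)

end HOPAD

/-! ### Bracket words and mirror images -/

namespace Letter

/-- The contribution of a letter to the balance. -/
def val : Letter → ℤ
  | opn => 1
  | cls => -1
  | dollar => 0

/-- Exchange opening and closing brackets. -/
def flip : Letter → Letter
  | opn => cls
  | cls => opn
  | dollar => dollar

@[simp] theorem flip_flip (l : Letter) : l.flip.flip = l := by cases l <;> rfl

theorem val_flip (l : Letter) : l.flip.val = -l.val := by cases l <;> rfl

/-- The number of opening brackets minus the number of closing brackets. -/
def bal : List Letter → ℤ
  | [] => 0
  | l :: w => l.val + bal w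

@[simp] theorem bal_nil : bal [] = 0 := rfl
@[simp] theorem bal_cons (l : Letter) (w : List Letter) : bal (l :: w) = l.val + bal w := rfl

@[simp] theorem bal_append (w w' : List Letter) : bal (w ++ w') = bal w + bal w' := by
  induction w with
  | nil => simp
  | cons l w ih => simp [ih, add_assoc]

theorem bal_eq (w : List Letter) : bal w = w.count opn - w.count cls := by
  induction w with
  | nil => rfl
  | cons l w ih => cases l <;> simp [ih, val] <;> ring

/-- Starting from the balance `z`, the balance never gets negative. -/
def Nonneg : ℤ → List Letter → Prop
  | z, [] => 0 ≤ z
  | z, l :: w => 0 ≤ z ∧ Nonneg (z + l.val) w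

theorem Nonneg.start {z : ℤ} : ∀ {w : List Letter}, Nonneg z w → 0 ≤ z
  | [], h => h
  | _ :: _, h => h.1

theorem nonneg_append {z : ℤ} {w w' : List Letter} :
    Nonneg z (w ++ w') ↔ Nonneg z w ∧ Nonneg (z + bal w) w' := by
  induction w generalizing z with
  | nil =>
    simp only [List.nil_append, bal_nil, add_zero]
    exact ⟨fun h => ⟨h.start, h⟩, And.right⟩
  | cons l w ih =>
    change (0 ≤ z ∧ Nonneg _ (w ++ w')) ↔ (0 ≤ z ∧ Nonneg _ w) ∧ _
    rw [ih, bal_cons, ← add_assoc, and_assoc]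

theorem Nonneg.mono {z z' : ℤ} (hz : z ≤ z') : ∀ {w : List Letter}, Nonneg z w → Nonneg z' w
  | [], h => le_trans h hz
  | _ :: _, h => ⟨h.1.trans hz, h.2.mono (by omega)⟩

theorem Nonneg.bal_nonneg {z : ℤ} {w : List Letter} (h : Nonneg z w) : 0 ≤ z + bal w :=
  (nonneg_append (w' := [])).1 ((List.append_nil w).symm ▸ h) |>.2

theorem nonneg_iff {z : ℤ} {w : List Letter} :
    Nonneg z w ↔ ∀ p, p <+: w → (p.count cls : ℤ) ≤ z + p.count opn := by
  induction w generalizing z with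
  | nil =>
    refine ⟨fun h p hp => ?_, fun h => show 0 ≤ z by simpa using h [] List.prefix_rfl⟩
    rw [List.prefix_nil.1 hp]
    simpa using (show 0 ≤ z from h)
  | cons l w ih =>
    change (0 ≤ z ∧ Nonneg _ w) ↔ _
    rw [ih]
    constructor
    · rintro ⟨hz, h⟩ p hp
      match p, hp with
      | [], _ => simpa using hz
      | l' :: p, hp =>
        obtain ⟨rfl, hp'⟩ := List.cons_prefix_cons.1 hp
        have := h p hp'
        cases l' <;> simp [val] at this ⊢ <;> linarith
    · intro h
      refine ⟨by simpa using h [] List.nil_prefix, fun p hp => ?_⟩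
      have := h (l :: p) (List.cons_prefix_cons.2 ⟨rfl, hp⟩)
      cases l <;> simp [val] at this ⊢ <;> linarith

theorem wellBracketed_iff {w : List Letter} :
    WellBracketed w ↔ dollar ∉ w ∧ Nonneg 0 w ∧ bal w = 0 := by
  unfold WellBracketed
  rw [nonneg_iff, bal_eq, sub_eq_zero]
  simp only [zero_add, Nat.cast_le, Nat.cast_inj]
  exact and_congr_right fun _ => and_congr_right fun _ => eq_comm

theorem nonneg_replicate_cls {z : ℤ} {b : ℕ} (h : (b : ℤ) ≤ z) :
    Nonneg z (List.replicate b cls) := by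
  induction b generalizing z with
  | zero => exact_mod_cast h
  | succ b ih =>
    push_cast at h
    exact ⟨by omega, ih (by simp only [val]; omega)⟩

theorem bal_replicate_cls (b : ℕ) : bal (List.replicate b cls) = -b := by
  induction b with
  | zero => rfl
  | succ b ih => rw [List.replicate_succ, bal_cons, ih, val]; push_cast; ring

end Letter

open Letter

section words

variable {D : Type v}

/-- The mirror image of a data word. -/
def mirror (w : DataWord Letter D) : DataWord Letter D :=
  (w.map fun x => (x.1.flip, x.2)).reverse

@[simp] theorem mirror_nil : mirror ([] : DataWord Letter D) = [] := rfl

theorem mirror_cons (x : Letter × D) (w : DataWord Letter D) :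
    mirror (x :: w) = mirror w ++ [(x.1.flip, x.2)] := by
  simp [mirror]

theorem mirror_append (w w' : DataWord Letter D) :
    mirror (w ++ w') = mirror w' ++ mirror w := by
  simp [mirror]

theorem mem_mirror {w : DataWord Letter D} {x : Letter × D} :
    x ∈ mirror w ↔ (x.1.flip, x.2) ∈ w := by
  obtain ⟨l, d⟩ := x
  simp only [mirror, List.mem_reverse, List.mem_map, Prod.mk.injEq, Prod.exists]
  constructor
  · rintro ⟨l', d', h, rfl, rfl⟩
    rwa [Letter.flip_flip]
  · exact fun h => ⟨_, _, h, Letter.flip_flip l, rfl⟩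

theorem isMirror_mirror {w : DataWord Letter D} (h : dollar ∉ w.map Prod.fst) :
    IsMirror w (mirror w) := by
  unfold IsMirror mirror
  rw [List.reverse_reverse, List.forall₂_map_right_iff, List.forall₂_same]
  rintro ⟨l, d⟩ hx
  refine ⟨rfl, ?_⟩
  cases l with
  | opn => exact .inl ⟨rfl, rfl⟩
  | cls => exact .inr ⟨rfl, rfl⟩
  | dollar => exact absurd (List.mem_map_of_mem hx) h

theorem bal_mirror (w : DataWord Letter D) :
    bal ((mirror w).map Prod.fst) = -bal (w.map Prod.fst) := by
  induction w with
  | nil => rfl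
  | cons x w ih => simp [mirror_cons, ih, val_flip]

theorem nonneg_mirror {z : ℤ} {w : DataWord Letter D} (h : Nonneg z (w.map Prod.fst)) :
    Nonneg (z + bal (w.map Prod.fst)) ((mirror w).map Prod.fst) := by
  induction w generalizing z with
  | nil => simpa using h
  | cons x w ih =>
    have h2 := ih h.2
    have h3 : 0 ≤ z := h.1
    have h4 : 0 ≤ z + x.1.val := h.2.start
    rw [mirror_cons, List.map_append, nonneg_append, bal_mirror, List.map_cons, bal_cons,
      ← add_assoc]
    refine ⟨h2, by linarith, ?_⟩
    change 0 ≤ _ + x.1.flip.val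
    rw [val_flip]
    linarith

theorem dollar_notMem_mirror {w : DataWord Letter D} (h : dollar ∉ w.map Prod.fst) :
    dollar ∉ (mirror w).map Prod.fst := by
  intro h'
  obtain ⟨⟨l, d⟩, hx, rfl⟩ := List.mem_map.1 h'
  exact h (List.mem_map.2 ⟨_, mem_mirror.1 hx, rfl⟩)

/-- A word without dollars, with nonnegative balance of all prefixes and with pairwise different
data values. -/
structure GoodWord (w : DataWord Letter D) : Prop where
  dollar : dollar ∉ w.map Prod.fst
  nonneg : Nonneg 0 (w.map Prod.fst)
  nodup : (w.map Prod.snd).Nodup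

theorem GoodWord.left {w w' : DataWord Letter D} (h : GoodWord (w ++ w')) : GoodWord w := by
  obtain ⟨h1, h2, h3⟩ := h
  rw [List.map_append] at h1 h2 h3
  exact ⟨fun h => h1 (List.mem_append_left _ h), (nonneg_append.1 h2).1, h3.of_append_left⟩

theorem GoodWord.concat {w : DataWord Letter D} (h : GoodWord w) {d : D}
    (hd : d ∉ w.map Prod.snd) : GoodWord (w ++ [(opn, d)]) := by
  refine ⟨?_, ?_, ?_⟩
  · simpa using h.dollar
  · rw [List.map_append, nonneg_append]
    have := h.nonneg.bal_nonneg
    refine ⟨h.nonneg, this, ?_⟩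
    change 0 ≤ _ + (1 : ℤ)
    omega
  · rw [List.map_append]
    refine h.nodup.append (by simp) ?_
    simpa using hd

/-- Words with a dollar followed by a mirror image are in `langU`. -/
theorem mem_langU_mirror {p m : DataWord Letter D} {e d : D}
    (hgood : GoodWord (p ++ [(opn, e)] ++ m)) (hm : WellBracketed (m.map Prod.fst)) :
    p ++ [(opn, e)] ++ m ++ (Letter.dollar, d) :: mirror (p ++ [(opn, e)]) ∈ langU D := by
  have hp := hgood.left
  refine ⟨p ++ [(opn, e)], m, _, d, rfl, ?_, isMirror_mirror hp.dollar, hm, .inr ⟨p, e, rfl⟩⟩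
  rw [wellBracketed_iff] at hm ⊢
  obtain ⟨h1, h2, h3⟩ := hgood
  generalize p ++ [(opn, e)] = q at *
  rw [List.map_append]
  refine ⟨?_, nonneg_append.2 ⟨h2, ?_⟩, ?_⟩
  · rw [List.mem_append]
    exact fun h => h.elim h1 (dollar_notMem_mirror hp.dollar)
  · rw [List.map_append, bal_append, hm.2.2, add_zero]
    exact nonneg_mirror hp.nonneg
  · rw [bal_append, bal_mirror, List.map_append, bal_append, hm.2.2]
    ring

/-- In a word of `langU` all data values after the dollar appear also before it. -/
theorem datum_mem_of_mem_langU {q v : DataWord Letter D} {d : D}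
    (hq : dollar ∉ q.map Prod.fst) (h : q ++ (dollar, d) :: v ∈ langU D) {x : Letter × D}
    (hx : x ∈ v) : x.2 ∈ q.map Prod.snd := by
  obtain ⟨p, m, v', d', e, hb, hmir, -, -⟩ := h
  have hv' : dollar ∉ (p ++ m).map Prod.fst := by
    have := hb.1
    rw [List.map_append, List.mem_append] at this
    exact fun h => this (.inl h)
  have key : ∀ (q r v v' : DataWord Letter D) (d d' : D), dollar ∉ q.map Prod.fst →
      dollar ∉ r.map Prod.fst → q ++ (dollar, d) :: v = r ++ (dollar, d') :: v' →
      q = r ∧ v = v' := by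
    intro q
    induction q with
    | nil =>
      rintro (_ | ⟨y, r⟩) v v' d d' h1 h2 h3
      · exact ⟨rfl, (List.cons.inj h3).2⟩
      · rw [List.nil_append, List.cons_append] at h3
        rw [← (List.cons.inj h3).1] at h2
        exact absurd (List.mem_cons_self) h2
    | cons x q ih =>
      rintro (_ | ⟨y, r⟩) v v' d d' h1 h2 h3
      · rw [List.nil_append, List.cons_append] at h3
        rw [(List.cons.inj h3).1] at h1
        exact absurd (List.mem_cons_self) h1
      · obtain ⟨rfl, h3'⟩ := List.cons.inj h3
        obtain ⟨rfl, rfl⟩ := ih r v v' d d' (fun h => h1 (List.mem_cons_of_mem _ h))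
          (fun h => h2 (List.mem_cons_of_mem _ h)) h3'
        exact ⟨rfl, rfl⟩
  obtain ⟨rfl, rfl⟩ := key q (p ++ m) v v' d d' hq hv' e
  have hx : x ∈ v.reverse := List.mem_reverse.2 hx
  have : ∀ {p v : DataWord Letter D}, List.Forall₂ (fun x y : Letter × D => x.2 = y.2 ∧
      ((x.1 = opn ∧ y.1 = cls) ∨ (x.1 = cls ∧ y.1 = opn))) p v → x ∈ v →
      x.2 ∈ p.map Prod.snd := by
    intro p v h hx
    induction h with
    | nil => cases hx
    | cons h _ ih =>
      rw [List.map_cons, List.mem_cons]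
      rcases List.mem_cons.1 hx with rfl | hx
      · exact .inl h.1.symm
      · exact .inr (ih hx)
  rw [List.map_append]
  exact List.mem_append_left _ (this hmir hx)

theorem exists_fresh [Infinite D] (w : DataWord Letter D) : ∃ d : D, d ∉ w.map Prod.snd :=
  (List.finite_toSet (w.map Prod.snd)).infinite_compl.nonempty

end words

/-! ### Runs of deterministic automata -/

theorem Run.append_iff {C : Type u} {X : Type v} {step : C → Option X → C → Prop} {c c' : C}
    {w w' : List X} : Run step c (w ++ w') c' ↔ ∃ c₁, Run step c w c₁ ∧ Run step c₁ w' c' := by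
  constructor
  · generalize hx : w ++ w' = x
    intro h
    induction h generalizing w with
    | nil c =>
      obtain ⟨rfl, rfl⟩ := List.append_eq_nil_iff.1 hx
      exact ⟨c, .nil c, .nil c⟩
    | eps h₁ _ ih =>
      obtain ⟨c₁, h, h'⟩ := ih hx
      exact ⟨c₁, .eps h₁ h, h'⟩
    | @read c c₁ c₂ x y h₁ h₂ ih =>
      match w, hx with
      | [], hx =>
        obtain rfl : w' = x :: y := hx
        exact ⟨c, .nil c, .read h₁ h₂⟩
      | a :: w, hx =>
        obtain ⟨rfl, hx'⟩ := List.cons.inj hx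
        obtain ⟨c₁, h, h'⟩ := ih hx'
        exact ⟨c₁, .read h₁ h, h'⟩
  · rintro ⟨c₁, h, h'⟩
    induction h with
    | nil => exact h'
    | eps h _ ih => exact .eps h (ih h')
    | read h _ ih => exact .read h (ih h')

namespace HOPAD

variable {I : Type} {n : ℕ} (M : HOPAD I n) {D : Type v}

theorem config_ext {c c' : M.Config D} (h : c.state = c'.state) (h' : c.stack = c'.stack) :
    c = c' := by
  cases c; cases c'; cases h; cases h'; rfl

theorem Step.det {c c₁ c₂ : M.Config D} {x : Option (I × D)} (h₁ : M.Step c x c₁)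
    (h₂ : M.Step c x c₂) : c₁ = c₂ := by
  obtain ⟨α, d, op, ht, hδ, he⟩ := h₁
  obtain ⟨α', d', op', ht', hδ', he'⟩ := h₂
  have e := Option.some.inj (ht.symm.trans ht')
  rw [Prod.mk.injEq] at e
  obtain ⟨rfl, rfl⟩ := e
  have e := Option.some.inj (hδ.symm.trans hδ')
  rw [Prod.mk.injEq] at e
  obtain ⟨e, rfl⟩ := e
  refine M.config_ext e ?_
  cases op with
  | pop k => exact he.2.trans he'.2.symm
  | push k β => exact (show _ = _ from he).trans (show _ = _ from he').symm

theorem Step.eps_read {c c₁ c₂ : M.Config D} {x : I × D} (h₁ : M.Step c none c₁)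
    (h₂ : M.Step c (some x) c₂) : False := by
  obtain ⟨α, d, op, ht, hδ, he⟩ := h₁
  obtain ⟨α', d', op', ht', hδ', he'⟩ := h₂
  have e := Option.some.inj (ht.symm.trans ht')
  rw [Prod.mk.injEq] at e
  obtain ⟨rfl, rfl⟩ := e
  have hδ : M.δ c.state α none = _ := hδ
  have hδ' : M.δ c.state α (some x.1) = _ := hδ'
  refine M.det c.state α x.1 ⟨?_, ?_⟩
  · rw [hδ]; rfl
  · rw [hδ']; rfl

/-- `M.Reads c w c'`: a run from `c` to `c'` reading `w` that ends right after reading the last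
letter. Such a `c'` is unique. -/
inductive Reads : M.Config D → DataWord I D → M.Config D → Prop
  | nil (c : M.Config D) : Reads c [] c
  | cons {c c₁ c₂ c' : M.Config D} {x : I × D} {w : DataWord I D} : Run M.Step c [] c₁ →
      M.Step c₁ (some x) c₂ → Reads c₂ w c' → Reads c (x :: w) c'

variable {M}

theorem eps_read_det {c c₁ c₂ c₁' c₂' : M.Config D} {x : I × D} (h₁ : Run M.Step c [] c₁)
    (h₂ : M.Step c₁ (some x) c₂) (h₁' : Run M.Step c [] c₁') (h₂' : M.Step c₁' (some x) c₂') :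
    c₂ = c₂' := by
  generalize hw : ([] : DataWord I D) = w at h₁
  induction h₁ with
  | nil c =>
    cases h₁' with
    | nil => exact Step.det M h₂ h₂'
    | eps h _ => exact (Step.eps_read M h h₂).elim
  | eps h _ ih =>
    subst hw
    cases h₁' with
    | nil => exact (Step.eps_read M h h₂').elim
    | eps h' h'' =>
      obtain rfl := Step.det M h h'
      exact ih h₂ h'' rfl
  | read => cases hw

theorem Reads.det {c c₁ c₂ : M.Config D} {w : DataWord I D} (h₁ : M.Reads c w c₁)
    (h₂ : M.Reads c w c₂) : c₁ = c₂ := by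
  induction h₁ with
  | nil => cases h₂; rfl
  | cons hr hs _ ih =>
    cases h₂ with
    | cons hr' hs' h' =>
      obtain rfl := eps_read_det hr hs hr' hs'
      exact ih h'

theorem Reads.run {c c' : M.Config D} {w : DataWord I D} (h : M.Reads c w c') :
    Run M.Step c w c' := by
  induction h with
  | nil => exact .nil _
  | @cons c c₁ c₂ c' x w hr hs _ ih =>
    exact (Run.append_iff (w := [])).2 ⟨c₁, hr, .read hs ih⟩

theorem Reads.exists_of_append {c c' : M.Config D} : ∀ {w w' : DataWord I D},
    M.Reads c (w ++ w') c' → ∃ c₁, M.Reads c w c₁ ∧ M.Reads c₁ w' c'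
  | [], _, h => ⟨c, .nil c, h⟩
  | _ :: _, _, .cons hr hs h =>
    have ⟨c₁, h₁, h₂⟩ := h.exists_of_append
    ⟨c₁, .cons hr hs h₁, h₂⟩

theorem exists_reads_of_run {c c' : M.Config D} {w : DataWord I D} (h : Run M.Step c w c') :
    ∃ c₁, M.Reads c w c₁ ∧ Run M.Step c₁ [] c' := by
  induction h with
  | nil c => exact ⟨c, .nil c, .nil c⟩
  | @eps c c₁ c₂ w h₁ h₂ ih =>
    obtain ⟨c₃, h, h'⟩ := ih
    cases h with
    | nil => exact ⟨c, .nil c, .eps h₁ h'⟩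
    | cons hr hs h => exact ⟨c₃, .cons (.eps h₁ hr) hs h, h'⟩
  | @read c c₁ c₂ x w h₁ h₂ ih =>
    obtain ⟨c₃, h, h'⟩ := ih
    exact ⟨c₃, .cons (.nil c) h₁ h, h'⟩

/-- The stacks along a run evolve by pops and pushes, where the data values of the pushed `0`-stacks
come from the word that is read. -/
theorem evolve_of_run {c c' : M.Config D} {w : DataWord I D} (h : Run M.Step c w c') :
    Stk.Evolve (fun a b => b = a ∧ ∀ d, a.2 = some d → d ∈ w.map Prod.snd) n c.stack c.stack
      c'.stack c'.stack := by
  have key : ∀ {c c' : M.Config D} {x : Option (I × D)}, M.Step c x c' →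
      Stk.Evolve (fun a b => b = a ∧ ∀ d, a.2 = some d → x.map Prod.snd = some d) n c.stack c.stack
        c'.stack c'.stack := by
    rintro c c' x ⟨α, d, op, ht, hδ, he⟩
    cases op with
    | pop k =>
      rw [he.2]
      exact .pop _ .refl
    | push k β =>
      have he : c'.stack = Stk.setTop (β, x.map Prod.snd) n (Stk.dup (k + 1) n c.stack) := he
      rw [he]
      exact .push _ .refl ⟨rfl, fun _ h => h⟩
  induction h with
  | nil => exact .refl
  | eps h₁ _ ih =>
    exact ((key h₁).mono fun a b h => ⟨h.1, fun d hd => by cases h.2 d hd⟩).trans ih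
  | read h₁ _ ih =>
    refine ((key h₁).mono fun a b h => ⟨h.1, fun d hd => ?_⟩).trans
      (ih.mono fun a b h => ⟨h.1, fun d hd => List.mem_cons_of_mem _ (h.2 d hd)⟩)
    rw [← Option.some.inj (h.2 d hd)]
    exact List.mem_cons_self

/-- All data values in the stack come from the word that has been read. -/
theorem mem_of_any {c : M.Config D} {w : DataWord I D} (h : Run M.Step (M.init D) w c) {d : D}
    (hd : Stk.Any (fun x => x.2 = some d) n c.stack) : d ∈ w.map Prod.snd := by
  rcases (evolve_of_run h).any hd with h | ⟨a, b, h, h'⟩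
  · have := Stk.any_single (S := M.Cell D) h
    cases this
  · exact h.2 d h'

/-- A letter whose data value is not in the stack has to be read by a push. -/
theorem pushRun_of_reads {c c' : M.Config D} {a : I} {d : D} (h : M.Reads c [(a, d)] c')
    (hd : ¬ Stk.Any (fun x => x.2 = some d) n c.stack) : M.PushRun a d c c' := by
  cases h with
  | @cons _ c₁ _ _ _ _ hr hs h =>
    cases h
    obtain ⟨α, d', op, ht, hδ, he⟩ := hs
    refine ⟨c₁, hr, α, d', ?_⟩
    cases op with
    | pop k =>
      exfalso
      have h1 : some d = d' := he.1.resolve_left (by simp)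
      subst h1
      rcases (evolve_of_run hr).any (Stk.any_of_top (P := fun x => x.2 = some d) ht rfl) with
        h | ⟨a, b, h, h'⟩
      · exact hd h
      · cases h.2 d h'
    | push k β => exact ⟨k, β, ht, hδ, he⟩

theorem PushRun.exists_top {c c' : M.Config D} {a : I} {d : D} (h : M.PushRun a d c c') :
    ∃ β, Stk.top n c'.stack = some (β, some d) := by
  obtain ⟨c₁, -, α, d', k, β, ht, -, hs⟩ := h
  refine ⟨β, ?_⟩
  rw [hs]
  exact Stk.top_setTop _ ((Stk.top_dup _).trans ht)

theorem PushRun.onlyTop {c c' : M.Config D} {a : I} {d : D} (h : M.PushRun a d c c')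
    (hd : ¬ Stk.Any (fun x => x.2 = some d) n c.stack) :
    Stk.OnlyTop (fun x => x.2 = some d) n c'.stack := by
  obtain ⟨c₁, hr, α, d', k, β, -, -, hs⟩ := h
  rw [hs]
  refine Stk.onlyTop_setTop _ fun h => ?_
  rcases (evolve_of_run hr).any (Stk.any_dup _ h) with h | ⟨a, b, h, h'⟩
  · exact hd h
  · cases h.2 d h'

theorem PushRun.reads {c c' : M.Config D} {a : I} {d : D} (h : M.PushRun a d c c') :
    M.Reads c [(a, d)] c' := by
  obtain ⟨c₁, hr, α, d', k, β, ht, hδ, hs⟩ := h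
  exact .cons hr ⟨α, d', _, ht, hδ, hs⟩ (.nil _)

/-! ### Runs reading all letters by pops -/

variable (M) in
/-- Runs in which each letter is read by a pop. -/
inductive PopRun : M.Config D → DataWord I D → M.Config D → Prop
  | nil (c : M.Config D) : PopRun c [] c
  | eps {c c₁ c' : M.Config D} {w : DataWord I D} : M.Step c none c₁ → PopRun c₁ w c' →
      PopRun c w c'
  | pop {c c₁ c' : M.Config D} {a : I} {d : D} {w : DataWord I D} (α : M.Γ) (k : Fin n) :
      Stk.top n c.stack = some (α, some d) → M.δ c.state α (some a) = some (c₁.state, .pop k) →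
      c₁.stack = Stk.pop (k + 1) n c.stack → PopRun c₁ w c' → PopRun c ((a, d) :: w) c'

theorem PopRun.any {c c' : M.Config D} {w : DataWord I D} (h : M.PopRun c w c') {d : D}
    (hd : d ∈ w.map Prod.snd) : Stk.Any (fun x => x.2 = some d) n c.stack := by
  induction h with
  | nil => cases hd
  | eps h₁ _ ih =>
    rcases (evolve_of_run (.eps h₁ (.nil _))).any (ih hd) with h | ⟨a, b, h, h'⟩
    · exact h
    · cases h.2 d h'
  | pop α k ht _ hs _ ih =>
    rcases List.mem_cons.1 hd with rfl | hd
    · exact Stk.any_of_top ht rfl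
    · have := ih hd
      rw [hs] at this
      exact Stk.any_pop _ this

/-- Stacks with the same symbols, and data values at the same places. -/
abbrev SameShape (M : HOPAD I n) {D : Type v} (s t : Stk (M.Cell D) n) : Prop :=
  Stk.Rel (fun x y => x.1 = y.1 ∧ (x.2 = none ↔ y.2 = none)) n s t

/-- A step can be imitated on a stack of the same shape, if a pop which reads a letter reads
the data value stored in the other stack. -/
theorem SameShape.step {c c' b : M.Config D} {x : Option (I × D)} (h : M.Step c x c')
    (hb : b.state = c.state) (hs : SameShape M c.stack b.stack) :
    ∃ y b', M.Step b y b' ∧ y.map Prod.fst = x.map Prod.fst ∧ b'.state = c'.state ∧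
      SameShape M c'.stack b'.stack := by
  obtain ⟨α, d, op, ht, hδ, he⟩ := h
  obtain ⟨⟨α', d'⟩, ht', h1, h2⟩ := Stk.rel_top hs ht
  obtain rfl : α = α' := h1
  have h2 : d = none ↔ d' = none := h2
  cases op with
  | pop k =>
    have hrel : SameShape M c'.stack (Stk.pop (k + 1) n b.stack) := he.2 ▸ Stk.rel_pop _ hs
    let b' : M.Config D := ⟨c'.state, _, Stk.rel_wellFormed hrel c'.wf⟩
    cases x with
    | none => exact ⟨none, b', ⟨α, d', .pop k, ht', hb ▸ hδ, .inl rfl, rfl⟩, rfl, rfl, hrel⟩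
    | some x =>
      have h3 : some x.2 = d := he.1.resolve_left (by simp)
      cases d' with
      | none => rw [← h3] at h2; simp at h2
      | some d' =>
        exact ⟨some (x.1, d'), b', ⟨α, some d', .pop k, ht', hb ▸ hδ, .inr rfl, rfl⟩, rfl, rfl,
          hrel⟩
  | push k β =>
    have hrel : SameShape M c'.stack
        (Stk.setTop (β, x.map Prod.snd) n (Stk.dup (k + 1) n b.stack)) := by
      have he : c'.stack = _ := he
      rw [he]
      exact Stk.rel_setTop ⟨rfl, Iff.rfl⟩ (Stk.rel_dup _ hs)
    let b' : M.Config D := ⟨c'.state, _, Stk.rel_wellFormed hrel c'.wf⟩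
    exact ⟨x, b', ⟨α, d', .push k β, ht', hb ▸ hδ, rfl⟩, rfl, rfl, hrel⟩

theorem SameShape.run {c c' b : M.Config D} {w : DataWord I D} (h : Run M.Step c w c')
    (hb : b.state = c.state) (hs : SameShape M c.stack b.stack) :
    ∃ w' b', Run M.Step b w' b' ∧ b'.state = c'.state := by
  induction h generalizing b with
  | nil => exact ⟨[], b, .nil b, hb⟩
  | eps h₁ _ ih =>
    obtain ⟨y, b', h₂, hy, hst, hs'⟩ := SameShape.step h₁ hb hs
    obtain ⟨w', b'', h₃, h₄⟩ := ih hst hs'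
    obtain rfl : y = none := by simpa using hy
    exact ⟨w', b'', .eps h₂ h₃, h₄⟩
  | read h₁ _ ih =>
    obtain ⟨y, b', h₂, hy, hst, hs'⟩ := SameShape.step h₁ hb hs
    obtain ⟨w', b'', h₃, h₄⟩ := ih hst hs'
    cases y with
    | none => cases hy
    | some y => exact ⟨y :: w', b'', .read h₂ h₃, h₄⟩

theorem sameShape_refl (s : Stk (M.Cell D) n) : SameShape M s s := by
  refine Stk.rel_mono (R := fun x y => y = id x) (fun _ _ h => by rw [h]; exact ⟨rfl, Iff.rfl⟩) ?_
  rw [Stk.rel_map_iff]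
  exact (Stk.map_id s).symm

/-- If some letter is read by a push, then its data value can be changed arbitrarily. -/
theorem popRun_or {c c' : M.Config D} {w : DataWord I D} (h : Run M.Step c w c') :
    M.PopRun c w c' ∨ ∀ d : D, ∃ w' c'', Run M.Step c w' c'' ∧ c''.state = c'.state ∧
      d ∈ w'.map Prod.snd := by
  induction h with
  | nil c => exact .inl (.nil c)
  | eps h₁ _ ih =>
    refine ih.imp (.eps h₁) fun ih d => ?_
    obtain ⟨w', c'', hr, hc, hd⟩ := ih d
    exact ⟨w', c'', .eps h₁ hr, hc, hd⟩
  | @read c c₁ c₂ x w h₁ h₂ ih =>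
    have h₁' := h₁
    obtain ⟨α, d', op, ht, hδ, he⟩ := h₁'
    cases op with
    | pop k =>
      have h3 : some x.2 = d' := he.1.resolve_left (by simp)
      subst h3
      refine ih.imp (.pop α k ht hδ he.2) fun ih d => ?_
      obtain ⟨w', c'', hr, hc, hd⟩ := ih d
      exact ⟨x :: w', c'', .read h₁ hr, hc, List.mem_cons_of_mem _ hd⟩
    | push k β =>
      refine .inr fun d => ?_
      have hrel : SameShape M c₁.stack
          (Stk.setTop (β, some d) n (Stk.dup (k + 1) n c.stack)) := by
        have he : c₁.stack = Stk.setTop (β, some x.2) n (Stk.dup (k + 1) n c.stack) := he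
        rw [he]
        exact Stk.rel_setTop ⟨rfl, by simp⟩ (sameShape_refl _)
      let b : M.Config D := ⟨c₁.state, _, Stk.rel_wellFormed hrel c₁.wf⟩
      obtain ⟨w', b', hr, hc⟩ := SameShape.run h₂ (b := b) rfl hrel
      exact ⟨(x.1, d) :: w', b', .read (c' := b) ⟨α, d', .push k β, ht, hδ, rfl⟩ hr, hc,
        List.mem_cons_self⟩

end HOPAD

/-! ### Locating a data value while reading letters by pops -/

namespace HOPAD

variable {n : ℕ} (M : HOPAD Letter n) {D : Type v}

/-- The continuation of the program `markProg` after reading the dollar: it performs `ε`-steps and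
pops that read the bracket opposite to the colour of the topmost symbol, until the topmost symbol
is marked. -/
def markAfter (q : M.Q) (γ : M.Γ) (x : Option (Letter × Bool)) :
    Option ((M.Q × Bool) × POp (M.Γ × Option (Letter × Bool))) :=
  match M.δ q γ none with
  | some (q', op) => some ((q', true), M.colOp _ op)
  | none => match x with
    | some (l, false) => match M.δ q γ (some l.flip) with
      | some (q', .pop k) => some ((q', true), .pop (k + 1))
      | _ => none
    | _ => none

/-- The program reports that it is waiting for a letter with a marked symbol on top. -/
def markRep (q : M.Q) (_ : Unit) (k : ℕ) (s : Stk (M.Γ × Option (Letter × Bool)) k) : Prop :=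
  ∃ γ l, Stk.top k s = some (γ, some (l, true)) ∧ M.δ q γ none = none

/-- The program that reads a dollar by a push and then brackets by pops, until a data value marked
by the colouring has to be read. -/
abbrev markProg : Program (M.Γ × Option (Letter × Bool)) (M.Q × Bool) Unit :=
  M.prog dollar M.markAfter M.markRep

variable {M}

/-- Assume that a word is read by pops, and that its letters up to some point have
unmarked data values coloured by the opposite letters. If the next data value has no colour
or a mark, then the program finds out which is the case. -/
theorem PopRun.acc_iff {χ : D → Option (Letter × Bool)} {c c' : M.Config D}
    {v v' : DataWord Letter D} {a : Letter} {d : D} (h : M.PopRun c (v ++ (a, d) :: v') c')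
    (hv : ∀ x ∈ v, χ x.2 = some (x.1.flip, false))
    (hd : χ d = none ∨ ∃ l, χ d = some (l, true)) :
    M.markProg.Acc n (c.state, true) (Stk.map (M.colour χ) n c.stack) () ↔
      ∃ l, χ d = some (l, true) := by
  generalize hw : v ++ (a, d) :: v' = w at h
  induction h generalizing v with
  | nil => simp at hw
  | @eps c c₁ c₂ w h₁ _ ih =>
    have hmap := Stk.rel_map_self (M.colour χ) n c.stack
    obtain ⟨γ, x, op, ht, hδ, hev⟩ := M.exists_colOp h₁ (M.rel_fst_map (χ := χ) c.stack)
    have h₂ : (M.colOp _ op).exec n (Stk.map (M.colour χ) n c.stack) =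
        Stk.map (M.colour χ) n c₁.stack := by
      refine Stk.rel_map_iff.1 (hev.rel ?_ hmap)
      rintro ⟨γ, e⟩ b ⟨h1, rfl⟩
      have h1 : e = none := h1
      rw [h1]
      rfl
    rw [← ih hv hw, ← h₂]
    refine Program.acc_step_iff ?_ ht ?_
    · rintro ⟨-, γ', l, ht', h'⟩
      have e := Option.some.inj (ht.symm.trans ht')
      rw [Prod.mk.injEq] at e
      rw [← e.1, hδ] at h'
      cases h'
    · simp only [prog, markAfter, hδ]
  | @pop c c₁ c₂ b e w α k ht hδ hs _ ih =>
    have hnone : M.δ c.state α none = none := by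
      have := M.det c.state α b
      rw [hδ] at this
      simpa using this
    obtain ⟨y, ht', rfl⟩ := Stk.rel_top (Stk.rel_map_self (M.colour χ) n c.stack) ht
    match v, hw, hv with
    | [], hw, _ =>
      obtain ⟨h1, -⟩ := List.cons.inj hw
      rw [Prod.mk.injEq] at h1
      obtain ⟨rfl, rfl⟩ := h1
      rw [Program.acc_halt_iff]
      · constructor
        · rintro ⟨-, γ, l, ht'', -⟩
          have h2 := Option.some.inj (ht'.symm.trans ht'')
          exact ⟨l, (Prod.mk.inj h2).2⟩
        · rintro ⟨l, hl⟩
          exact ⟨rfl, α, l, ht'.trans (by simp [colour, hl]), hnone⟩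
      · intro y hy
        obtain rfl := Option.some.inj (ht'.symm.trans hy)
        rcases hd with hd | ⟨l, hd⟩ <;>
          simp [prog, markAfter, colour, hnone, hd]
    | x :: v, hw, hv =>
      obtain ⟨rfl, hw'⟩ := List.cons.inj hw
      have hx : χ e = some (b.flip, false) := hv _ List.mem_cons_self
      rw [← ih (fun x hx => hv x (List.mem_cons_of_mem _ hx)) hw']
      have h₂ : Stk.pop (k + 1) n (Stk.map (M.colour χ) n c.stack) =
          Stk.map (M.colour χ) n c₁.stack := by
        rw [hs]
        exact Stk.rel_map_iff.1 (Stk.rel_pop _ (Stk.rel_map_self _ _ _))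
      rw [← h₂]
      refine Program.acc_step_iff ?_ ht' (op := .pop (k + 1)) ?_
      · rintro ⟨-, γ', l, ht'', -⟩
        have h2 := Option.some.inj (ht'.symm.trans ht'')
        have h3 := (Prod.mk.inj h2).2
        simp [hx] at h3
      · simp [prog, markAfter, colour, hnone, hx, hδ]

end HOPAD

/-! ### Data values hidden below the topmost stack -/

namespace Stk

variable {S : Type u}

theorem IsTop.exists_succ {m n : ℕ} {x : Stk S m} {s : Stk S n} (h : IsTop x n s) (hmn : m < n) :
    ∃ r : List (Stk S m), IsTop (m := m + 1) (x :: r : List (Stk S m)) n s := by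
  induction h with
  | refl => omega
  | @cons n t s h ih =>
    rcases h.le.eq_or_lt with rfl | hlt
    · obtain rfl := IsTop.self_iff.1 h
      exact ⟨s, .refl⟩
    · obtain ⟨r, hr⟩ := ih hlt
      exact ⟨r, .cons _ _ hr⟩

/-- The key invariant for a single stack. As long as the topmost `(m+1)`-stack contains a mark `f`
that was in `s` only in the topmost `0`-stack, it arises from that of `s` by replacing
its topmost `m`-stack by a nonempty sequence `l` of `m`-stacks, which are free of elements `g`
if that `m`-stack was. -/
theorem Evolve.suffix_self {f g : S → Prop} {m n : ℕ} (hmn : m < n) {s s' : Stk S n}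
    {x : Stk S m} {r : List (Stk S m)} (hf : OnlyTop f n s)
    (hx : IsTop (m := m + 1) (x :: r : List (Stk S m)) n s) (hg : ¬ Any g m x)
    (h : Evolve (fun a b => b = a ∧ ¬ f a ∧ ¬ g a) n s s s' s')
    {y : List (Stk S m)} (hy : IsTop (m := m + 1) y n s') (hfy : Any f (m + 1) y) :
    ∃ l : List (Stk S m), l ≠ [] ∧ y = l ++ r ∧ ¬ Any g (m + 1) l := by
  have hrefl : Rel (fun a b : S => b = id a) n s s := rel_map_iff.2 (map_id s).symm
  have hρ : Rel (fun a b => b = a ∧ ¬ g a) m x x :=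
    rel_diag_iff.2 ⟨rfl, fun h => hg (any_mono (fun _ => not_not.1) h)⟩
  obtain ⟨l, l', hl, e, -, hll⟩ := Evolve.suffix hmn hrefl hf hx hx hρ
    (h.mono fun a b h => ⟨⟨h.1, h.2.2⟩, h.2.1⟩) hy hfy
  refine ⟨l, hl, e, fun h => ?_⟩
  exact (rel_diag_iff (n := m + 1).1 hll).2 (any_mono (fun _ h h' => h' h) h)

/-- An element `g` not in the topmost `m`-stack does not return to it as long as
the topmost `m`-stack contains the mark. -/
theorem Evolve.not_any_isTop {f g : S → Prop} {m n : ℕ} {s s' : Stk S n} {x y : Stk S m}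
    (hf : OnlyTop f n s) (hx : IsTop x n s) (hg : ¬ Any g m x)
    (h : Evolve (fun a b => b = a ∧ ¬ f a ∧ ¬ g a) n s s s' s')
    (hy : IsTop y n s') (hfy : Any f m y) : ¬ Any g m y := by
  rcases hx.le.eq_or_lt with rfl | hmn
  · obtain rfl := IsTop.self_iff.1 hx
    obtain rfl := IsTop.self_iff.1 hy
    exact fun h' => (h.any h').elim hg fun ⟨_, _, h1, h2⟩ => h1.2.2 h2
  · obtain ⟨r, hr⟩ := hx.exists_succ hmn
    obtain ⟨r', hr'⟩ := hy.exists_succ hmn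
    obtain ⟨l, hl, e, hgl⟩ := h.suffix_self hmn hf hr hg hr' (any_cons.2 (.inl hfy))
    match l, hl, e with
    | z :: l, _, e =>
      obtain ⟨rfl, -⟩ := List.cons.inj e
      exact fun h' => hgl (any_cons.2 (.inl h'))

end Stk

/-! ### An automaton recognizing the language loses data -/

section colours

variable {D : Type v}

open Classical in
/-- The colour of a data value is its letter in the word `w`, together with a mark for
the data value `e`; data values outside `w` have no colour. -/
noncomputable def wordColour (w : DataWord Letter D) (e d : D) : Option (Letter × Bool) :=
  (w.find? fun x => x.2 = d).map fun x => (x.1, decide (d = e))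

theorem wordColour_eq_none {w : DataWord Letter D} {e d : D} (h : d ∉ w.map Prod.snd) :
    wordColour w e d = none := by
  unfold wordColour
  rw [Option.map_eq_none_iff, List.find?_eq_none]
  intro x hx hd
  obtain rfl : x.2 = d := by simpa using hd
  exact h (List.mem_map_of_mem hx)

theorem wordColour_congr (w : DataWord Letter D) {e e' d : D} (h : d ≠ e) (h' : d ≠ e') :
    wordColour w e d = wordColour w e' d := by
  simp [wordColour, h, h']

theorem wordColour_of_mem {w : DataWord Letter D} (hw : (w.map Prod.snd).Nodup) {l : Letter}
    {d : D} (h : (l, d) ∈ w) :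
    (wordColour w d d = some (l, true)) ∧ ∀ e, d ≠ e → wordColour w e d = some (l, false) := by
  classical
  have hf : (w.find? fun x => x.2 = d) = some (l, d) := by
    induction w with
    | nil => cases h
    | cons x w ih =>
      rw [List.map_cons, List.nodup_cons] at hw
      rcases List.mem_cons.1 h with rfl | h
      · simp
      · rw [List.find?_cons_of_neg, ih hw.2 h]
        rw [decide_eq_true_eq]
        rintro rfl
        exact hw.1 (List.mem_map.2 ⟨_, h, rfl⟩)
  unfold wordColour
  constructor
  · simp [hf]
  · intro e he
    simp [hf, he]

end colours

namespace HOPAD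

variable {n : ℕ} {M : HOPAD Letter n} {D : Type v}

/-- Every good word can be read, since it can be completed to a word of the language. -/
theorem exists_reads [Infinite D] (hM : M.language D = langU D) {w : DataWord Letter D}
    (hw : GoodWord w) : ∃ c, M.Reads (M.init D) w c := by
  obtain ⟨e, he⟩ := exists_fresh w
  have h := mem_langU_mirror (p := w) (m := []) (e := e) (d := e) (by
    rw [List.append_nil]; exact hw.concat he) (by simp [wellBracketed_iff, Nonneg])
  rw [← hM] at h
  obtain ⟨c, hc, -⟩ := h
  rw [List.append_assoc, List.append_assoc, Run.append_iff] at hc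
  obtain ⟨c₁, hc₁, -⟩ := hc
  obtain ⟨c₂, hc₂, -⟩ := exists_reads_of_run hc₁
  exact ⟨c₂, hc₂⟩

/-- After reading the dollar, an automaton recognizing the language has to read all letters by
pops. -/
theorem exists_popRun [Infinite D] (hM : M.language D = langU D) {p m : DataWord Letter D}
    {e d : D} (hgood : GoodWord (p ++ [(opn, e)] ++ m))
    (hm : WellBracketed (m.map Prod.fst)) {c : M.Config D}
    (hc : M.Reads (M.init D) (p ++ [(opn, e)] ++ m) c)
    (hd : d ∉ (p ++ [(opn, e)] ++ m).map Prod.snd) :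
    ∃ c₁ c₂, M.PushRun dollar d c c₁ ∧ M.PopRun c₁ (mirror (p ++ [(opn, e)])) c₂ := by
  have h := mem_langU_mirror (d := d) hgood hm
  rw [← hM] at h
  obtain ⟨c₂, hrun, hF⟩ := h
  generalize mirror (p ++ [(opn, e)]) = v at *
  generalize p ++ [(opn, e)] ++ m = q at *
  obtain ⟨c₁, h₁, h₂⟩ : ∃ c₁, M.Reads (M.init D) (q ++ [(dollar, d)]) c₁ ∧ Run M.Step c₁ v c₂ := by
    rw [← List.singleton_append, ← List.append_assoc, Run.append_iff] at hrun
    obtain ⟨c₃, h, h'⟩ := hrun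
    obtain ⟨c₁, h₁, h₂⟩ := exists_reads_of_run h
    exact ⟨c₁, h₁, (Run.append_iff (w := [])).2 ⟨c₃, h₂, h'⟩⟩
  obtain ⟨c', h₃, h₄⟩ := h₁.exists_of_append
  obtain rfl := hc.det h₃
  refine ⟨c₁, c₂, pushRun_of_reads h₄ fun h => hd (mem_of_any hc.run h), ?_⟩
  refine (popRun_or h₂).resolve_right fun h => ?_
  obtain ⟨d', hd'⟩ := exists_fresh q
  obtain ⟨w', c₃, hw', hst, hdw⟩ := h d'
  have hacc : q ++ (dollar, d) :: w' ∈ M.language D := by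
    refine ⟨c₃, ?_, hst ▸ hF⟩
    rw [← List.singleton_append, ← List.append_assoc]
    exact Run.append_iff.2 ⟨c₁, h₁.run, hw'⟩
  rw [hM] at hacc
  obtain ⟨x, hx, rfl⟩ := List.mem_map.1 hdw
  exact hd' (datum_mem_of_mem_langU hgood.dollar hacc hx)

theorem pushRun_of_concat {w : DataWord Letter D} {a : Letter} {d : D} {c c' : M.Config D}
    (hd : d ∉ w.map Prod.snd) (hc : M.Reads (M.init D) w c)
    (hc' : M.Reads (M.init D) (w ++ [(a, d)]) c') : M.PushRun a d c c' := by
  obtain ⟨c₁, h₁, h₂⟩ := hc'.exists_of_append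
  obtain rfl := hc.det h₁
  exact pushRun_of_reads h₂ fun h => hd (mem_of_any hc.run h)

theorem onlyTop_of_concat {w : DataWord Letter D} {a : Letter} {d : D} {c : M.Config D}
    (hw : GoodWord (w ++ [(a, d)])) (hc : M.Reads (M.init D) (w ++ [(a, d)]) c) :
    Stk.OnlyTop (fun x => x.2 = some d) n c.stack := by
  obtain ⟨c₁, h₁, h₂⟩ := hc.exists_of_append
  have hd : d ∉ w.map Prod.snd := by
    have := hw.nodup
    rw [List.map_append, List.nodup_append] at this
    exact fun h => this.2.2 d h d (by simp) rfl
  exact (pushRun_of_concat hd h₁ hc).onlyTop fun h => hd (mem_of_any h₁.run h)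

end HOPAD

section words

variable {D : Type v}

/-- `b` closing brackets with the data values `g 0, …, g (b - 1)`. -/
def closings (g : ℕ → D) (b : ℕ) : DataWord Letter D := (List.range b).map fun j => (cls, g j)

theorem closings_succ (g : ℕ → D) (b : ℕ) : closings g (b + 1) = closings g b ++ [(cls, g b)] := by
  simp [closings, List.range_succ]

theorem map_fst_closings (g : ℕ → D) (b : ℕ) :
    (closings g b).map Prod.fst = List.replicate b cls := by
  simp [closings, Function.comp_def]

theorem mem_map_snd_closings {g : ℕ → D} {b : ℕ} {d : D} (h : d ∈ (closings g b).map Prod.snd) :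
    ∃ j < b, g j = d := by
  simpa [closings] using h

theorem GoodWord.notMem_right {w w' : DataWord Letter D} (h : GoodWord (w ++ w')) {d : D}
    (hd : d ∈ w.map Prod.snd) : d ∉ w'.map Prod.snd := by
  have := h.nodup
  rw [List.map_append, List.nodup_append] at this
  exact fun h' => this.2.2 d hd d h' rfl

theorem GoodWord.append_closings {w : DataWord Letter D} (hw : GoodWord w) {g : ℕ → D}
    (hg : Function.Injective g) (hgw : ∀ j, g j ∉ w.map Prod.snd) {b : ℕ}
    (hb : (b : ℤ) ≤ bal (w.map Prod.fst)) : GoodWord (w ++ closings g b) := by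
  obtain ⟨h1, h2, h3⟩ := hw
  refine ⟨?_, ?_, ?_⟩
  · rw [List.map_append, map_fst_closings, List.mem_append, List.mem_replicate]
    rintro (h | h)
    · exact h1 h
    · cases h.2
  · rw [List.map_append, map_fst_closings, nonneg_append]
    exact ⟨h2, nonneg_replicate_cls (by omega)⟩
  · rw [List.map_append, List.nodup_append]
    refine ⟨h3, ?_, ?_⟩
    · simp only [closings, List.map_map, Function.comp_def]
      exact List.nodup_range.map hg
    · rintro d hd d' hd' rfl
      obtain ⟨j, -, rfl⟩ := mem_map_snd_closings hd'
      exact hgw j hd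

end words

namespace HOPAD

variable {n : ℕ} {M : HOPAD Letter n} {D : Type v}

theorem evolve_of_append {q v : DataWord Letter D} {c c' : M.Config D}
    (hc : M.Reads (M.init D) q c) (hc' : M.Reads (M.init D) (q ++ v) c') {f g : M.Cell D → Prop}
    (hf : ∀ a, f a → ∃ d, a.2 = some d ∧ d ∉ v.map Prod.snd)
    (hg : ∀ a, g a → ∃ d, a.2 = some d ∧ d ∉ v.map Prod.snd) :
    Stk.Evolve (fun a b => b = a ∧ ¬ f a ∧ ¬ g a) n c.stack c.stack c'.stack c'.stack := by
  obtain ⟨c₁, h₁, h₂⟩ := hc'.exists_of_append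
  obtain rfl := hc.det h₁
  refine (evolve_of_run h₂.run).mono fun a b h => ⟨h.1, fun h' => ?_, fun h' => ?_⟩
  · obtain ⟨d, hd, hd'⟩ := hf a h'
    exact hd' (h.2 d hd)
  · obtain ⟨d, hd, hd'⟩ := hg a h'
    exact hd' (h.2 d hd)

/-- Each nonempty good word `w` can be prolonged by a word `u`, ending with an opening bracket,
such that after reading `w ++ u` some data value of `u` is not in the topmost `k`-stack. -/
def Escapes (M : HOPAD Letter n) (D : Type v) (k : ℕ) : Prop :=
  ∀ w : DataWord Letter D, GoodWord w → w ≠ [] → ∃ (u : DataWord Letter D) (e : D),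
    Nonneg 0 ((u ++ [(opn, e)]).map Prod.fst) ∧ GoodWord (w ++ (u ++ [(opn, e)])) ∧
    ∃ c, M.Reads (M.init D) (w ++ (u ++ [(opn, e)])) c ∧
    ∃ d ∈ (u ++ [(opn, e)]).map Prod.snd,
      ∀ y : Stk (M.Cell D) k, Stk.IsTop y n c.stack → ¬ Stk.Any (fun x => x.2 = some d) k y

variable [Infinite D]

theorem escapes_zero (hM : M.language D = langU D) : M.Escapes D 0 := by
  intro w hw _
  obtain ⟨d, hd⟩ := exists_fresh w
  have hw₁ := hw.concat hd
  obtain ⟨e, he⟩ := exists_fresh (w ++ [(opn, d)])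
  have hw₂ := hw₁.concat he
  rw [List.append_assoc] at hw₂
  obtain ⟨c, hc⟩ := exists_reads hM hw₁
  obtain ⟨c', hc'⟩ := exists_reads hM hw₂
  refine ⟨[(opn, d)], e, by simp [Nonneg, val], hw₂, c', hc', d, by simp, fun y hy h => ?_⟩
  rw [← List.append_assoc] at hc'
  obtain ⟨β, hβ⟩ := (pushRun_of_concat he hc hc').exists_top
  rw [hy.top_eq] at hβ
  obtain rfl : y = (β, some e) := Option.some.inj hβ
  have h : some e = some d := h
  exact he (by simp [Option.some.inj h])

/-- If the topmost `k`-stacks remember all data values of words ending with an opening bracket, then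
they remember all data values of all words. -/
theorem any_of_not_escapes (hM : M.language D = langU D) {k : ℕ}
    {w : DataWord Letter D}
    (H : ∀ (u : DataWord Letter D) (e : D), Nonneg 0 ((u ++ [(opn, e)]).map Prod.fst) →
      GoodWord (w ++ (u ++ [(opn, e)])) → ∀ c, M.Reads (M.init D) (w ++ (u ++ [(opn, e)])) c →
      ∀ d ∈ (u ++ [(opn, e)]).map Prod.snd, ∃ y : Stk (M.Cell D) k, Stk.IsTop y n c.stack ∧
        Stk.Any (fun x => x.2 = some d) k y)
    {u : DataWord Letter D} (hu : u ≠ []) (hu' : Nonneg 0 (u.map Prod.fst)) (hg : GoodWord (w ++ u))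
    {c : M.Config D} (hc : M.Reads (M.init D) (w ++ u) c) {d : D} (hd : d ∈ u.map Prod.snd)
    {y : Stk (M.Cell D) k} (hy : Stk.IsTop y n c.stack) :
    Stk.Any (fun x => x.2 = some d) k y := by
  by_contra hcon
  obtain ⟨e, he⟩ := exists_fresh (w ++ u)
  have hg' := hg.concat he
  obtain ⟨c', hc'⟩ := exists_reads hM hg'
  have hmem : ∀ d ∈ u.map Prod.snd, d ≠ e := by
    rintro d hd rfl
    exact he (by rw [List.map_append]; exact List.mem_append_right _ hd)
  obtain ⟨u', ⟨a, f⟩, rfl⟩ := (List.eq_nil_or_concat' u).resolve_left hu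
  have hf : f ∈ (u' ++ [(a, f)]).map Prod.snd := by simp
  have hall : ∀ d ∈ (u' ++ [(a, f)]).map Prod.snd, ∃ y : Stk (M.Cell D) k,
      Stk.IsTop y n c'.stack ∧ Stk.Any (fun x => x.2 = some d) k y := by
    intro d hd
    refine H (u' ++ [(a, f)]) e ?_ (by rwa [← List.append_assoc]) c'
      (by rwa [← List.append_assoc]) d (by rw [List.map_append]; exact List.mem_append_left _ hd)
    rw [List.map_append, nonneg_append]
    have := hu'.bal_nonneg
    refine ⟨hu', this, ?_⟩
    change 0 ≤ _ + (1 : ℤ)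
    omega
  obtain ⟨y₁, hy₁, h₁⟩ := hall f hf
  obtain ⟨y₂, hy₂, h₂⟩ := hall d hd
  obtain rfl := hy₁.unique hy₂
  have hev := evolve_of_append hc hc' (f := fun x => x.2 = some f) (g := fun x => x.2 = some d)
    (fun a h => ⟨f, h, by simpa using hmem f hf⟩) (fun a h => ⟨d, h, by simpa using hmem d hd⟩)
  rw [← List.append_assoc] at hg hc
  exact hev.not_any_isTop (onlyTop_of_concat hg hc) hy hcon hy₁ h₁ h₂

end HOPAD

namespace HOPAD

variable {n : ℕ} {M : HOPAD Letter n} {D : Type v}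

/-- The typing by a single type. -/
def trivialTyping (A : Type) (n : ℕ) : FinTyping A n where
  C _ := Unit
  fin _ := inferInstance
  ty _ _ := ()
  congr _ _ _ _ _ _ _ _ := rfl

/-- The refinement of the trivial typing which determines the outcome of `markProg`. -/
noncomputable def markTyping (M : HOPAD Letter n) :
    FinTyping (M.Γ × Option (Letter × Bool)) n :=
  have := M.finQ
  M.markProg.refine (trivialTyping _ n)

theorem acc_of_markTyping_eq {q : M.Q} {s t : Stk (M.Γ × Option (Letter × Bool)) n}
    (e : M.markTyping.ty n s = M.markTyping.ty n t) (h : M.markProg.Acc n (q, false) s ()) :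
    M.markProg.Acc n (q, false) t () := by
  have := M.finQ
  refine Program.acc_of_refine_ty_eq M.markProg (trivialTyping _ n) ?_ e h
  rintro p o s s' hs ⟨hp, γ, l, ht, h⟩
  exact ⟨hp, γ, l, (hs.top _ _).trans ht, h⟩

/-- The outcome of `markProg` started before reading a dollar. -/
theorem acc_of_pushRun {χ : D → Option (Letter × Bool)} {c c₁ c₂ : M.Config D} {d₀ : D}
    (h₁ : M.PushRun dollar d₀ c c₁) (hd₀ : χ d₀ = none) {v v' : DataWord Letter D} {a : Letter}
    {d : D} (h₂ : M.PopRun c₁ (v ++ (a, d) :: v') c₂)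
    (hv : ∀ x ∈ v, χ x.2 = some (x.1.flip, false))
    (hd : χ d = none ∨ ∃ l, χ d = some (l, true)) :
    M.markProg.Acc n (c.state, false) (Stk.map (M.colour χ) n c.stack) () ↔
      ∃ l, χ d = some (l, true) := by
  obtain ⟨t, hev, hacc⟩ := M.prog_pushRun h₁ (M.rel_fst_map (χ := χ) c.stack)
    (after := M.markAfter) (rep := M.markRep)
  have ht : t = Stk.map (M.colour χ) n c₁.stack := by
    refine Stk.rel_map_iff.1 (hev.rel ?_ (Stk.rel_map_self _ _ _))
    rintro ⟨γ, e⟩ b ⟨h | h, rfl⟩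
    · have h : e = none := h
      rw [h]; rfl
    · have h : e = some d₀ := h
      simp [h, colour, hd₀]
  rw [hacc, ht]
  exact h₂.acc_iff hv hd

/-- If the letters of `V ++ R` are coloured and a data value of `V` is marked, then `markProg` finds
the mark, provided that `M` reads the mirror image of `w₀ ++ V` after the dollar. -/
theorem acc_of_mark {w₀ V R : DataWord Letter D} {d d₀ : D} {c c₁ c₂ : M.Config D}
    (hV : ((V ++ R).map Prod.snd).Nodup) (hd : d ∈ V.map Prod.snd)
    (h₁ : M.PushRun dollar d₀ c c₁) (hd₀ : d₀ ∉ (V ++ R).map Prod.snd)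
    (h₂ : M.PopRun c₁ (mirror (w₀ ++ V)) c₂) :
    M.markProg.Acc n (c.state, false)
      (Stk.map (M.colour (wordColour (V ++ R) d)) n c.stack) () := by
  obtain ⟨⟨l, d⟩, hx, rfl⟩ := List.mem_map.1 hd
  obtain ⟨s, s', rfl⟩ := List.append_of_mem hx
  rw [mirror_append, mirror_append, mirror_cons, List.append_assoc, List.append_assoc,
    List.singleton_append] at h₂
  have hl : (l, d) ∈ s ++ (l, d) :: s' ++ R := by simp
  have hd := (wordColour_of_mem hV hl).1
  refine (acc_of_pushRun h₁ (wordColour_eq_none hd₀) h₂ ?_ (.inr ⟨l, hd⟩)).2 ⟨l, hd⟩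
  rintro ⟨a, e⟩ he
  rw [mem_mirror] at he
  refine (wordColour_of_mem hV (l := a.flip) (by simp [he])).2 d ?_
  rintro rfl
  have h' := hV
  simp only [List.map_append, List.map_cons, List.nodup_append, List.nodup_cons] at h'
  exact h'.1.2.1.1 (List.mem_map.2 ⟨_, he, rfl⟩)

/-- If the marked data value is not in `V`, then `markProg` stops at the last letter of `w₀`,
which has no colour. -/
theorem not_acc_of_mark {w₀ V R : DataWord Letter D} (hw₀ : w₀ ≠ []) {d d₀ : D}
    {c c₁ c₂ : M.Config D} (hV : ((w₀ ++ (V ++ R)).map Prod.snd).Nodup) (hd : d ∉ V.map Prod.snd)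
    (h₁ : M.PushRun dollar d₀ c c₁) (hd₀ : d₀ ∉ (V ++ R).map Prod.snd)
    (h₂ : M.PopRun c₁ (mirror (w₀ ++ V)) c₂) :
    ¬ M.markProg.Acc n (c.state, false)
      (Stk.map (M.colour (wordColour (V ++ R) d)) n c.stack) () := by
  obtain ⟨w', ⟨l, e⟩, rfl⟩ := (List.eq_nil_or_concat' w₀).resolve_left hw₀
  have hV' := hV
  rw [List.map_append, List.nodup_append] at hV'
  have he : wordColour (V ++ R) d e = none :=
    wordColour_eq_none fun h => hV'.2.2 e (by simp) e h rfl
  rw [mirror_append, mirror_append (w := w'), mirror_cons, mirror_nil, List.nil_append,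
    List.singleton_append] at h₂
  rw [acc_of_pushRun h₁ (wordColour_eq_none hd₀) h₂ ?_ (.inl he), he]
  · simp
  · rintro ⟨a, e'⟩ h
    rw [mem_mirror] at h
    refine (wordColour_of_mem hV'.2.1 (l := a.flip) (by simp [h])).2 d ?_
    rintro rfl
    exact hd (List.mem_map.2 ⟨_, h, rfl⟩)

/-- The induction step: if the topmost `k`-stack can always be made to lose a data value, then so
can the topmost `(k+1)`-stack. -/
theorem escapes_succ [Infinite D] (hM : M.language D = langU D) {k : ℕ} (hk : k < n)
    (hesc : M.Escapes D k) : M.Escapes D (k + 1) := by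
  by_contra hcon
  unfold Escapes at hcon
  push Not at hcon
  obtain ⟨w₀, hw₀, hne, H⟩ := hcon
  -- a sequence of longer and longer words, where each prolongation escapes
  have step : ∀ V : {V : DataWord Letter D // Nonneg 0 (V.map Prod.fst) ∧ GoodWord (w₀ ++ V)},
      ∃ (V' : {V : DataWord Letter D // Nonneg 0 (V.map Prod.fst) ∧ GoodWord (w₀ ++ V)})
        (u : DataWord Letter D) (e : D) (c : M.Config D) (d : D),
        V'.1 = V.1 ++ (u ++ [(opn, e)]) ∧ Nonneg 0 ((u ++ [(opn, e)]).map Prod.fst) ∧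
        M.Reads (M.init D) (w₀ ++ V'.1) c ∧ d ∈ (u ++ [(opn, e)]).map Prod.snd ∧
        ∀ y : Stk (M.Cell D) k, Stk.IsTop y n c.stack → ¬ Stk.Any (fun x => x.2 = some d) k y := by
    rintro ⟨V, hV, hV'⟩
    obtain ⟨u, e, h1, h2, c, h3, d, h4, h5⟩ := hesc _ hV' (by simp [hne])
    refine ⟨⟨V ++ (u ++ [(opn, e)]), ?_, ?_⟩, u, e, c, d, rfl, h1, ?_, h4, h5⟩
    · rw [List.map_append, nonneg_append]
      exact ⟨hV, h1.mono (by simpa using hV.bal_nonneg)⟩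
    · rwa [← List.append_assoc]
    · rwa [← List.append_assoc]
  choose nxt u' e' c' d' h1' h2' h3' h4' h5' using step
  obtain ⟨V, hVs⟩ : ∃ V : ℕ → {V : DataWord Letter D //
      Nonneg 0 (V.map Prod.fst) ∧ GoodWord (w₀ ++ V)}, ∀ i, V (i + 1) = nxt (V i) :=
    ⟨fun i => nxt^[i] ⟨[], by simp [Nonneg], by simpa using hw₀⟩,
      fun i => Function.iterate_succ_apply' _ _ _⟩
  obtain ⟨u, e, C, d, h1, h2, h3, h4, h5⟩ : ∃ (u : ℕ → DataWord Letter D) (e : ℕ → D)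
      (C : ℕ → M.Config D) (d : ℕ → D),
      (∀ i, (V (i + 1)).1 = (V i).1 ++ (u i ++ [(opn, e i)])) ∧
      (∀ i, Nonneg 0 ((u i ++ [(opn, e i)]).map Prod.fst)) ∧
      (∀ i, M.Reads (M.init D) (w₀ ++ (V (i + 1)).1) (C i)) ∧
      (∀ i, d i ∈ (u i ++ [(opn, e i)]).map Prod.snd) ∧
      ∀ i, ∀ y : Stk (M.Cell D) k, Stk.IsTop y n (C i).stack →
        ¬ Stk.Any (fun x => x.2 = some (d i)) k y :=
    ⟨fun i => u' (V i), fun i => e' (V i), fun i => c' (V i), fun i => d' (V i),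
      fun i => hVs i ▸ h1' (V i), fun i => h2' (V i), fun i => hVs i ▸ h3' (V i),
      fun i => h4' (V i), fun i => h5' (V i)⟩
  clear h1' h2' h3' h4' h5' hVs nxt u' e' c' d' hesc
  obtain ⟨W, hW⟩ : ∃ W : ℕ → DataWord Letter D, ∀ i, W i = (V i).1 := ⟨_, fun _ => rfl⟩
  have hWn : ∀ i, Nonneg 0 ((W i).map Prod.fst) := fun i => hW i ▸ (V i).2.1
  have hWg : ∀ i, GoodWord (w₀ ++ W i) := fun i => hW i ▸ (V i).2.2
  simp only [← hW] at h1 h3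
  clear hW V
  have hmono : ∀ {i j}, i ≤ j → ∃ R, W j = W i ++ R ∧ Nonneg 0 (R.map Prod.fst) := by
    intro i j hij
    induction j, hij using Nat.le_induction with
    | base => exact ⟨[], by simp, by simp [Nonneg]⟩
    | succ j hij ih =>
      obtain ⟨R, hR, hR'⟩ := ih
      refine ⟨R ++ (u j ++ [(opn, e j)]), by rw [h1, hR, List.append_assoc], ?_⟩
      rw [List.map_append, nonneg_append]
      exact ⟨hR', (h2 j).mono (by simpa using hR'.bal_nonneg)⟩
  have hdW : ∀ i, d i ∈ (W (i + 1)).map Prod.snd := fun i => by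
    rw [h1, List.map_append]
    exact List.mem_append_right _ (h4 i)
  have heW : ∀ i, e i ∈ (W (i + 1)).map Prod.snd := fun i => by simp [h1]
  have hsub : ∀ {i j}, i ≤ j → ∀ {x}, x ∈ (W i).map Prod.snd → x ∈ (W j).map Prod.snd := by
    intro i j hij x hx
    obtain ⟨R, hR, -⟩ := hmono hij
    rw [hR, List.map_append]
    exact List.mem_append_left _ hx
  have hsub' : ∀ i {x}, x ∈ (W i).map Prod.snd → x ∈ (w₀ ++ W i).map Prod.snd := by
    intro i x hx
    rw [List.map_append]
    exact List.mem_append_right _ hx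
  have honly : ∀ i, Stk.OnlyTop (fun x => x.2 = some (e i)) n (C i).stack := by
    intro i
    have hg := hWg (i + 1)
    have hr := h3 i
    rw [h1, ← List.append_assoc, ← List.append_assoc] at hg hr
    exact onlyTop_of_concat hg hr
  have Hany : ∀ {v : DataWord Letter D}, v ≠ [] → Nonneg 0 (v.map Prod.fst) →
      GoodWord (w₀ ++ v) → ∀ {c : M.Config D}, M.Reads (M.init D) (w₀ ++ v) c → ∀ {d : D},
      d ∈ v.map Prod.snd → ∀ {y : Stk (M.Cell D) (k + 1)}, Stk.IsTop y n c.stack →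
      Stk.Any (fun x => x.2 = some d) (k + 1) y :=
    fun hv hv' hg _ hr _ hd _ hy => any_of_not_escapes hM H hv hv' hg hr hd hy
  clear H
  -- finitely many classes of colourings
  obtain ⟨Z, hZ, hcl⟩ := M.exists_classes (D := D) cls n hk le_rfl M.markTyping
  obtain ⟨N, hN⟩ : ∃ N, N = Nat.card Z := ⟨_, rfl⟩
  have hWne : W (N + 1) ≠ [] := by simp [h1]
  -- fresh data values for closing brackets
  obtain ⟨g, hg, hgw⟩ : ∃ g : ℕ → D, Function.Injective g ∧
      ∀ j, g j ∉ (w₀ ++ W (N + 1)).map Prod.snd := by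
    have := (List.finite_toSet ((w₀ ++ W (N + 1)).map Prod.snd)).infinite_compl.to_subtype
    let g := Infinite.natEmbedding ↥{x | x ∈ (w₀ ++ W (N + 1)).map Prod.snd}ᶜ
    exact ⟨fun j => (g j).1, fun i j h => g.injective (Subtype.ext h), fun j => (g j).2⟩
  obtain ⟨L, hL⟩ : ∃ L : ℕ, (L : ℤ) = bal ((W (N + 1)).map Prod.fst) :=
    ⟨_, Int.toNat_of_nonneg (by simpa using (hWn (N + 1)).bal_nonneg)⟩
  have hgood : ∀ b ≤ L, GoodWord (w₀ ++ W (N + 1) ++ closings g b) := by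
    intro b hb
    refine (hWg _).append_closings hg hgw ?_
    have := hw₀.nonneg.bal_nonneg
    rw [List.map_append, bal_append, ← hL]
    omega
  have hclos : ∀ b ≤ L, Nonneg 0 ((W (N + 1) ++ closings g b).map Prod.fst) := by
    intro b hb
    rw [List.map_append, nonneg_append, map_fst_closings]
    exact ⟨hWn _, nonneg_replicate_cls (by omega)⟩
  have hreads : ∀ b, ∃ c, b ≤ L → M.Reads (M.init D) (w₀ ++ W (N + 1) ++ closings g b) c := by
    intro b
    by_cases hb : b ≤ L
    · obtain ⟨c, hc⟩ := exists_reads hM (hgood b hb)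
      exact ⟨c, fun _ => hc⟩
    · exact ⟨M.init D, fun h => absurd h hb⟩
  choose S hS using hreads
  -- the data value read last before the configuration `S j`
  let f : ℕ → D := fun j => Nat.casesOn j (e N) g
  have hge : ∀ j, g j ∉ (W (N + 1)).map Prod.snd := fun j h => hgw j (hsub' _ h)
  have hnc : ∀ {x b}, x ∈ (W (N + 1)).map Prod.snd → x ∉ (closings g b).map Prod.snd := by
    intro x b hx h
    obtain ⟨j, -, rfl⟩ := mem_map_snd_closings h
    exact hge j hx
  -- the topmost `(k+1)`-stack after reading all brackets of the sequence
  obtain ⟨X, hX⟩ := Stk.IsTop.exists_of_wellFormed (C N).wf hk.le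
  obtain ⟨tail, hXt⟩ := hX.exists_succ hk
  -- its topmost `k`-stack arises from those of all `C i`, where `d i` is missing
  have hdX : ∀ i ≤ N, ¬ Stk.Any (fun x => x.2 = some (d i)) k X := by
    intro i hi
    obtain ⟨x, hx⟩ := Stk.IsTop.exists_of_wellFormed (C i).wf hk.le
    obtain ⟨r, hr⟩ := hx.exists_succ hk
    obtain ⟨R, hR, -⟩ := hmono (show i + 1 ≤ N + 1 by omega)
    have hgR := hWg (N + 1)
    have hrN := h3 N
    rw [hR, ← List.append_assoc] at hgR hrN
    have hev := evolve_of_append (h3 i) hrN (f := fun x => x.2 = some (e i))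
      (g := fun x => x.2 = some (d i))
      (fun a h => ⟨_, h, hgR.notMem_right (hsub' _ (heW i))⟩)
      (fun a h => ⟨_, h, hgR.notMem_right (hsub' _ (hdW i))⟩)
    obtain ⟨l, hl, hl', hl''⟩ := hev.suffix_self hk (honly i) hr (h5 i x hx) hXt
      (Hany hWne (hWn _) (hWg _) (h3 N) (hsub (by omega) (heW i)) hXt)
    match l, hl, hl' with
    | y :: l, _, hl' =>
      obtain ⟨rfl, -⟩ := List.cons.inj hl'
      exact fun h => hl'' (Stk.any_cons.2 (.inl h))
  -- the `i`-th colouring shows the letters read after `w₀` and marks `d i`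
  let χ : Fin (N + 1) → D → Option (Letter × Bool) := fun i => wordColour (W (N + 1)) (d i)
  have hconcat : ∀ b, ∃ (q : DataWord Letter D) (a : Letter),
      w₀ ++ W (N + 1) ++ closings g b = q ++ [(a, f b)] := by
    rintro (_ | b)
    · exact ⟨w₀ ++ (W N ++ u N), opn, by simp [closings, h1, f]⟩
    · exact ⟨w₀ ++ W (N + 1) ++ closings g b, cls, by simp [closings_succ, f]⟩
  have hfmem : ∀ b, f b ∈ (W (N + 1) ++ closings g (b + 1)).map Prod.snd := by
    rintro (_ | b)
    · rw [List.map_append]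
      exact List.mem_append_left _ (heW N)
    · simp [closings_succ, f]
  have hchain : M.PushChain cls k L S f χ := by
    refine ⟨?_, ?_, ?_, ?_, ?_, tail, ?_⟩
    · intro b hb
      have hr := hS (b + 1) hb
      have hgo := hgood (b + 1) hb
      rw [closings_succ, ← List.append_assoc] at hr hgo
      refine pushRun_of_concat ?_ (hS b (by omega)) hr
      exact fun h => hgo.notMem_right h (by simp [f])
    · rintro (_ | b) hb h
      · have h : g 0 = e N := h
        exact hge 0 (h ▸ heW N)
      · have := hg h
        omega
    · intro b hb
      obtain ⟨q, a, hq⟩ := hconcat b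
      exact onlyTop_of_concat (hq ▸ hgood b hb) (hq ▸ hS b hb)
    · intro b hb y hy
      have hr := hS (b + 1) hb
      have hgo := hgood (b + 1) hb
      rw [List.append_assoc] at hr hgo
      exact Hany (by simp [hWne]) (hclos _ hb) hgo hr (hfmem b) hy
    · intro b hb i
      exact wordColour_eq_none (hge b)
    · intro b hb
      obtain ⟨y, hy⟩ := Stk.IsTop.exists_of_wellFormed (S b).wf (Nat.succ_le_of_lt hk)
      have hr := hS b hb
      have hgo := hgood b hb
      have hev := evolve_of_append (h3 N) hr (f := fun x => x.2 = some (e N))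
        (g := fun x => ∃ i ≤ N, x.2 = some (d i)) (fun a h => ⟨_, h, hnc (heW N)⟩)
        (fun a ⟨i, hi, h⟩ => ⟨_, h, hnc (hsub (by omega) (hdW i))⟩)
      have hXg : ¬ Stk.Any (fun x => ∃ i ≤ N, x.2 = some (d i)) k X := by
        intro h
        obtain ⟨a, ⟨i, hi, ha⟩, h⟩ := Stk.exists_of_any h
        exact hdX i hi (Stk.any_mono (fun _ h => h ▸ ha) h)
      rw [List.append_assoc] at hr hgo
      obtain ⟨l, -, hl, hgl⟩ := hev.suffix_self hk (honly N) hXt hXg hy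
        (Hany (by simp [hWne]) (hclos _ hb) hgo hr
          (by rw [List.map_append]; exact List.mem_append_left _ (heW N)) hy)
      refine ⟨l, hl ▸ hy, fun i i' => ?_⟩
      refine Stk.map_congr (n := k + 1) fun h => hgl (Stk.any_mono ?_ h)
      rintro ⟨γ, x⟩ hx
      by_contra hno
      push Not at hno
      refine hx ?_
      cases x with
      | none => rfl
      | some x =>
        have h : ∀ j : Fin (N + 1), x ≠ d j := fun j h =>
          hno j (Nat.le_of_lt_succ j.2) (congrArg some h)
        exact congrArg (Prod.mk γ) (wordColour_congr _ (h i) (h i'))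
  obtain ⟨z, hz⟩ := hcl (Fin (N + 1)) L S f χ hchain
  obtain ⟨i, i', hii, hzz⟩ : ∃ i i' : Fin (N + 1), i < i' ∧ z i = z i' := by
    have := Fintype.ofFinite Z
    obtain ⟨i, i', hne, h⟩ := Fintype.exists_ne_map_eq_of_card_lt z (by
      rw [Fintype.card_fin, hN, Nat.card_eq_fintype_card]; omega)
    rcases lt_or_gt_of_ne hne with h' | h'
    · exact ⟨i, i', h', h⟩
    · exact ⟨i', i, h', h.symm⟩
  -- close all brackets after the `i`-th prolongation
  have hii : (i : ℕ) < i' := hii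
  obtain ⟨R, hR, hRn⟩ := hmono (show (i : ℕ) + 1 ≤ N + 1 by omega)
  obtain ⟨b, hb⟩ : ∃ b : ℕ, (b : ℤ) = bal (R.map Prod.fst) :=
    ⟨_, Int.toNat_of_nonneg (by simpa using hRn.bal_nonneg)⟩
  have hbL : b ≤ L := by
    have := (hWn (i + 1)).bal_nonneg
    rw [hR, List.map_append, bal_append, ← hb] at hL
    omega
  have hm : WellBracketed ((R ++ closings g b).map Prod.fst) := by
    rw [wellBracketed_iff, List.map_append, map_fst_closings, nonneg_append, bal_append,
      bal_replicate_cls, ← hb]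
    refine ⟨?_, ⟨hRn, nonneg_replicate_cls (by omega)⟩, by omega⟩
    have h := (hgood b hbL).dollar
    rw [hR] at h
    simp only [List.map_append, List.mem_append, map_fst_closings] at h ⊢
    tauto
  have hq : w₀ ++ W (N + 1) ++ closings g b =
      (w₀ ++ (W i ++ u i)) ++ [(opn, e i)] ++ (R ++ closings g b) := by
    simp [hR, h1]
  have hp : w₀ ++ W (i + 1) = (w₀ ++ (W i ++ u i)) ++ [(opn, e i)] := by simp [h1]
  obtain ⟨d₀, hd₀⟩ := exists_fresh (w₀ ++ W (N + 1) ++ closings g b)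
  obtain ⟨c₁, c₂, hpush, hpop⟩ := exists_popRun hM (hq ▸ hgood b hbL) hm (hq ▸ hS b hbL) (hq ▸ hd₀)
  rw [← hp] at hpop
  have hd₀' : d₀ ∉ (W (i + 1) ++ R).map Prod.snd := by
    rw [← hR]
    simp only [List.map_append, List.mem_append] at hd₀ ⊢
    tauto
  have hnd := (hWg (N + 1)).nodup
  rw [hR] at hnd
  have hnd' := hnd
  rw [List.map_append, List.nodup_append] at hnd'
  have hacc := acc_of_mark hnd'.2.1 (hdW i) hpush hd₀' hpop
  refine not_acc_of_mark hne (d := d i') hnd ?_ hpush hd₀' hpop ?_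
  · intro h
    have hg' := hWg (i' + 1)
    rw [h1, ← List.append_assoc] at hg'
    exact hg'.notMem_right (hsub' _ (hsub (by omega) h)) (h4 i')
  · rw [← hR] at hacc ⊢
    exact acc_of_markTyping_eq (hz i i' hzz b hbL _ .refl) hacc

/-- No automaton without collapse recognizes the language. -/
theorem language_ne_langU [Infinite D] (M : HOPAD Letter n) : M.language D ≠ langU D := by
  intro hM
  have hesc : ∀ k ≤ n, M.Escapes D k := by
    intro k hk
    induction k with
    | zero => exact escapes_zero hM
    | succ k ih => exact escapes_succ hM hk (ih (by omega))
  obtain ⟨a⟩ : Nonempty D := inferInstance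
  have hw : GoodWord [(opn, a)] := ⟨by simp, by simp [Nonneg, val], by simp⟩
  obtain ⟨u, e, -, hg, c, hc, d, hd, h⟩ := hesc n le_rfl _ hw (by simp)
  rw [← List.append_assoc] at hg hc
  obtain ⟨d₀, hd₀⟩ := exists_fresh ([(opn, a)] ++ u ++ [(opn, e)])
  obtain ⟨c₁, c₂, hpush, hpop⟩ := exists_popRun hM (m := []) (by rwa [List.append_nil])
    (by simp [wellBracketed_iff, Nonneg]) (by rwa [List.append_nil]) (by rwa [List.append_nil])
  have hd' : d ∈ ([(opn, a)] ++ u ++ [(opn, e)]).map Prod.snd := by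
    rw [List.append_assoc, List.map_append]
    exact List.mem_append_right _ hd
  have hany := hpop.any (d := d) (by
    obtain ⟨x, hx, rfl⟩ := List.mem_map.1 hd'
    exact List.mem_map.2 ⟨(x.1.flip, x.2), mem_mirror.2 (by simpa using hx), rfl⟩)
  rcases (evolve_of_run hpush.reads.run).any hany with h' | ⟨x, y, h1, h2⟩
  · exact h _ .refl h'
  · have : d = d₀ := by simpa using h1.2 d h2
    exact hd₀ (this ▸ hd')

end HOPAD

/-! ### Acceptance by collapsible automata of level `2` -/

namespace CPAD

variable (M : CPAD Letter 2) {D : Type v}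

/-- The word `w` is accepted from the state `q` and the (well-formed) stack `s`. -/
def Accepts (q : M.Q) (s : List (List (M.Cell D))) (w : DataWord Letter D) : Prop :=
  ∃ (h : Stk.WellFormed 2 s) (c : M.Config D), Run M.Step ⟨q, s, h⟩ w c ∧ c.state ∈ M.F

variable {M}

theorem wellFormed_two {R : List (M.Cell D)} {E : List (List (M.Cell D))} (hR : R ≠ [])
    (hE : ∀ t ∈ E, t ≠ []) : Stk.WellFormed 2 (R :: E : List (List (M.Cell D))) := by
  refine ⟨Nat.succ_ne_zero _, fun t ht => ⟨fun h => ?_, fun _ _ => trivial⟩⟩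
  have h := List.length_eq_zero_iff.1 h
  rcases List.mem_cons.1 ht with rfl | ht
  · exact hR h
  · exact hE t ht h

/-- The top of a nonempty stack of level `2`. -/
theorem top_two (x : M.Cell D) (R : List (M.Cell D)) (E : List (List (M.Cell D))) :
    Stk.top 2 ((x :: R) :: E : List (List (M.Cell D))) = some x := rfl

variable {q : M.Q} {x : M.Cell D} {R : List (M.Cell D)} {E : List (List (M.Cell D))}
  {w : DataWord Letter D}

theorem accepts_eps_iff (hq : q ∉ M.F) (hE : ∀ t ∈ E, t ≠ []) {q' : M.Q} {op : COp M.Γ 2}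
    (hδ : M.δ q x.1 none = some (q', op)) :
    M.Accepts q ((x :: R) :: E) w ↔ ∃ s' : List (List (M.Cell D)),
      M.Effect none x.2.1 x.2.2 ((x :: R) :: E : List (List (M.Cell D))) s' op ∧
        M.Accepts q' s' w := by
  constructor
  · rintro ⟨h, c, hr, hc⟩
    cases hr with
    | nil => exact absurd hc hq
    | eps hs hr =>
      obtain ⟨α, d', ks, op', ht, hδ', he⟩ := hs
      obtain rfl := Option.some.inj ((top_two x R E).symm.trans ht)
      have e := Option.some.inj (hδ.symm.trans hδ')
      rw [Prod.mk.injEq] at e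
      obtain ⟨rfl, rfl⟩ := e
      exact ⟨_, he, Config.wf _, c, hr, hc⟩
    | read hs hr =>
      obtain ⟨α, d', ks, op', ht, hδ', he⟩ := hs
      obtain rfl := Option.some.inj ((top_two x R E).symm.trans ht)
      exact (M.det q α _ ⟨Option.isSome_iff_exists.2 ⟨_, hδ⟩,
        Option.isSome_iff_exists.2 ⟨_, hδ'⟩⟩).elim
  · rintro ⟨s', he, h, c, hr, hc⟩
    refine ⟨wellFormed_two (List.cons_ne_nil _ _) hE, c, .eps (c' := ⟨q', s', h⟩) ?_ hr, hc⟩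
    exact ⟨x.1, x.2.1, x.2.2, op, rfl, hδ, he⟩

theorem not_accepts_nil (hq : q ∉ M.F) (hδ : M.δ q x.1 none = none) :
    ¬ M.Accepts q ((x :: R) :: E) [] := by
  rintro ⟨h, c, hr, hc⟩
  cases hr with
  | nil => exact hq hc
  | eps hs hr =>
    obtain ⟨α, d', ks, op', ht, hδ', he⟩ := hs
    obtain rfl := Option.some.inj ((top_two x R E).symm.trans ht)
    cases hδ.symm.trans hδ'

theorem accepts_cons_iff (hE : ∀ t ∈ E, t ≠ []) (hδ : M.δ q x.1 none = none) {a : Letter} {d : D} :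
    M.Accepts q ((x :: R) :: E) ((a, d) :: w) ↔ ∃ (q' : M.Q) (op : COp M.Γ 2)
      (s' : List (List (M.Cell D))), M.δ q x.1 (some a) = some (q', op) ∧
        M.Effect (some d) x.2.1 x.2.2 ((x :: R) :: E : List (List (M.Cell D))) s' op ∧
        M.Accepts q' s' w := by
  constructor
  · rintro ⟨h, c, hr, hc⟩
    cases hr with
    | eps hs hr =>
      obtain ⟨α, d', ks, op', ht, hδ', he⟩ := hs
      obtain rfl := Option.some.inj ((top_two x R E).symm.trans ht)
      cases hδ.symm.trans hδ'
    | @read _ c₁ _ y w' hs hr =>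
      obtain ⟨α, d', ks, op', ht, hδ', he⟩ := hs
      obtain rfl := Option.some.inj ((top_two x R E).symm.trans ht)
      exact ⟨c₁.state, op', c₁.stack, hδ', he, c₁.wf, c, hr, hc⟩
  · rintro ⟨q', op, s', hδ', he, h, c, hr, hc⟩
    refine ⟨wellFormed_two (List.cons_ne_nil _ _) hE, c, .read (c' := ⟨q', s', h⟩) ?_ hr, hc⟩
    exact ⟨x.1, x.2.1, x.2.2, op, rfl, hδ', he⟩

theorem accepts_halt_iff (hq : q ∈ M.F) (hE : ∀ t ∈ E, t ≠ []) (hδ : ∀ a, M.δ q x.1 a = none) :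
    M.Accepts q ((x :: R) :: E) w ↔ w = [] := by
  constructor
  · rintro ⟨h, c, hr, hc⟩
    cases hr with
    | nil => rfl
    | eps hs hr =>
      obtain ⟨α, d', ks, op', ht, hδ', he⟩ := hs
      obtain rfl := Option.some.inj ((top_two x R E).symm.trans ht)
      cases (hδ _).symm.trans hδ'
    | read hs hr =>
      obtain ⟨α, d', ks, op', ht, hδ', he⟩ := hs
      obtain rfl := Option.some.inj ((top_two x R E).symm.trans ht)
      cases (hδ _).symm.trans hδ'
  · rintro rfl
    exact ⟨wellFormed_two (List.cons_ne_nil _ _) hE, _, .nil _, hq⟩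

end CPAD

/-! ### A collapsible automaton recognizing the language -/

namespace Bracket

/-- Stack symbols: the bottom symbol, brackets, and an auxiliary symbol. -/
inductive Sym
  | bot
  | opn
  | cls
  | aux

instance : Finite Sym :=
  Finite.of_surjective ![Sym.bot, .opn, .cls, .aux] <| by
    rintro (_ | _ | _ | _)
    exacts [⟨0, rfl⟩, ⟨1, rfl⟩, ⟨2, rfl⟩, ⟨3, rfl⟩]

/-- States. The states `store₁`, `store₂`, `store₃` put a copy of the topmost `1`-stack
below it, `cancel` removes a matched pair of brackets, `dollar` and `turn` are used just after the
dollar, and in the state `back` the remaining letters are compared with the stored `1`-stacks. -/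
inductive State
  | start
  | ready
  | store₁
  | store₂
  | store₃
  | cancel
  | dollar
  | turn
  | back
  | acc

instance : Finite State :=
  Finite.of_surjective ![State.start, .ready, .store₁, .store₂, .store₃, .cancel, .dollar, .turn,
    .back, .acc] <| by
    rintro (_ | _ | _ | _ | _ | _ | _ | _ | _ | _)
    exacts [⟨0, rfl⟩, ⟨1, rfl⟩, ⟨2, rfl⟩, ⟨3, rfl⟩, ⟨4, rfl⟩, ⟨5, rfl⟩, ⟨6, rfl⟩, ⟨7, rfl⟩,
      ⟨8, rfl⟩, ⟨9, rfl⟩]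

/-- The transition function. -/
def trans : State → Sym → Option Letter → Option (State × COp Sym 2)
  | .start, _, none => some (.ready, .push 1 .bot)
  | .ready, .bot, some .opn => some (.store₁, .push 0 .opn)
  | .ready, .opn, some .opn => some (.store₁, .push 0 .opn)
  | .ready, .opn, some .cls => some (.store₁, .push 0 .cls)
  | .ready, .cls, none => some (.cancel, .pop 0)
  | .ready, .bot, some .dollar => some (.dollar, .push 0 .aux)
  | .ready, .opn, some .dollar => some (.dollar, .push 0 .aux)
  | .store₁, _, none => some (.store₂, .push 0 .aux)
  | .store₂, _, none => some (.store₃, .push 1 .aux)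
  | .store₃, _, none => some (.ready, .pop 0)
  | .cancel, _, none => some (.ready, .pop 0)
  | .dollar, _, none => some (.turn, .pop 0)
  | .turn, .bot, none => some (.acc, .push 0 .aux)
  | .turn, .opn, some .cls => some (.back, .collapse 1)
  | .back, .aux, none => some (.back, .pop 0)
  | .back, .opn, some .cls => some (.back, .pop 1)
  | .back, .cls, some .opn => some (.back, .pop 1)
  | .back, .bot, none => some (.acc, .push 0 .aux)
  | _, _, _ => none

/-- The automaton. While reading the part before the dollar, the topmost `1`-stack contains the
opening brackets not closed so far, and below it there is one `1`-stack for every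
letter read so far, which has this letter just below its topmost symbol `aux`. After the dollar, a
collapse at the last unclosed opening bracket uncovers the `1`-stacks of the letters before that
bracket. -/
abbrev automaton : CPAD Letter 2 where
  Γ := Sym
  finΓ := inferInstance
  γI := .bot
  Q := State
  finQ := inferInstance
  qI := .start
  F := {.acc}
  δ := trans
  det := by
    rintro q α a ⟨h, h'⟩
    cases q <;> cases α <;> cases a <;> simp [trans] at h h'

variable {D : Type v}

/-- The `0`-stacks of the automaton. -/
abbrev Cell (D : Type v) : Type v := automaton.Cell D

/-- The symbol of a bracket. -/
def sym : Letter → Sym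
  | .opn => .opn
  | .cls => .cls
  | .dollar => .aux

/-- `Hist w E`: the list `E` of `1`-stacks stores the word `w`. -/
inductive Hist : DataWord Letter D → List (List (Cell D)) → Prop
  | nil (o : Option D) (ks : Fin 2 → ℕ) : Hist [] [[(Sym.bot, o, ks)]]
  | concat {w : DataWord Letter D} {E : List (List (Cell D))} (l : Letter) (d : D) (o : Option D)
      (ks ks' : Fin 2 → ℕ) (R : List (Cell D)) : Hist w E → l ≠ dollar →
      Hist (w ++ [(l, d)]) (((Sym.aux, o, ks) :: (sym l, some d, ks') :: R) :: E)

/-- `Unclosed w R`: the `1`-stack `R` contains the opening brackets of `w` that are not closed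
in `w`; each of them stores the size of the `2`-stack when it was read. -/
inductive Unclosed : DataWord Letter D → List (Cell D) → Prop
  | bot {m : DataWord Letter D} (o : Option D) (ks : Fin 2 → ℕ) :
      WellBracketed (m.map Prod.fst) → Unclosed m [(Sym.bot, o, ks)]
  | opn {w m : DataWord Letter D} {R : List (Cell D)} (d : D) (ks : Fin 2 → ℕ) :
      Unclosed w R → WellBracketed (m.map Prod.fst) → ks 1 = w.length + 2 →
      Unclosed (w ++ (Letter.opn, d) :: m) ((Sym.opn, some d, ks) :: R)

theorem wellBracketed_nil : WellBracketed [] := by simp [wellBracketed_iff, Nonneg]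

theorem wellBracketed_close {m m' : List Letter} (h : WellBracketed m) (h' : WellBracketed m') :
    WellBracketed (m ++ Letter.opn :: m' ++ [Letter.cls]) := by
  rw [wellBracketed_iff] at *
  obtain ⟨h1, h2, h3⟩ := h
  obtain ⟨h1', h2', h3'⟩ := h'
  refine ⟨by simp [h1, h1'], ?_, by simp [h3, h3', val]⟩
  rw [nonneg_append, nonneg_append]
  refine ⟨⟨h2, by simp [h3], h2'.mono (by simp [h3, val])⟩, ?_, ?_⟩ <;> simp [h3, h3', val, Nonneg]

theorem Unclosed.ne_nil {w : DataWord Letter D} {R : List (Cell D)} (h : Unclosed w R) :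
    R ≠ [] := by
  cases h <;> simp

theorem Unclosed.close {w : DataWord Letter D} {d d' : D} {R : List (Cell D)} {ks : Fin 2 → ℕ}
    (h : Unclosed w ((Sym.opn, some d', ks) :: R)) : Unclosed (w ++ [(Letter.cls, d)]) R := by
  cases h with
  | @opn w m _ _ _ h hm hks =>
    cases h with
    | @bot m' o ks hm' =>
      refine .bot o ks ?_
      simpa using wellBracketed_close hm' hm
    | @opn w m' R d'' ks'' h hm' hks' =>
      have := Unclosed.opn (m := m' ++ (Letter.opn, d') :: m ++ [(Letter.cls, d)]) d'' ks'' h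
        (by simpa using wellBracketed_close hm' hm) hks'
      simpa using this

theorem Unclosed.dollar_notMem {w : DataWord Letter D} {R : List (Cell D)} (h : Unclosed w R) :
    Letter.dollar ∉ w.map Prod.fst := by
  induction h with
  | bot _ _ h => exact h.1
  | opn d ks _ h _ ih =>
    have := h.1
    simp only [List.map_append, List.map_cons, List.mem_append, List.mem_cons]
    simp_all

theorem Unclosed.nonneg {w : DataWord Letter D} {R : List (Cell D)} (h : Unclosed w R) :
    Nonneg 0 (w.map Prod.fst) := by
  induction h with
  | bot _ _ h => exact (wellBracketed_iff.1 h).2.1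
  | opn d ks _ h _ ih =>
    rw [List.map_append, nonneg_append]
    have := ih.bal_nonneg
    exact ⟨ih, this, (wellBracketed_iff.1 h).2.1.mono (by simp only [val]; omega)⟩

theorem Hist.ne_nil {w : DataWord Letter D} {E : List (List (Cell D))} (h : Hist w E) :
    ∀ t ∈ E, t ≠ [] := by
  induction h with
  | nil => simp
  | concat l d o ks ks' R _ _ ih => simpa using ih

theorem Hist.length {w : DataWord Letter D} {E : List (List (Cell D))} (h : Hist w E) :
    E.length = w.length + 1 := by
  induction h with
  | nil => rfl
  | concat l d o ks ks' R _ _ ih => simp [ih]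

theorem Hist.drop {w : DataWord Letter D} (u : DataWord Letter D) :
    ∀ {E : List (List (Cell D))}, Hist (w ++ u) E → Hist w (E.drop u.length) := by
  induction u using List.reverseRecOn with
  | nil => intro E h; simpa using h
  | append_singleton u x ih =>
    intro E h
    generalize hw : w ++ (u ++ [x]) = w' at h
    cases h with
    | nil => simp at hw
    | concat l d o ks ks' R h hl =>
      rw [← List.append_assoc] at hw
      obtain ⟨rfl, -⟩ := List.append_inj' hw rfl
      simpa using ih h

/-- The decomposition into a part ending with an opening bracket and a well-formed bracket
expression is unique. -/
theorem append_wellBracketed_unique {p p' m m' : DataWord Letter D} (h : p ++ m = p' ++ m')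
    (hm : WellBracketed (m.map Prod.fst)) (hm' : WellBracketed (m'.map Prod.fst))
    (hp : p = [] ∨ ∃ q e, p = q ++ [(Letter.opn, e)])
    (hp' : p' = [] ∨ ∃ q e, p' = q ++ [(Letter.opn, e)]) : p = p' := by
  have key : ∀ {p s m : DataWord Letter D}, WellBracketed ((s ++ m).map Prod.fst) →
      WellBracketed (m.map Prod.fst) → (p ++ s = [] ∨ ∃ q e, p ++ s = q ++ [(Letter.opn, e)]) →
      s = [] := by
    intro p s m h h' hp
    rcases List.eq_nil_or_concat' s with rfl | ⟨s, x, rfl⟩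
    · rfl
    · exfalso
      rcases hp with hp | ⟨q, e, hp⟩
      · simp at hp
      · rw [← List.append_assoc] at hp
        obtain ⟨-, e⟩ := List.append_inj' hp rfl
        obtain rfl := List.singleton_inj.1 e
        rw [wellBracketed_iff] at h h'
        obtain ⟨-, h1, h2⟩ := h
        simp only [List.map_append, nonneg_append] at h1
        have := h1.1.1.bal_nonneg
        simp [h'.2.2, val] at h2
        omega
  rcases List.append_eq_append_iff.1 h with ⟨s, rfl, rfl⟩ | ⟨s, rfl, rfl⟩
  · rw [key hm hm' hp', List.append_nil]
  · rw [key hm' hm hp, List.append_nil]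

section steps

variable {q q' : State} {x y : Cell D} {R : List (Cell D)} {E : List (List (Cell D))} {β : Sym}
  {a : Letter} {d : D} {w : DataWord Letter D}

theorem eps_pop (hq : q ≠ .acc) (hE : ∀ t ∈ E, t ≠ [])
    (hδ : trans q x.1 none = some (q', .pop 0)) :
    automaton.Accepts q ((x :: y :: R) :: E) w ↔ automaton.Accepts q' ((y :: R) :: E) w := by
  rw [CPAD.accepts_eps_iff (M := automaton) hq hE hδ]
  constructor
  · rintro ⟨s', ⟨-, rfl⟩, h⟩
    exact h
  · exact fun h => ⟨_, ⟨.inl rfl, rfl⟩, h⟩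

theorem eps_push (hq : q ≠ .acc) (hE : ∀ t ∈ E, t ≠ [])
    (hδ : trans q x.1 none = some (q', .push 0 β)) :
    ∃ ks, automaton.Accepts q ((x :: R) :: E) w ↔
      automaton.Accepts q' (((β, none, ks) :: x :: R) :: E) w := by
  rw [CPAD.accepts_eps_iff (M := automaton) hq hE hδ]
  refine ⟨_, ?_, fun h => ⟨_, rfl, h⟩⟩
  rintro ⟨s', rfl, h⟩
  exact h

theorem eps_push_two (hq : q ≠ .acc) (hE : ∀ t ∈ E, t ≠ [])
    (hδ : trans q x.1 none = some (q', .push 1 β)) :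
    ∃ ks, automaton.Accepts q ((x :: R) :: E) w ↔
      automaton.Accepts q' (((β, none, ks) :: R) :: (x :: R) :: E) w := by
  rw [CPAD.accepts_eps_iff (M := automaton) hq hE hδ]
  refine ⟨_, ?_, fun h => ⟨_, rfl, h⟩⟩
  rintro ⟨s', rfl, h⟩
  exact h

theorem read_push (hE : ∀ t ∈ E, t ≠ []) (hδ : trans q x.1 none = none)
    (hδ' : trans q x.1 (some a) = some (q', .push 0 β)) :
    ∃ ks : Fin 2 → ℕ, ks 1 = E.length + 1 ∧
      (automaton.Accepts q ((x :: R) :: E) ((a, d) :: w) ↔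
        automaton.Accepts q' (((β, some d, ks) :: x :: R) :: E) w) := by
  rw [CPAD.accepts_cons_iff (M := automaton) hE hδ]
  refine ⟨_, ?_, ?_, fun h => ⟨q', .push 0 β, _, hδ', rfl, h⟩⟩
  · rfl
  · rintro ⟨q₁, op, s', hδ₁, he, h⟩
    cases hδ'.symm.trans hδ₁
    obtain rfl := he
    exact h

theorem read_pop_two (hE : ∀ t ∈ E, t ≠ []) (hδ : trans q x.1 none = none)
    (hδ' : trans q x.1 (some a) = some (q', .pop 1)) :
    automaton.Accepts q ((x :: R) :: E) ((a, d) :: w) ↔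
      x.2.1 = some d ∧ automaton.Accepts q' E w := by
  rw [CPAD.accepts_cons_iff (M := automaton) hE hδ]
  refine ⟨?_, fun h => ⟨q', .pop 1, _, hδ', ⟨.inr h.1.symm, rfl⟩, h.2⟩⟩
  rintro ⟨q₁, op, s', hδ₁, he, h⟩
  cases hδ'.symm.trans hδ₁
  obtain ⟨h1, rfl⟩ := he
  exact ⟨(h1.resolve_left nofun).symm, h⟩

theorem read_collapse_two (hE : ∀ t ∈ E, t ≠ []) (hδ : trans q x.1 none = none)
    (hδ' : trans q x.1 (some a) = some (q', .collapse 1)) :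
    automaton.Accepts q ((x :: R) :: E) ((a, d) :: w) ↔ x.2.1 = some d ∧
      automaton.Accepts q' (((x :: R) :: E).drop (E.length + 1 - (x.2.2 1 - 1))) w := by
  rw [CPAD.accepts_cons_iff (M := automaton) hE hδ]
  refine ⟨?_, fun h => ⟨q', .collapse 1, _, hδ', ⟨.inr h.1.symm, rfl⟩, h.2⟩⟩
  rintro ⟨q₁, op, s', hδ₁, he, h⟩
  cases hδ'.symm.trans hδ₁
  obtain ⟨h1, rfl⟩ := he
  exact ⟨(h1.resolve_left nofun).symm, h⟩

theorem not_read (hE : ∀ t ∈ E, t ≠ []) (hδ : trans q x.1 none = none)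
    (hδ' : trans q x.1 (some a) = none) :
    ¬ automaton.Accepts q ((x :: R) :: E) ((a, d) :: w) := by
  rw [CPAD.accepts_cons_iff (M := automaton) hE hδ]
  rintro ⟨q₁, op, s', hδ₁, -⟩
  cases hδ'.symm.trans hδ₁

theorem accepts_acc_iff (hE : ∀ t ∈ E, t ≠ []) :
    automaton.Accepts State.acc ((x :: R) :: E) w ↔ w = [] :=
  CPAD.accepts_halt_iff (M := automaton) rfl hE fun _ => rfl

end steps

/-- In the state `back` the automaton reads the mirror image of the stored word. -/
theorem accepts_back_iff {w : DataWord Letter D} {E : List (List (Cell D))} (h : Hist w E) :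
    ∀ {v : DataWord Letter D}, automaton.Accepts State.back E v ↔ v = mirror w := by
  induction h with
  | nil o ks =>
    intro v
    obtain ⟨ks', h⟩ := eps_push (q := State.back) (x := ((Sym.bot, o, ks) : Cell D)) (R := [])
      (E := []) (w := v) nofun (by simp) rfl
    rw [h, accepts_acc_iff (by simp), mirror_nil]
  | @concat w E l d o ks ks' R h hl ih =>
    intro v
    rw [mirror_append, mirror_cons, mirror_nil, List.nil_append, List.singleton_append,
      eps_pop (q := .back) (q' := .back) nofun h.ne_nil rfl]
    have hnone : trans State.back (sym l) none = none := by
      cases l <;> first | rfl | exact absurd rfl hl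
    match v with
    | [] => exact ⟨fun h => absurd h (CPAD.not_accepts_nil (M := automaton) (nofun) hnone), nofun⟩
    | (a, e) :: v =>
      rw [List.cons.injEq, Prod.mk.injEq]
      by_cases ha : a = l.flip
      · subst ha
        rw [read_pop_two (q' := .back) h.ne_nil hnone
          (by cases l <;> first | rfl | exact absurd rfl hl), ih, Option.some_inj]
        simp only [true_and, eq_comm]
      · refine ⟨fun h' => absurd h' (not_read h.ne_nil hnone ?_), fun h' => absurd h'.1.1 ha⟩
        cases l <;> cases a <;> first | rfl | exact absurd rfl hl | exact absurd rfl ha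

/-- In the state `turn` the automaton reads the mirror image of the part before the dollar that
ends on the last unclosed opening bracket. -/
theorem accepts_turn_iff {w v : DataWord Letter D} {R : List (Cell D)} {E : List (List (Cell D))}
    (hR : Unclosed w R) (hE : Hist w E) : automaton.Accepts State.turn (R :: E) v ↔
      ∃ p m, w = p ++ m ∧ WellBracketed (m.map Prod.fst) ∧
        (p = [] ∨ ∃ q e, p = q ++ [(Letter.opn, e)]) ∧ v = mirror p := by
  have hdec : ∀ {p₀ m₀ : DataWord Letter D}, w = p₀ ++ m₀ → WellBracketed (m₀.map Prod.fst) →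
      (p₀ = [] ∨ ∃ q e, p₀ = q ++ [(Letter.opn, e)]) →
      ((∃ p m, w = p ++ m ∧ WellBracketed (m.map Prod.fst) ∧
        (p = [] ∨ ∃ q e, p = q ++ [(Letter.opn, e)]) ∧ v = mirror p) ↔ v = mirror p₀) := by
    intro p₀ m₀ h1 h2 h3
    constructor
    · rintro ⟨p, m, h1', h2', h3', h4⟩
      rwa [append_wellBracketed_unique (h1.symm.trans h1') h2 h2' h3 h3']
    · exact fun h => ⟨p₀, m₀, h1, h2, h3, h⟩
  cases hR with
  | bot o ks hw =>
    obtain ⟨ks', h⟩ := eps_push (q := State.turn) (x := ((Sym.bot, o, ks) : Cell D)) (R := [])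
      (w := v) nofun hE.ne_nil rfl
    rw [h, accepts_acc_iff hE.ne_nil, hdec (p₀ := []) rfl hw (.inl rfl), mirror_nil]
  | @opn w m R d ks hR hm hks =>
    rw [hdec (p₀ := w ++ [(Letter.opn, d)]) (m₀ := m) (by simp) hm (.inr ⟨_, _, rfl⟩),
      mirror_append, mirror_cons, mirror_nil, List.nil_append, List.singleton_append]
    match v with
    | [] => exact ⟨fun h => absurd h (CPAD.not_accepts_nil (M := automaton) (nofun) rfl), nofun⟩
    | (a, e) :: v =>
      rw [List.cons.injEq, Prod.mk.injEq]
      by_cases ha : a = Letter.cls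
      · subst ha
        have hlen : E.length + 1 - (ks 1 - 1) = m.length + 1 + 1 := by
          rw [hE.length, hks, List.length_append, List.length_cons]
          omega
        have hback := accepts_back_iff (v := v) (hE.drop ((Letter.opn, d) :: m))
        rw [List.length_cons] at hback
        rw [read_collapse_two (q' := .back) hE.ne_nil rfl rfl, hlen, List.drop_succ_cons, hback,
          Option.some_inj]
        simp only [Letter.flip, true_and, eq_comm]
      · refine ⟨fun h' => absurd h' (not_read hE.ne_nil rfl ?_), fun h' => absurd h'.1.1 ha⟩
        cases a <;> first | rfl | exact absurd rfl ha

/-- The letter that has just been pushed on top of `R` is stored below. -/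
theorem accepts_store_iff {w : DataWord Letter D} {c y : Cell D} {R : List (Cell D)}
    {E : List (List (Cell D))} (hE : ∀ t ∈ E, t ≠ []) :
    ∃ ks, automaton.Accepts State.store₁ ((c :: y :: R) :: E) w ↔ automaton.Accepts State.ready
      ((c :: y :: R) :: ((Sym.aux, none, ks) :: c :: y :: R) :: E) w := by
  obtain ⟨ks, h⟩ := eps_push (q := .store₁) (x := c) (R := y :: R) (w := w) nofun hE rfl
  obtain ⟨ks', h'⟩ := eps_push_two (q := .store₂) (x := ((Sym.aux, none, ks) : Cell D))
    (R := c :: y :: R) (w := w) nofun hE rfl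
  refine ⟨ks, ?_⟩
  rw [h, h', eps_pop (q := .store₃) (q' := .ready) nofun (by simpa using hE) rfl]

/-- The condition under which `x` may follow after the word `w` without dollars in a word of the
language. -/
def Completes (w x : DataWord Letter D) : Prop :=
  ∃ m v d, x = m ++ (Letter.dollar, d) :: v ∧ Letter.dollar ∉ (w ++ m).map Prod.fst ∧
    Nonneg 0 ((w ++ m).map Prod.fst) ∧
    ∃ p m', w ++ m = p ++ m' ∧ WellBracketed (m'.map Prod.fst) ∧
        (p = [] ∨ ∃ q e, p = q ++ [(Letter.opn, e)]) ∧ v = mirror p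

theorem completes_cons_iff {w x : DataWord Letter D} {l : Letter} (hl : l ≠ Letter.dollar) {d : D} :
    Completes w ((l, d) :: x) ↔ Completes (w ++ [(l, d)]) x := by
  constructor
  · rintro ⟨_ | ⟨y, m⟩, v, d', hx, h⟩
    · cases hx
      exact absurd rfl hl
    · obtain ⟨rfl, rfl⟩ := List.cons.inj hx
      exact ⟨m, v, d', rfl, by simpa using h⟩
  · rintro ⟨m, v, d', rfl, h⟩
    exact ⟨(l, d) :: m, v, d', rfl, by simpa using h⟩

theorem completes_dollar_iff {w v : DataWord Letter D} {d : D}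
    (hw : Letter.dollar ∉ w.map Prod.fst) (hw' : Nonneg 0 (w.map Prod.fst)) :
    Completes w ((Letter.dollar, d) :: v) ↔
      ∃ p m, w = p ++ m ∧ WellBracketed (m.map Prod.fst) ∧
        (p = [] ∨ ∃ q e, p = q ++ [(Letter.opn, e)]) ∧ v = mirror p := by
  constructor
  · rintro ⟨_ | ⟨y, m⟩, v', d', hx, h1, h2, h3⟩
    · cases hx
      simpa using h3
    · rw [List.cons_append] at hx
      rw [← (List.cons.inj hx).1] at h1
      simp at h1
  · intro h
    exact ⟨[], v, d, rfl, by simpa using hw, by simpa using hw', by simpa using h⟩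

/-- The words accepted after reading a word `w` without dollars. -/
theorem accepts_ready_iff {x : DataWord Letter D} : ∀ {w : DataWord Letter D} {R : List (Cell D)}
    {E : List (List (Cell D))}, Unclosed w R → Hist w E →
    (automaton.Accepts State.ready (R :: E) x ↔ Completes w x) := by
  induction x with
  | nil =>
    intro w R E hR hE
    refine ⟨fun h => ?_, fun ⟨m, v, d, h, _⟩ => by simp at h⟩
    cases hR <;> exact absurd h (CPAD.not_accepts_nil (M := automaton) (nofun) rfl)
  | cons y x ih =>
    obtain ⟨l, d⟩ := y
    intro w R E hR hE
    obtain ⟨y, R, rfl⟩ := List.exists_cons_of_ne_nil hR.ne_nil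
    have hy : y.1 = Sym.bot ∨ y.1 = Sym.opn := by
      cases hR
      · exact .inl rfl
      · exact .inr rfl
    have hnone : trans .ready y.1 none = none := by rcases hy with h | h <;> rw [h] <;> rfl
    cases l with
    | opn =>
      obtain ⟨ks, hks, h⟩ := read_push (q := .ready) (x := y) (R := R) (w := x) (a := .opn) (d := d)
        (q' := .store₁) (β := .opn) hE.ne_nil hnone (by rcases hy with h | h <;> rw [h] <;> rfl)
      obtain ⟨ks', h'⟩ := accepts_store_iff (w := x) (c := (Sym.opn, some d, ks)) (y := y) (R := R)
        hE.ne_nil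
      rw [h, h', completes_cons_iff (l := .opn) nofun]
      refine ih (.opn (m := []) d ks hR wellBracketed_nil ?_)
        (.concat .opn d none ks' ks _ hE nofun)
      rw [hks, hE.length]
    | cls =>
      rw [completes_cons_iff (l := .cls) nofun]
      rcases hy with hy | hy
      · refine ⟨fun h => absurd h (not_read hE.ne_nil hnone (by rw [hy]; rfl)), ?_⟩
        rintro ⟨m, v, e, -, -, h, -⟩
        cases hR with
        | bot o ks hw =>
          rw [List.map_append, nonneg_append, List.map_append, nonneg_append] at h
          have h := h.1.2.2
          rw [(wellBracketed_iff.1 hw).2.2] at h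
          exact absurd h (by simp [Nonneg, val])
        | opn => cases hy
      · obtain ⟨ks, hks, h⟩ := read_push (q := .ready) (x := y) (R := R) (w := x) (a := .cls)
          (d := d) (q' := .store₁) (β := .cls) hE.ne_nil hnone (by rw [hy]; rfl)
        obtain ⟨ks', h'⟩ := accepts_store_iff (w := x) (c := (Sym.cls, some d, ks)) (y := y)
          (R := R) hE.ne_nil
        have hE' : Hist (w ++ [(Letter.cls, d)])
            (((Sym.aux, none, ks') :: (Sym.cls, some d, ks) :: y :: R) :: E) :=
          .concat .cls d none ks' ks _ hE nofun
        obtain ⟨z, R', hzR⟩ : ∃ z R', R = z :: R' := by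
          cases hR with
          | bot => cases hy
          | opn _ _ hR => exact List.exists_cons_of_ne_nil hR.ne_nil
        subst hzR
        rw [h, h', eps_pop (q := .ready) (q' := .cancel) nofun hE'.ne_nil rfl,
          eps_pop (q := .cancel) (q' := .ready) nofun hE'.ne_nil rfl]
        refine ih ?_ hE'
        cases hR with
        | opn e ks₀ hR hm hks₀ => exact (Unclosed.opn e ks₀ hR hm hks₀).close
    | dollar =>
      obtain ⟨ks, hks, h⟩ := read_push (q := .ready) (x := y) (R := R) (w := x) (a := .dollar)
        (d := d) (q' := .dollar) (β := .aux) hE.ne_nil hnone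
        (by rcases hy with h | h <;> rw [h] <;> rfl)
      rw [h, eps_pop (q := .dollar) (q' := .turn) nofun hE.ne_nil rfl, accepts_turn_iff hR hE,
        completes_dollar_iff hR.dollar_notMem hR.nonneg]

theorem isMirror_iff {p v : DataWord Letter D} (hp : Letter.dollar ∉ p.map Prod.fst) :
    IsMirror p v ↔ v = mirror p := by
  refine ⟨fun h => ?_, fun h => h ▸ isMirror_mirror hp⟩
  unfold IsMirror at h
  rw [← List.reverse_reverse v]
  generalize v.reverse = v' at h
  unfold mirror
  congr 1
  induction h with
  | nil => rfl
  | @cons x y p v h _ ih =>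
    rw [List.map_cons, ih (fun h => hp (List.mem_cons_of_mem _ h))]
    congr 1
    obtain ⟨l, d⟩ := x
    obtain ⟨l', d'⟩ := y
    obtain ⟨rfl, ⟨rfl, rfl⟩ | ⟨rfl, rfl⟩⟩ := h <;> rfl

theorem completes_nil_iff {w : DataWord Letter D} : Completes [] w ↔ w ∈ langU D := by
  constructor
  · rintro ⟨q, v, d, rfl, h1, h2, p, m, h3, hm, hp, rfl⟩
    rw [List.nil_append] at h1 h2 h3
    subst h3
    have h1' : Letter.dollar ∉ p.map Prod.fst := fun h => h1 (by simp_all)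
    refine ⟨p, m, _, d, rfl, ?_, isMirror_mirror h1', hm, hp⟩
    rw [List.map_append, wellBracketed_iff]
    have h2' := h2
    rw [List.map_append, nonneg_append] at h2'
    have hb : bal ((p ++ m).map Prod.fst) = bal (p.map Prod.fst) := by
      rw [List.map_append, bal_append, (wellBracketed_iff.1 hm).2.2, add_zero]
    refine ⟨?_, nonneg_append.2 ⟨h2, ?_⟩, ?_⟩
    · rw [List.mem_append]
      exact fun h => h.elim h1 (dollar_notMem_mirror h1')
    · rw [hb]
      exact nonneg_mirror h2'.1
    · rw [bal_append, hb, bal_mirror, add_neg_cancel]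
  · rintro ⟨p, m, v, d, rfl, h1, h2, hm, hp⟩
    rw [List.map_append, wellBracketed_iff, nonneg_append, List.mem_append] at h1
    have h1' : Letter.dollar ∉ p.map Prod.fst := fun h => h1.1 (.inl (by simp_all))
    exact ⟨p ++ m, v, d, rfl, fun h => h1.1 (.inl h), h1.2.1.1, p, m, rfl, hm, hp,
      (isMirror_iff h1').1 h2⟩

theorem language_automaton : automaton.language D = langU D := by
  ext w
  rw [← completes_nil_iff]
  have h : w ∈ automaton.language D ↔
      automaton.Accepts State.start [[((Sym.bot, none, fun _ => 1) : Cell D)]] w :=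
    ⟨fun ⟨c, h⟩ => ⟨(automaton.init D).wf, c, h⟩, fun ⟨_, c, h⟩ => ⟨c, h⟩⟩
  obtain ⟨ks, h'⟩ := eps_push_two (q := .start) (x := ((Sym.bot, none, fun _ => 1) : Cell D))
    (R := []) (E := []) (w := w) nofun (by simp) rfl
  rw [h, h']
  exact accepts_ready_iff (.bot _ _ wellBracketed_nil) (.nil _ _)

end Bracket

theorem theorem1 (D : Type*) [Infinite D] :
    (∃ M : CPAD Letter 2, M.language D = langU D) ∧
      ∀ (n : ℕ) (M : HOPAD Letter n), M.language D ≠ langU D :=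
  ⟨⟨Bracket.automaton, Bracket.language_automaton⟩, fun _ M => M.language_ne_langU⟩
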